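/- Let $\theta\in\mathbb R$ be irrational, $\Theta=\begin{pmatrix}0&\theta\\-\theta&0\end{pmatrix}$, and $\sigma_\Theta(x,y)=e^{-\pi i\langle x,\Theta y\rangle}$ for $x,y\in\mathbb Z^2$. Let $B$ be the quantum torus $\mathbb C\rtimes^{\sigma_\Theta}\mathbb Z^2$, i.e. the C*-algebra generated by unitaries $W_x$ ($x\in\mathbb Z^2$) with $W_x^*=W_{-x}$ and $W_xW_y=\sigma_\Theta(x,y)W_{x+y}$. Let $\tau_B$ be its trace, $\tau_B(W_x)=\delta_{x,0}$, let $L^2(B,\tau_B)$ be its GNS space with GNS representation $\pi_{\tau_B}$ and canonical map $\iota_B:B\to L^2(B,\tau_B)$, and let $\mathcal T_B=\{\sum_r\alpha_rW_r:\ \sup_r(1+r_1^2+r_2^2)^k|\alpha_r|^2<\infty\ \ \forall k\in\mathbb N\}$. Let $\delta_j^B$ ($j=1,2$) be the derivation with domain $\iota_B(\mathcal T_B)$ and $\delta^B_j(\iota_B(W_r))=2\pi i\,r_j\,\iota_B(W_r)$, and let $D^{\pm}$ be the closure of $-i(\delta_1^B\pm i\delta_2^B)$; so $\begin{pmatrix}0&D^-\\D^+&0\end{pmatrix}$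 is the standard (even) Dirac operator of $B$ on $L^2(B,\tau_B)\oplus L^2(B,\tau_B)$. Let $M\in M_2(\mathbb Z)$ with $\det M>1$, $\widehat M=(M^{-1})^T$, $G=\mathbb Z^2/M\mathbb Z^2$. The group $G$ acts on $B$ by $\gamma_{t+M\mathbb Z^2}(W_x)=e^{2\pi i\langle M^{-1}t,x\rangle}W_x$; let $A=B^\gamma$ be the fixed-point algebra and $\mathcal T_A=A\cap\mathcal T_B$. The dual group is $\widehat G=\widehat M\mathbb Z^2/\mathbb Z^2\cong\mathbb Z^2/M^T\mathbb Z^2$; for $\widehat g\in\widehat G$ let $\zeta(\widehat g)\in[0,1)^2$ be its representative and $s(\widehat g)=M^T\zeta(\widehat g)\in\mathbb Z^2$. Put $\mu_{\widehat g}=W_{s(\widehat g)}$, $\rho_j(a)=\mu_ja\mu_j^*$ and $\sigma_{j,k}=\mu_j\mu_k\mu_{j+k}^*$ for $j,k\in\widehat G$, $a\in A$. Then $(\rho,\sigma)$ is a twisted action of $\widehat G$ on $A$. Let $A\rtimes_r^{\rho,\sigma}\widehat G$ be the reduced twisted crossed product, with elements $\sum_j a_j\delta_j$ and $(a\delta_j)(b\delta_k)=a\rho_j(b)\sigma_{j,k}\delta_{j+k}$,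 defined by the left regular representation induced by any faithful representation of $A$, and let $C(\widehat G,\mathcal T_A)=\{\sum_j a_j\delta_j:\ a_j\in\mathcal T_A\}$. Let $V=\mathbb C^2$, $\boldsymbol\ell(\widehat g)=\begin{pmatrix}0&s_1-is_2\\s_1+is_2&0\end{pmatrix}$ with $(s_1,s_2)=s(\widehat g)$, and $M_{\boldsymbol\ell}(\delta_{\widehat g}\otimes v)=\delta_{\widehat g}\otimes\boldsymbol\ell(\widehat g)v$ on $\ell^2(\widehat G)\otimes V$. Put $\widetilde H=(L^2(B,\tau_B)\otimes\ell^2(\widehat G)\otimes V)\oplus(L^2(B,\tau_B)\otimes\ell^2(\widehat G)\otimes V)$ and $$\widetilde D=\begin{pmatrix}I\otimes M_{\boldsymbol\ell}&D^-\otimes I\otimes I\\ D^+\otimes I\otimes I&-I\otimes M_{\boldsymbol\ell}\end{pmatrix}.$$ Then $\Phi(a\delta_j)=a\mu_j$ defines a $*$-isomorphism $\Phi:A\rtimes_r^{\rho,\sigma}\widehat G\to B$. Moreover there is a representation $\hat\pi\times\hat L:A\rtimes_r^{\rho,\sigma}\widehat G\to\mathbb B(\widetilde H)$ such that $(\hat\pi\times\hat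 L)(a\delta_j)$ acts on each of the two summands by $\xi\otimes\delta_g\otimes v\mapsto\pi_{\tau_B}(a)\pi_{\tau_B}(\mu_j)\xi\otimes\delta_{j+g}\otimes v$ for all $a\in A$, $j\in\widehat G$. It is determined by the formula $$(\hat\pi\times\hat L)(W_{M^Tx}\delta_j)\begin{pmatrix}\iota_B(W_m)\otimes\delta_g\otimes v\\ \iota_B(W_n)\otimes\delta_h\otimes w\end{pmatrix}=\begin{pmatrix}e^{-\pi i[\langle M^Tx,\Theta s(j)\rangle+\langle M^Tx+s(j),\Theta m\rangle]}\,\iota_B(W_{m+M^Tx+s(j)})\otimes\delta_{j+g}\otimes v\\ e^{-\pi i[\langle M^Tx,\Theta s(j)\rangle+\langle M^Tx+s(j),\Theta n\rangle]}\,\iota_B(W_{n+M^Tx+s(j)})\otimes\delta_{j+h}\otimes w\end{pmatrix}$$ for $x,m,n\in\mathbb Z^2$, $j,g,h\in\widehat G$, $v,w\in V$. The operator $\widetilde D$ is self-adjoint and $$\widetilde D\begin{pmatrix}\iota_B(W_m)\otimes\delta_g\otimes v\\ \iota_B(W_n)\otimes\delta_h\otimes w\end{pmatrix}=\begin{pmatrix}\iota_B(W_m)\otimes\delta_g\otimes\boldsymbol\ell(g)v+2\pi(n_1-in_2)\,\iota_B(W_n)\otimes\delta_h\otimes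 w\\ 2\pi(m_1+im_2)\,\iota_B(W_m)\otimes\delta_g\otimes v-\iota_B(W_n)\otimes\delta_h\otimes\boldsymbol\ell(h)w\end{pmatrix}.$$ Finally, $(C(\widehat G,\mathcal T_A),\hat\pi\times\hat L,\widetilde H,\widetilde D)$ is an odd spectral triple on $A\rtimes_r^{\rho,\sigma}\widehat G$: $C(\widehat G,\mathcal T_A)$ is a dense $*$-subalgebra, $(1+\widetilde D^2)^{-1/2}$ is compact, and every element of $C(\widehat G,\mathcal T_A)$ preserves $\operatorname{Dom}\widetilde D$ and has bounded commutator with $\widetilde D$. This triple is regular: for every $c\in C(\widehat G,\mathcal T_A)$ both $(\hat\pi\times\hat L)(c)$ and the bounded extension of $[\widetilde D,(\hat\pi\times\hat L)(c)]$ lie in the domain of $\delta^k$ for all $k\ge1$, where $\delta=[|\widetilde D|,\cdot\,]$. -/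

import Mathlib

open scoped ComplexOrder InnerProductSpace

noncomputable section

namespace QTorus

/-! ### Weighted shifts on `ℓ²(G, K)` -/

/-- The Hilbert space `ℓ²(G, K) ≅ K ⊗ ℓ²(G)`. -/
abbrev Ell2 (G K : Type*) [NormedAddCommGroup K] : Type _ := lp (fun _ : G => K) 2

section Shift

variable {G K : Type*} [NormedAddCommGroup K] [InnerProductSpace ℂ K]

theorem shift_summable (e : G ≃ G) (T : G → K →L[ℂ] K) (c : ℝ) (hT : ∀ z, ‖T z‖ ≤ c)
    (f : Ell2 G K) :
    (∀ z, ‖T z (f (e z))‖ ^ (2 : ENNReal).toReal ≤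
      c ^ (2 : ENNReal).toReal * ‖f (e z)‖ ^ (2 : ENNReal).toReal) ∧
    HasSum (fun z => c ^ (2 : ENNReal).toReal * ‖f (e z)‖ ^ (2 : ENNReal).toReal)
      (c ^ (2 : ENNReal).toReal * ‖f‖ ^ (2 : ENNReal).toReal) := by
  constructor
  · intro z
    have hc : 0 ≤ c := (norm_nonneg _).trans (hT z)
    rw [← Real.mul_rpow hc (norm_nonneg _)]
    exact Real.rpow_le_rpow (norm_nonneg _)
      (((T z).le_opNorm _).trans (mul_le_mul_of_nonneg_right (hT z) (norm_nonneg _)))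
      (by norm_num)
  · have h := lp.hasSum_norm (p := 2) (by norm_num) f
    exact ((Equiv.hasSum_iff e).2 h).mul_left _

/-- The bounded operator `(S f)(z) = T_z (f (e z))` on `ℓ²(G, K)`, for a permutation `e` of `G` and
a uniformly bounded family of operators `T_z` on `K`. -/
def weightedShift (e : G ≃ G) (T : G → K →L[ℂ] K) (c : ℝ) (hT : ∀ z, ‖T z‖ ≤ c) :
    Ell2 G K →L[ℂ] Ell2 G K :=
  LinearMap.mkContinuous
    { toFun := fun f => ⟨fun z => T z (f (e z)), memℓp_gen <|
        Summable.of_nonneg_of_le (fun z => by positivity) (shift_summable e T c hT f).1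
          (shift_summable e T c hT f).2.summable⟩
      map_add' := fun f g => by
        apply lp.ext
        funext z
        exact map_add (T z) (f (e z)) (g (e z))
      map_smul' := fun a f => by
        apply lp.ext
        funext z
        exact map_smul (T z) a (f (e z)) }
    |c| (fun f => by
      refine lp.norm_le_of_tsum_le (p := 2) (by norm_num) (by positivity) ?_
      have h := shift_summable e T c hT f
      have hs : Summable fun z => ‖T z (f (e z))‖ ^ (2 : ENNReal).toReal :=
        Summable.of_nonneg_of_le (fun z => by positivity) h.1 h.2.summable
      refine (hs.tsum_le_tsum h.1 h.2.summable).trans ?_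
      rw [h.2.tsum_eq, Real.mul_rpow (abs_nonneg _) (norm_nonneg _)]
      have h2 : c ^ (2 : ENNReal).toReal = |c| ^ (2 : ENNReal).toReal := by simp
      rw [h2])

@[simp]
theorem weightedShift_apply (e : G ≃ G) (T : G → K →L[ℂ] K) (c : ℝ) (hT : ∀ z, ‖T z‖ ≤ c)
    (f : Ell2 G K) (z : G) : weightedShift e T c hT f z = T z (f (e z)) := rfl

end Shift

/-! ### Twisted actions and reduced twisted crossed products -/

/-- A twisting pair `(ρ, σ)` for a unital C⋆-algebra `A` and a discrete group `G` (written
additively). -/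
structure TwistingPair (A G : Type*) [CStarAlgebra A] [AddGroup G] where
  ρ : G → (A ≃⋆ₐ[ℂ] A)
  σ : G → G → unitary A
  ρ_σ : ∀ x y z, ρ x (σ y z : A) = (σ x y : A) * (σ (x + y) z : A) * star (σ x (y + z) : A)
  ρ_ρ : ∀ x y a, ρ x (ρ y a) = (σ x y : A) * ρ (x + y) a * star (σ x y : A)
  σ_zero_right : ∀ x, σ x 0 = 1
  σ_zero_left : ∀ x, σ 0 x = 1
  ρ_zero : ∀ a, ρ 0 a = a

section Crossed

variable {A G K : Type*} [CStarAlgebra A] [AddGroup G]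
  [NormedAddCommGroup K] [InnerProductSpace ℂ K] [CompleteSpace K]

theorem leftRegular_bound (P : TwistingPair A G) (π : A →⋆ₐ[ℂ] (K →L[ℂ] K)) (a : A) (x z : G) :
    ‖π (P.ρ (-z) a * (P.σ (-z) x : A))‖ ≤ ‖a‖ := by
  refine (NonUnitalStarAlgHom.norm_apply_le π _).trans ?_
  rw [CStarRing.norm_mul_coe_unitary]
  exact NonUnitalStarAlgHom.norm_apply_le (P.ρ (-z)) a

/-- The operator `Π(a δ_x)` of the left regular representation on `ℓ²(G, K)` induced by `π`:
`Π(a δ_x)(ξ ⊗ δ_y) = π(ρ_{-(x+y)}(a) σ_{-(x+y),x}) ξ ⊗ δ_{x+y}`. -/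
def leftRegular (P : TwistingPair A G) (π : A →⋆ₐ[ℂ] (K →L[ℂ] K)) (a : A) (x : G) :
    Ell2 G K →L[ℂ] Ell2 G K :=
  weightedShift (Equiv.addLeft (-x)) (fun z => π (P.ρ (-z) a * (P.σ (-z) x : A))) ‖a‖
    (leftRegular_bound P π a x)

/-- The reduced twisted crossed product: the C⋆-algebra generated by the image of the left regular
representation induced by `π` (to be used with `π` faithful). -/
def reducedCrossedProduct (P : TwistingPair A G) (π : A →⋆ₐ[ℂ] (K →L[ℂ] K)) :
    StarSubalgebra ℂ (Ell2 G K →L[ℂ] Ell2 G K) :=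
  (StarAlgebra.adjoin ℂ
    (Set.range fun p : A × G => leftRegular P π p.1 p.2)).topologicalClosure

instance (P : TwistingPair A G) (π : A →⋆ₐ[ℂ] (K →L[ℂ] K)) :
    IsClosed (reducedCrossedProduct P π : Set (Ell2 G K →L[ℂ] Ell2 G K)) :=
  StarSubalgebra.isClosed_topologicalClosure _

/-- The element `a δ_x` of the reduced twisted crossed product. -/
def crossedElem (P : TwistingPair A G) (π : A →⋆ₐ[ℂ] (K →L[ℂ] K)) (a : A) (x : G) :
    reducedCrossedProduct P π :=
  ⟨leftRegular P π a x,
    StarSubalgebra.le_topologicalClosure _ (StarAlgebra.subset_adjoin ℂ _ ⟨(a, x), rfl⟩)⟩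

/-- The subspace `C(G, 𝒜)` of the reduced twisted crossed product by a finite group: the elements
`∑ a_x δ_x` with all `a_x` in `𝒜`. -/
def crossedSmooth [Fintype G] (P : TwistingPair A G) (π : A →⋆ₐ[ℂ] (K →L[ℂ] K)) (𝒜 : Set A) :
    Set (reducedCrossedProduct P π) :=
  {c | ∃ f : G → A, (∀ x, f x ∈ 𝒜) ∧ c = ∑ x, crossedElem P π (f x) x}

end Crossed

/-! ### Twisting pairs from frames -/

section Frame

variable {B G : Type*} [CStarAlgebra B] [AddGroup G]

/-- The twisting pair `ρ_j(a) = μ_j a μ_j^*`, `σ_{j,k} = μ_j μ_k μ_{j+k}^*` of a family of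
unitaries `μ`, for a closed ⋆-subalgebra `A` for which these formulas make sense. -/
def frameTwistingPair (A : StarSubalgebra ℂ B) [IsClosed (A : Set B)] (μ : G → unitary B)
    (h₀ : μ 0 = 1)
    (h₁ : ∀ j, ∀ a ∈ A, (μ j : B) * a * star (μ j : B) ∈ A)
    (h₂ : ∀ j, ∀ a ∈ A, star (μ j : B) * a * (μ j : B) ∈ A)
    (h₃ : ∀ j k, ((μ j * μ k * star (μ (j + k)) : unitary B) : B) ∈ A) :
    TwistingPair A G where
  ρ j := StarAlgEquiv.ofBijective
    ({ toFun := fun a => ⟨(μ j : B) * a * star (μ j : B), h₁ j a a.2⟩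
       map_one' := by ext; simp
       map_zero' := by ext; simp
       map_mul' := fun a b => by
        ext
        have h : star (μ j : B) * (μ j : B) = 1 := by simp
        calc (μ j : B) * (a * b) * star (μ j : B)
            = (μ j : B) * a * 1 * b * star (μ j : B) := by simp [mul_assoc]
          _ = (μ j : B) * a * star (μ j : B) * ((μ j : B) * b * star (μ j : B)) := by
            rw [← h]; simp only [mul_assoc]
       map_add' := fun a b => by ext; simp [mul_add, add_mul]
       commutes' := fun r => by
        ext
        simp [Algebra.algebraMap_eq_smul_one]
       map_star' := fun a => by ext; simp [mul_assoc] } : A →⋆ₐ[ℂ] A)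
    ⟨fun a b hab => by
      have h := congrArg Subtype.val hab
      have h' : star (μ j : B) * ((μ j : B) * a * star (μ j : B)) * (μ j : B) =
          star (μ j : B) * ((μ j : B) * b * star (μ j : B)) * (μ j : B) :=
        congrArg (fun t => star (μ j : B) * t * (μ j : B)) h
      ext
      simpa [mul_assoc, ← mul_assoc (star (μ j : B)) (μ j : B)] using h',
     fun a => ⟨⟨star (μ j : B) * a * (μ j : B), h₂ j a a.2⟩, by
      ext
      change (μ j : B) * (star (μ j : B) * a * (μ j : B)) * star (μ j : B) = a
      simp [mul_assoc, ← mul_assoc (μ j : B) (star (μ j : B))]⟩⟩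
  σ j k := ⟨⟨((μ j * μ k * star (μ (j + k)) : unitary B) : B), h₃ j k⟩, by
    rw [Unitary.mem_iff]
    constructor <;> ext
    · exact (Unitary.mem_iff.1 (μ j * μ k * star (μ (j + k))).2).1
    · exact (Unitary.mem_iff.1 (μ j * μ k * star (μ (j + k))).2).2⟩
  ρ_σ x y z := by
    ext
    change ((μ x * (μ y * μ z * star (μ (y + z))) * star (μ x) : unitary B) : B) =
      ((μ x * μ y * star (μ (x + y)) * (μ (x + y) * μ z * star (μ (x + y + z))) *
        star (μ x * μ (y + z) * star (μ (x + (y + z)))) : unitary B) : B)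
    congr 1
    simp only [Unitary.star_eq_inv, add_assoc]
    group
  ρ_ρ x y a := by
    ext
    have h : star (μ (x + y) : B) * (μ (x + y) : B) = 1 := by simp
    change (μ x : B) * ((μ y : B) * a * star (μ y : B)) * star (μ x : B) =
      ((μ x : B) * (μ y : B) * star (μ (x + y) : B)) * ((μ (x + y) : B) * a * star (μ (x + y) : B)) *
        star ((μ x : B) * (μ y : B) * star (μ (x + y) : B))
    simp [mul_assoc, ← mul_assoc (star (μ (x + y) : B)) (μ (x + y) : B)]
  σ_zero_right x := by ext; simp [h₀]
  σ_zero_left x := by ext; simp [h₀]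
  ρ_zero a := by
    ext
    change ((μ 0 : unitary B) : B) * a * star ((μ 0 : unitary B) : B) = a
    simp [h₀]

end Frame

/-! ### Spectral triples and regularity -/

section Triples

variable {H : Type*} [NormedAddCommGroup H] [InnerProductSpace ℂ H]

/-- The bounded operator `S` preserves the domain of `D` and `[D, S]` extends to the bounded
operator `C`. -/
def IsBddCommutator (D : H →ₗ.[ℂ] H) (S C : H →L[ℂ] H) : Prop :=
  ∀ x : D.domain, ∃ h : S x ∈ D.domain, D ⟨S x, h⟩ - S (D x) = C x

/-- The graph of `D²`, on its natural domain. -/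
def sqGraph (D : H →ₗ.[ℂ] H) : Set (H × H) :=
  {p | ∃ y, (p.1, y) ∈ D.graph ∧ (y, p.2) ∈ D.graph}

/-- `R` is the operator `(1 + D²)^{-1/2}`: the positive bounded operator whose square is the
everywhere defined inverse of `1 + D²`. -/
def IsInvSqrtOneAddSq (D : H →ₗ.[ℂ] H) (R : H →L[ℂ] H) : Prop :=
  R.IsPositive ∧ ∀ x, (R (R x), x - R (R x)) ∈ sqGraph D

/-- `T` is the operator `|D|`: the positive self-adjoint operator with `T² = D²`. -/
def IsAbs [CompleteSpace H] (D T : H →ₗ.[ℂ] H) : Prop :=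
  IsSelfAdjoint T ∧ (∀ x : T.domain, 0 ≤ ⟪(x : H), T x⟫_ℂ) ∧ sqGraph T = sqGraph D

/-- `S ∈ Dom(δ^k)` for the derivation `δ = [T, ·]`. -/
def MemDomDelta (T : H →ₗ.[ℂ] H) : ℕ → (H →L[ℂ] H) → Prop
  | 0, _ => True
  | k + 1, S => ∃ C, IsBddCommutator T S C ∧ MemDomDelta T k C

/-- `S ∈ Dom^∞(δ)` for the derivation `δ = [T, ·]`. -/
def MemDomDeltaInf (T : H →ₗ.[ℂ] H) (S : H →L[ℂ] H) : Prop := ∀ k, MemDomDelta T k S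

variable [CompleteSpace H] {C : Type*} [CStarAlgebra C]

/-- `(𝒞, H, D, π)` is an odd spectral triple on the unital C⋆-algebra `C`. -/
structure IsOddSpectralTriple (𝒞 : Set C) (π : C →⋆ₐ[ℂ] (H →L[ℂ] H)) (D : H →ₗ.[ℂ] H) : Prop where
  isStarSubalgebra : ∃ S : StarSubalgebra ℂ C, (S : Set C) = 𝒞
  dense : Dense 𝒞
  dense_domain : Dense (D.domain : Set H)
  selfAdjoint : IsSelfAdjoint D
  compact : ∃ R : H →L[ℂ] H, IsInvSqrtOneAddSq D R ∧ IsCompactOperator R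
  commutator : ∀ a ∈ 𝒞, ∃ E, IsBddCommutator D (π a) E

/-- Regularity: `π(𝒞)` and `[D, π(𝒞)]` lie in `Dom^∞(δ)`, where `δ = [|D|, ·]`. -/
def IsRegularTriple (𝒞 : Set C) (π : C →⋆ₐ[ℂ] (H →L[ℂ] H)) (D : H →ₗ.[ℂ] H) : Prop :=
  ∃ T, IsAbs D T ∧ ∀ a ∈ 𝒞, MemDomDeltaInf T (π a) ∧
    ∃ E, IsBddCommutator D (π a) E ∧ MemDomDeltaInf T E

end Triples

/-! ### The equivariant construction, even to odd, for a finite group and `V = ℂ²` -/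

section Equivariant

variable {G H : Type*} [AddGroup G] [Fintype G] [NormedAddCommGroup H] [InnerProductSpace ℂ H]

/-- The Hilbert space `H ⊗ ℓ²(G) ⊗ ℂ²` for a finite group `G`. -/
abbrev Tens (G H : Type*) [Fintype G] [NormedAddCommGroup H] : Type _ :=
  PiLp 2 (fun _ : G × Fin 2 => H)

open Classical in
/-- The elementary tensor `ξ ⊗ δ_g ⊗ v`. -/
def tens (ξ : H) (g : G) (v : EuclideanSpace ℂ (Fin 2)) : Tens G H :=
  WithLp.toLp 2 fun p => if p.1 = g then v p.2 • ξ else 0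

/-- The operator `T ⊗ λ_h ⊗ 1`, i.e. `ξ ⊗ δ_g ⊗ v ↦ T ξ ⊗ δ_{h+g} ⊗ v`. -/
def ampShift (T : H →L[ℂ] H) (h : G) : Tens G H →L[ℂ] Tens G H :=
  ((PiLp.continuousLinearEquiv 2 ℂ (fun _ : G × Fin 2 => H)).symm :
      (G × Fin 2 → H) →L[ℂ] Tens G H) ∘L
    (ContinuousLinearMap.pi fun p : G × Fin 2 =>
      T ∘L ContinuousLinearMap.proj (R := ℂ) (φ := fun _ : G × Fin 2 => H) (-h + p.1, p.2)) ∘L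
    ((PiLp.continuousLinearEquiv 2 ℂ (fun _ : G × Fin 2 => H)) :
      Tens G H →L[ℂ] (G × Fin 2 → H))

/-- The operator `1 ⊗ M_ℓ`, i.e. `ξ ⊗ δ_g ⊗ v ↦ ξ ⊗ δ_g ⊗ ℓ(g) v`. -/
def lengthMul (ℓ : G → Matrix (Fin 2) (Fin 2) ℂ) : Tens G H →ₗ[ℂ] Tens G H where
  toFun x := WithLp.toLp 2 fun p => ∑ k, ℓ p.1 p.2 k • x (p.1, k)
  map_add' x y := by
    ext p
    simp [Finset.sum_add_distrib]
  map_smul' c x := by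
    ext p
    simp only [PiLp.smul_apply, RingHom.id_apply, Finset.smul_sum]
    exact Finset.sum_congr rfl fun k _ => smul_comm _ _ _

/-- The Hilbert space `(H⁺ ⊗ ℓ²(G) ⊗ ℂ²) ⊕ (H⁻ ⊗ ℓ²(G) ⊗ ℂ²)` with `H⁺ = H⁻ = H`. -/
abbrev EquivHilb (G H : Type*) [Fintype G] [NormedAddCommGroup H] : Type _ :=
  WithLp 2 (Tens G H × Tens G H)

/-- The operator `(π̂ × L̂)(a δ_h)`, where `T⁺ = π⁺(a) U⁺_h` and `T⁻ = π⁻(a) U⁻_h`: the diagonal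
operator with entries `T^± ⊗ λ_h ⊗ 1`. -/
def equivRep (Tp Tm : H →L[ℂ] H) (h : G) : EquivHilb G H →L[ℂ] EquivHilb G H :=
  ((WithLp.prodContinuousLinearEquiv 2 ℂ (Tens G H) (Tens G H)).symm :
      Tens G H × Tens G H →L[ℂ] EquivHilb G H) ∘L
    ((ampShift Tp h).prodMap (ampShift Tm h)) ∘L
    ((WithLp.prodContinuousLinearEquiv 2 ℂ (Tens G H) (Tens G H)) :
      EquivHilb G H →L[ℂ] Tens G H × Tens G H)

/-- The Dirac operator of the equivariant construction,
`[[1 ⊗ M_ℓ, D⁻ ⊗ 1 ⊗ 1], [D⁺ ⊗ 1 ⊗ 1, - 1 ⊗ M_ℓ]]`. -/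
def equivDirac (Dp Dm : H →ₗ.[ℂ] H) (ℓ : G → Matrix (Fin 2) (Fin 2) ℂ) :
    EquivHilb G H →ₗ.[ℂ] EquivHilb G H where
  domain :=
    { carrier := {x | (∀ p, x.fst p ∈ Dp.domain) ∧ ∀ p, x.snd p ∈ Dm.domain}
      add_mem' := fun hx hy =>
        ⟨fun p => add_mem (hx.1 p) (hy.1 p), fun p => add_mem (hx.2 p) (hy.2 p)⟩
      zero_mem' := ⟨fun _ => zero_mem _, fun _ => zero_mem _⟩
      smul_mem' := fun c _ hx =>
        ⟨fun p => Submodule.smul_mem _ c (hx.1 p), fun p => Submodule.smul_mem _ c (hx.2 p)⟩ }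
  toFun :=
    { toFun := fun x => WithLp.toLp 2
        (lengthMul ℓ (x : EquivHilb G H).fst + WithLp.toLp 2 fun p => Dm ⟨_, x.2.2 p⟩,
          (WithLp.toLp 2 fun p => Dp ⟨_, x.2.1 p⟩) - lengthMul ℓ (x : EquivHilb G H).snd)
      map_add' := fun x y => by
        have h1 : ∀ p, Dp ⟨_, (x + y).2.1 p⟩ = Dp ⟨_, x.2.1 p⟩ + Dp ⟨_, y.2.1 p⟩ := fun p =>
          Dp.map_add ⟨_, x.2.1 p⟩ ⟨_, y.2.1 p⟩
        have h2 : ∀ p, Dm ⟨_, (x + y).2.2 p⟩ = Dm ⟨_, x.2.2 p⟩ + Dm ⟨_, y.2.2 p⟩ := fun p =>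
          Dm.map_add ⟨_, x.2.2 p⟩ ⟨_, y.2.2 p⟩
        simp only [h1, h2]
        apply WithLp.ofLp_injective 2
        apply Prod.ext <;> ext p
        · simp
          abel
        · simp
          abel
      map_smul' := fun c x => by
        have h1 : ∀ p, Dp ⟨_, (c • x).2.1 p⟩ = c • Dp ⟨_, x.2.1 p⟩ := fun p =>
          Dp.map_smul c ⟨_, x.2.1 p⟩
        have h2 : ∀ p, Dm ⟨_, (c • x).2.2 p⟩ = c • Dm ⟨_, x.2.2 p⟩ := fun p =>
          Dm.map_smul c ⟨_, x.2.2 p⟩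
        simp only [h1, h2]
        apply WithLp.ofLp_injective 2
        apply Prod.ext <;> ext p
        · simp
        · simp [smul_sub] }

end Equivariant

/-! ### The quantum torus -/

section Torus

/-- The lattice `ℤ²`. -/
abbrev Z2 : Type := Fin 2 → ℤ

/-- `⟨x, Θ y⟩` for `Θ = [[0, θ], [-θ, 0]]`. -/
def thetaForm (θ : ℝ) (x y : Z2) : ℝ :=
  (fun i => (x i : ℝ)) ⬝ᵥ (!![0, θ; -θ, 0]).mulVec fun i => (y i : ℝ)

/-- The skew bicharacter `σ_Θ(x, y) = exp(-π i ⟨x, Θ y⟩)`. -/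
def sigmaTheta (θ : ℝ) (x y : Z2) : ℂ :=
  Complex.exp (-(Real.pi * Complex.I) * thetaForm θ x y)

theorem thetaForm_eq (θ : ℝ) (x y : Z2) :
    thetaForm θ x y = θ * ((x 0 : ℝ) * y 1 - x 1 * y 0) := by
  simp [thetaForm, dotProduct, Matrix.mulVec, Fin.sum_univ_two]
  ring

theorem thetaForm_add_left (θ : ℝ) (x x' y : Z2) :
    thetaForm θ (x + x') y = thetaForm θ x y + thetaForm θ x' y := by
  simp only [thetaForm_eq, Pi.add_apply]; push_cast; ring

theorem thetaForm_add_right (θ : ℝ) (x y y' : Z2) :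
    thetaForm θ x (y + y') = thetaForm θ x y + thetaForm θ x y' := by
  simp only [thetaForm_eq, Pi.add_apply]; push_cast; ring

theorem thetaForm_neg_left (θ : ℝ) (x y : Z2) : thetaForm θ (-x) y = -thetaForm θ x y := by
  simp only [thetaForm_eq, Pi.neg_apply]; push_cast; ring

theorem thetaForm_neg_right (θ : ℝ) (x y : Z2) : thetaForm θ x (-y) = -thetaForm θ x y := by
  simp only [thetaForm_eq, Pi.neg_apply]; push_cast; ring

theorem thetaForm_self (θ : ℝ) (x : Z2) : thetaForm θ x x = 0 := by
  simp only [thetaForm_eq]; ring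

theorem thetaForm_swap (θ : ℝ) (x y : Z2) : thetaForm θ y x = -thetaForm θ x y := by
  simp only [thetaForm_eq]; ring

theorem sigmaTheta_star (θ : ℝ) (x y : Z2) :
    star (sigmaTheta θ x y) = Complex.exp (Real.pi * Complex.I * thetaForm θ x y) := by
  rw [sigmaTheta, Complex.star_def, ← Complex.exp_conj]
  simp

theorem sigmaTheta_mem_unitary (θ : ℝ) (x y : Z2) : sigmaTheta θ x y ∈ unitary ℂ := by
  rw [Unitary.mem_iff, sigmaTheta_star, sigmaTheta, ← Complex.exp_add, ← Complex.exp_add]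
  constructor <;> (rw [← Complex.exp_zero]; congr 1; ring)

/-- The twisted action `(id, σ_Θ)` of `ℤ²` on `ℂ`. -/
def torusPair (θ : ℝ) : TwistingPair ℂ Z2 where
  ρ _ := StarAlgEquiv.refl ℂ ℂ
  σ x y := ⟨sigmaTheta θ x y, sigmaTheta_mem_unitary θ x y⟩
  ρ_σ x y z := by
    change sigmaTheta θ y z = sigmaTheta θ x y * sigmaTheta θ (x + y) z *
      star (sigmaTheta θ x (y + z))
    rw [sigmaTheta_star]
    simp only [sigmaTheta, ← Complex.exp_add, thetaForm_add_left, thetaForm_add_right]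
    congr 1
    push_cast
    ring
  ρ_ρ x y a := by
    change a = sigmaTheta θ x y * a * star (sigmaTheta θ x y)
    rw [mul_right_comm, (Unitary.mem_iff.1 (sigmaTheta_mem_unitary θ x y)).2, one_mul]
  σ_zero_right x := by
    ext
    change sigmaTheta θ x 0 = 1
    simp [sigmaTheta, thetaForm_eq]
  σ_zero_left x := by
    ext
    change sigmaTheta θ 0 x = 1
    simp [sigmaTheta, thetaForm_eq]
  ρ_zero _ := rfl

/-- The representation of `ℂ` on the Hilbert space `ℂ` by scalar multiplication. -/
def scalarRep : ℂ →⋆ₐ[ℂ] (ℂ →L[ℂ] ℂ) :=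
  { Algebra.ofId ℂ (ℂ →L[ℂ] ℂ) with
    map_star' := fun c => by
      change algebraMap ℂ (ℂ →L[ℂ] ℂ) (star c) = star (algebraMap ℂ (ℂ →L[ℂ] ℂ) c)
      exact algebraMap_star_comm c }

/-- The quantum torus `B = ℂ ⋊_r^{σ_Θ} ℤ²`, concretely realized on `ℓ²(ℤ²)`. As `ℤ²` is amenable,
it is also the full crossed product, i.e. the universal C⋆-algebra of the relations of the `W_x`. -/
def QuantumTorus (θ : ℝ) : Type := reducedCrossedProduct (torusPair θ) scalarRep

instance (θ : ℝ) : CStarAlgebra (QuantumTorus θ) :=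
  inferInstanceAs (CStarAlgebra (reducedCrossedProduct (torusPair θ) scalarRep))

instance (θ : ℝ) : PartialOrder (QuantumTorus θ) := CStarAlgebra.spectralOrder _

instance (θ : ℝ) : StarOrderedRing (QuantumTorus θ) := CStarAlgebra.spectralOrderedRing _

/-- The inclusion of `B` in the bounded operators on `ℓ²(ℤ²)`. -/
def torusIncl (θ : ℝ) : QuantumTorus θ →⋆ₐ[ℂ] (Ell2 Z2 ℂ →L[ℂ] Ell2 Z2 ℂ) :=
  (reducedCrossedProduct (torusPair θ) scalarRep).subtype

theorem torusIncl_injective (θ : ℝ) : Function.Injective (torusIncl θ) :=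
  Subtype.val_injective

/-- The generators `W_x = 1 δ_x` of the quantum torus. -/
def W (θ : ℝ) (x : Z2) : QuantumTorus θ := crossedElem (torusPair θ) scalarRep 1 x

theorem torusIncl_W_apply (θ : ℝ) (x : Z2) (f : Ell2 Z2 ℂ) (z : Z2) :
    torusIncl θ (W θ x) f z = sigmaTheta θ x z * f (-x + z) := by
  change (scalarRep (StarAlgEquiv.refl ℂ ℂ 1 * sigmaTheta θ (-z) x)) (f (-x + z)) = _
  have h : sigmaTheta θ (-z) x = sigmaTheta θ x z := by
    rw [sigmaTheta, sigmaTheta, thetaForm_neg_left, thetaForm_swap, neg_neg]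
  rw [h]
  change (algebraMap ℂ (ℂ →L[ℂ] ℂ) (1 * sigmaTheta θ x z)) (f (-x + z)) = _
  simp [Algebra.algebraMap_eq_smul_one]

theorem W_mul (θ : ℝ) (x y : Z2) : W θ x * W θ y = sigmaTheta θ x y • W θ (x + y) := by
  apply torusIncl_injective
  rw [map_mul, map_smul]
  ext f z
  change torusIncl θ (W θ x) (torusIncl θ (W θ y) f) z =
    sigmaTheta θ x y * torusIncl θ (W θ (x + y)) f z
  rw [torusIncl_W_apply, torusIncl_W_apply, torusIncl_W_apply, ← mul_assoc, ← mul_assoc]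
  congr 1
  · simp only [sigmaTheta, ← Complex.exp_add, thetaForm_add_left, thetaForm_add_right,
      thetaForm_neg_right, thetaForm_swap θ x y]
    congr 1
    push_cast
    ring
  · rw [neg_add_rev, add_assoc]

theorem W_zero (θ : ℝ) : W θ 0 = 1 := by
  apply torusIncl_injective
  rw [map_one]
  ext f z
  rw [torusIncl_W_apply]
  simp [sigmaTheta, thetaForm_eq]

theorem W_star (θ : ℝ) (x : Z2) : star (W θ x) = W θ (-x) := by
  apply torusIncl_injective
  rw [map_star, ContinuousLinearMap.star_eq_adjoint, eq_comm, ContinuousLinearMap.eq_adjoint_iff]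
  intro f g
  rw [lp.inner_eq_tsum, lp.inner_eq_tsum, ← (Equiv.addLeft (-x)).tsum_eq]
  congr 1
  funext z
  have h : torusIncl θ (W θ (-x)) f (-x + z) = star (sigmaTheta θ x z) * f z := by
    rw [torusIncl_W_apply, sigmaTheta_star, sigmaTheta]
    congr 2
    · rw [thetaForm_neg_left, thetaForm_add_right, thetaForm_neg_right, thetaForm_self]
      push_cast
      ring
    · simp
  rw [torusIncl_W_apply θ x g]
  change ⟪torusIncl θ (W θ (-x)) f (-x + z), g (-x + z)⟫_ℂ = _
  rw [h]
  simp only [RCLike.inner_apply, map_mul, Complex.star_def, Complex.conj_conj]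
  ring

theorem W_mem_unitary (θ : ℝ) (x : Z2) : W θ x ∈ unitary (QuantumTorus θ) := by
  have h : ∀ y : Z2, W θ (-y) * W θ y = 1 := fun y => by
    rw [W_mul, neg_add_cancel, W_zero, sigmaTheta, thetaForm_neg_left, thetaForm_self]
    simp
  rw [Unitary.mem_iff, W_star]
  exact ⟨h x, by simpa using h (-x)⟩

/-- The vector state `b ↦ ⟨δ_0, b δ_0⟩`; it is the trace `τ_B(∑ α_r W_r) = α_0`. -/
def torusTrace (θ : ℝ) : QuantumTorus θ →ₚ[ℂ] ℂ :=
  PositiveLinearMap.mk₀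
    { toFun := fun b => ⟪lp.single 2 0 (1 : ℂ), torusIncl θ b (lp.single 2 0 (1 : ℂ))⟫_ℂ
      map_add' := fun a b => by
        rw [map_add, add_apply, inner_add_right]
      map_smul' := fun c b => by
        rw [map_smul, smul_apply, inner_smul_right]
        rfl }
    (fun b hb => by
      obtain ⟨c, rfl⟩ := CStarAlgebra.nonneg_iff_eq_star_mul_self.1 hb
      change 0 ≤ ⟪lp.single 2 0 (1 : ℂ), torusIncl θ (star c * c) (lp.single 2 0 (1 : ℂ))⟫_ℂ
      rw [map_mul, map_star, ContinuousLinearMap.star_eq_adjoint, mul_apply_eq_comp,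
        ContinuousLinearMap.adjoint_inner_right]
      rw [inner_self_eq_norm_sq_to_K]
      exact pow_nonneg (by simp) 2)

theorem torusTrace_W (θ : ℝ) (x : Z2) : torusTrace θ (W θ x) = if x = 0 then 1 else 0 := by
  change ⟪lp.single 2 0 (1 : ℂ), torusIncl θ (W θ x) (lp.single 2 0 (1 : ℂ))⟫_ℂ = _
  rw [lp.inner_single_left, torusIncl_W_apply]
  by_cases h : x = 0
  · subst h
    simp [sigmaTheta, thetaForm_eq]
  · simp [h]

/-- The Hilbert space `L²(B, τ_B)` of the GNS representation of `τ_B`. -/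
abbrev L2B (θ : ℝ) : Type := (torusTrace θ).GNS

/-- The GNS representation of `B` on `L²(B, τ_B)`. -/
def piTau (θ : ℝ) : QuantumTorus θ →⋆ₐ[ℂ] (L2B θ →L[ℂ] L2B θ) := (torusTrace θ).gnsStarAlgHom

/-- The canonical map `ι_B : B → L²(B, τ_B)`. -/
def iotaB (θ : ℝ) (b : QuantumTorus θ) : L2B θ :=
  (((torusTrace θ).toPreGNS b : (torusTrace θ).PreGNS) : L2B θ)

/-- The sequences in `𝒮(ℤ²)`. -/
def IsSchwartz (α : Z2 → ℂ) : Prop :=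
  ∀ k : ℕ, BddAbove (Set.range fun r : Z2 => (1 + (r 0 : ℝ) ^ 2 + (r 1 : ℝ) ^ 2) ^ k * ‖α r‖ ^ 2)

theorem IsSchwartz.zero : IsSchwartz 0 := fun k => ⟨0, by rintro _ ⟨r, rfl⟩; simp⟩

theorem IsSchwartz.smul {α : Z2 → ℂ} (hα : IsSchwartz α) (c : ℂ) : IsSchwartz (c • α) := by
  intro k
  obtain ⟨b, hb⟩ := hα k
  refine ⟨‖c‖ ^ 2 * b, ?_⟩
  rintro _ ⟨r, rfl⟩
  have h := mul_le_mul_of_nonneg_left (hb ⟨r, rfl⟩) (sq_nonneg ‖c‖)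
  simp only [Pi.smul_apply, norm_smul, mul_pow] at h ⊢
  linarith

theorem IsSchwartz.add {α β : Z2 → ℂ} (hα : IsSchwartz α) (hβ : IsSchwartz β) :
    IsSchwartz (α + β) := by
  intro k
  obtain ⟨a, ha⟩ := hα k
  obtain ⟨b, hb⟩ := hβ k
  refine ⟨2 * (a + b), ?_⟩
  rintro _ ⟨r, rfl⟩
  have h1 := ha ⟨r, rfl⟩
  have h2 := hb ⟨r, rfl⟩
  have h3 : ‖α r + β r‖ ^ 2 ≤ 2 * (‖α r‖ ^ 2 + ‖β r‖ ^ 2) := by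
    have := norm_add_le (α r) (β r)
    nlinarith [norm_nonneg (α r + β r), sq_nonneg (‖α r‖ - ‖β r‖)]
  have h4 : (0 : ℝ) ≤ (1 + (r 0 : ℝ) ^ 2 + (r 1 : ℝ) ^ 2) ^ k := by positivity
  have h5 := mul_le_mul_of_nonneg_left h3 h4
  simp only [Pi.add_apply] at h1 h2 ⊢
  linarith

/-- The smooth noncommutative torus `𝒯_B`: the sums `∑ α_r W_r` with `α ∈ 𝒮(ℤ²)`. -/
def smoothTorus (θ : ℝ) : Set (QuantumTorus θ) :=
  {b | ∃ α : Z2 → ℂ, IsSchwartz α ∧ HasSum (fun r => α r • W θ r) b}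

/-- The graph of the derivation `δ^B_j`: the pairs `(ι_B(∑ α_r W_r), ∑ 2πi r_j α_r ι_B(W_r))` with
`α ∈ 𝒮(ℤ²)`. -/
def derivGraph (θ : ℝ) (j : Fin 2) : Submodule ℂ (L2B θ × L2B θ) where
  carrier := {p | ∃ (α : Z2 → ℂ) (b : QuantumTorus θ), IsSchwartz α ∧
    HasSum (fun r => α r • W θ r) b ∧ p.1 = iotaB θ b ∧
    HasSum (fun r => (2 * Real.pi * Complex.I * (r j : ℂ) * α r) • iotaB θ (W θ r)) p.2}
  add_mem' := by
    rintro p q ⟨α, b, h1, h2, h3, h4⟩ ⟨β, c, k1, k2, k3, k4⟩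
    refine ⟨α + β, b + c, h1.add k1, ?_, ?_, ?_⟩
    · simpa [add_smul] using h2.add k2
    · rw [Prod.fst_add, h3, k3]
      simp [iotaB, UniformSpace.Completion.coe_add]
    · simpa [mul_add, add_smul] using h4.add k4
  zero_mem' := ⟨0, 0, .zero, by simp, by
    simp [iotaB, UniformSpace.Completion.coe_zero], by simp⟩
  smul_mem' := by
    rintro c p ⟨α, b, h1, h2, h3, h4⟩
    refine ⟨c • α, c • b, h1.smul c, ?_, ?_, ?_⟩
    · simpa [mul_smul] using h2.const_smul c
    · rw [Prod.smul_fst, h3]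
      simp [iotaB]
    · simpa [smul_smul, mul_left_comm, mul_assoc] using h4.const_smul c

/-- The closable derivation `δ^B_j` on `ι_B(𝒯_B)`, with `δ^B_j(ι_B(W_r)) = 2πi r_j ι_B(W_r)`. -/
def torusDeriv (θ : ℝ) (j : Fin 2) : L2B θ →ₗ.[ℂ] L2B θ := (derivGraph θ j).toLinearPMap

/-- The component `D⁺ = -i (δ₁ + i δ₂)` of the Dirac operator `D_B`. -/
def diracPlus (θ : ℝ) : L2B θ →ₗ.[ℂ] L2B θ :=
  ((-Complex.I) • (torusDeriv θ 0 + Complex.I • torusDeriv θ 1)).closure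

/-- The component `D⁻ = -i (δ₁ - i δ₂)` of the Dirac operator `D_B`. -/
def diracMinus (θ : ℝ) : L2B θ →ₗ.[ℂ] L2B θ :=
  ((-Complex.I) • (torusDeriv θ 0 - Complex.I • torusDeriv θ 1)).closure

end Torus

/-! ### The covering -/

section Covering

variable (M : Matrix (Fin 2) (Fin 2) ℤ)

/-- The character `x ↦ exp(2πi ⟨M⁻¹ t, x⟩)`. -/
def deckChar (t x : Z2) : ℂ :=
  Complex.exp (2 * Real.pi * Complex.I *
    (((M.map (Int.cast : ℤ → ℝ))⁻¹.mulVec (fun i => (t i : ℝ)) ⬝ᵥ fun i => (x i : ℝ) : ℝ) : ℂ))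

theorem deckChar_norm (t x : Z2) : ‖deckChar M t x‖ = 1 := by
  rw [deckChar, Complex.norm_exp]
  simp

theorem deckChar_add_right (t x y : Z2) :
    deckChar M t (x + y) = deckChar M t x * deckChar M t y := by
  rw [deckChar, deckChar, deckChar, ← Complex.exp_add, ← mul_add, ← Complex.ofReal_add,
    ← dotProduct_add]
  congr 5
  funext i
  simp

theorem deckChar_zero_right (t : Z2) : deckChar M t 0 = 1 := by
  simp [deckChar]

theorem deckChar_neg_right (t x : Z2) : deckChar M t (-x) = star (deckChar M t x) := by
  have h : deckChar M t x * deckChar M t (-x) = 1 := by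
    rw [← deckChar_add_right, add_neg_cancel, deckChar_zero_right]
  have h' : deckChar M t x * star (deckChar M t x) = 1 := by
    rw [Complex.star_def, Complex.mul_conj, Complex.normSq_eq_norm_sq, deckChar_norm]
    simp
  have h0 : deckChar M t x ≠ 0 := by
    intro h0
    rw [h0] at h
    simp at h
  exact mul_left_cancel₀ h0 (h.trans h'.symm)

/-- The diagonal unitary `δ_x ↦ exp(2πi ⟨M⁻¹ t, x⟩) δ_x` on `ℓ²(ℤ²)`. -/
def deckDiag (t : Z2) : Ell2 Z2 ℂ →L[ℂ] Ell2 Z2 ℂ :=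
  weightedShift (Equiv.refl Z2) (fun z => scalarRep (deckChar M t z)) 1 (fun z =>
    (NonUnitalStarAlgHom.norm_apply_le scalarRep _).trans (deckChar_norm M t z).le)

theorem deckDiag_apply (t : Z2) (f : Ell2 Z2 ℂ) (z : Z2) :
    deckDiag M t f z = deckChar M t z * f z := by
  change (algebraMap ℂ (ℂ →L[ℂ] ℂ) (deckChar M t z)) (f z) = _
  simp [Algebra.algebraMap_eq_smul_one]

theorem deckDiag_mem_unitary (t : Z2) : deckDiag M t ∈ unitary (Ell2 Z2 ℂ →L[ℂ] Ell2 Z2 ℂ) := by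
  have h : ∀ z, star (deckChar M t z) * deckChar M t z = 1 := fun z => by
    rw [← deckChar_neg_right, ← deckChar_add_right, neg_add_cancel, deckChar_zero_right]
  have hstar : ∀ f z, star (deckDiag M t) f z = star (deckChar M t z) * f z := by
    intro f z
    have h1 : ⟪lp.single 2 z (1 : ℂ), star (deckDiag M t) f⟫_ℂ =
        ⟪deckDiag M t (lp.single 2 z (1 : ℂ)), f⟫_ℂ := by
      rw [ContinuousLinearMap.star_eq_adjoint, ContinuousLinearMap.adjoint_inner_right]
    have h2 : deckDiag M t (lp.single 2 z (1 : ℂ)) = lp.single 2 z (deckChar M t z) := by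
      apply lp.ext
      funext w
      rw [deckDiag_apply]
      by_cases hw : w = z
      · subst hw
        simp
      · simp [hw]
    rw [h2, lp.inner_single_left, lp.inner_single_left] at h1
    simpa [mul_comm] using h1
  rw [Unitary.mem_iff]
  constructor
  · ext f z
    change star (deckDiag M t) (deckDiag M t f) z = f z
    rw [hstar, deckDiag_apply, ← mul_assoc, h, one_mul]
  · ext f z
    change deckDiag M t (star (deckDiag M t) f) z = f z
    rw [deckDiag_apply, hstar, ← mul_assoc, mul_comm (deckChar M t z), h, one_mul]

/-- Conjugation by the diagonal unitary. -/
def deckConj (t : Z2) :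
    (Ell2 Z2 ℂ →L[ℂ] Ell2 Z2 ℂ) →⋆ₐ[ℂ] (Ell2 Z2 ℂ →L[ℂ] Ell2 Z2 ℂ) :=
  (Unitary.conjStarAlgAut ℂ (Ell2 Z2 ℂ →L[ℂ] Ell2 Z2 ℂ) ⟨deckDiag M t, deckDiag_mem_unitary M t⟩ :
    (Ell2 Z2 ℂ →L[ℂ] Ell2 Z2 ℂ) ≃⋆ₐ[ℂ] (Ell2 Z2 ℂ →L[ℂ] Ell2 Z2 ℂ))

theorem deckConj_leftRegular (θ : ℝ) (t : Z2) (c : ℂ) (x : Z2) :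
    deckConj M t (leftRegular (torusPair θ) scalarRep c x) =
      deckChar M t x • leftRegular (torusPair θ) scalarRep c x := by
  have hc : ∀ f : Ell2 Z2 ℂ, leftRegular (torusPair θ) scalarRep c x (deckDiag M t f) =
      star (deckChar M t x) • deckDiag M t (leftRegular (torusPair θ) scalarRep c x f) := by
    intro f
    apply lp.ext
    funext z
    change scalarRep _ (deckDiag M t f (-x + z)) =
      star (deckChar M t x) * deckDiag M t (leftRegular (torusPair θ) scalarRep c x f) z
    rw [deckDiag_apply, deckDiag_apply, deckChar_add_right, deckChar_neg_right]
    change scalarRep _ _ = _ * (_ * scalarRep _ (f (-x + z)))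
    have hl : ∀ (S : ℂ →L[ℂ] ℂ) (p q r : ℂ), S (p * q * r) = p * (q * S r) := fun S p q r => by
      rw [mul_assoc, ← smul_eq_mul, map_smul, smul_eq_mul, ← smul_eq_mul q, map_smul, smul_eq_mul]
    exact hl _ _ _ _
  have h1 : deckChar M t x * star (deckChar M t x) = 1 := by
    rw [← deckChar_neg_right, ← deckChar_add_right, add_neg_cancel, deckChar_zero_right]
  have hu := Unitary.mem_iff.1 (deckDiag_mem_unitary M t)
  have h2 : leftRegular (torusPair θ) scalarRep c x * deckDiag M t =
      star (deckChar M t x) • (deckDiag M t * leftRegular (torusPair θ) scalarRep c x) :=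
    ContinuousLinearMap.ext hc
  change deckDiag M t * leftRegular (torusPair θ) scalarRep c x * star (deckDiag M t) = _
  have h3 : deckDiag M t * leftRegular (torusPair θ) scalarRep c x =
      deckChar M t x • (leftRegular (torusPair θ) scalarRep c x * deckDiag M t) := by
    rw [h2, smul_smul, h1, one_smul]
  rw [h3, smul_mul_assoc, mul_assoc, hu.2, mul_one]

theorem deckConj_mem (θ : ℝ) (t : Z2) (b : QuantumTorus θ) :
    deckConj M t (torusIncl θ b) ∈ reducedCrossedProduct (torusPair θ) scalarRep := by
  have hcont : Continuous (deckConj M t) := map_continuous (deckConj M t)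
  have hle : StarAlgebra.adjoin ℂ
      (Set.range fun p : ℂ × Z2 => leftRegular (torusPair θ) scalarRep p.1 p.2) ≤
      (reducedCrossedProduct (torusPair θ) scalarRep).comap (deckConj M t) := by
    refine StarAlgebra.adjoin_le ?_
    rintro _ ⟨p, rfl⟩
    change deckConj M t (leftRegular (torusPair θ) scalarRep p.1 p.2) ∈
      reducedCrossedProduct (torusPair θ) scalarRep
    rw [deckConj_leftRegular]
    exact SMulMemClass.smul_mem _ (crossedElem (torusPair θ) scalarRep p.1 p.2).2
  have hcl : IsClosed (((reducedCrossedProduct (torusPair θ) scalarRep).comap (deckConj M t) :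
      StarSubalgebra ℂ (Ell2 Z2 ℂ →L[ℂ] Ell2 Z2 ℂ)) : Set (Ell2 Z2 ℂ →L[ℂ] Ell2 Z2 ℂ)) :=
    IsClosed.preimage hcont (inferInstance : IsClosed
      (reducedCrossedProduct (torusPair θ) scalarRep : Set (Ell2 Z2 ℂ →L[ℂ] Ell2 Z2 ℂ)))
  exact StarSubalgebra.topologicalClosure_minimal hle hcl b.2

/-- The automorphism `γ̃_t` of `B`, with `γ̃_t(W_x) = exp(2πi ⟨M⁻¹ t, x⟩) W_x`. -/
def deckTilde (θ : ℝ) (t : Z2) : QuantumTorus θ →⋆ₐ[ℂ] QuantumTorus θ :=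
  StarAlgHom.codRestrict ((deckConj M t).comp (torusIncl θ))
    (reducedCrossedProduct (torusPair θ) scalarRep) (deckConj_mem M θ t)

theorem deckTilde_W (θ : ℝ) (t x : Z2) : deckTilde M θ t (W θ x) = deckChar M t x • W θ x :=
  torusIncl_injective θ (deckConj_leftRegular M θ t 1 x)

/-- The group `G = ℤ² / M ℤ²`. -/
abbrev Deck : Type := Z2 ⧸ LinearMap.range M.mulVecLin

/-- The dual group `Ĝ`: the class of `s ∈ ℤ²` modulo `Mᵀ ℤ²` stands for the class of `M̂ s` in
`M̂ ℤ² / ℤ²`, where `M̂ = (M⁻¹)ᵀ`, i.e. for the character `t ↦ exp(2πi ⟨M⁻¹ t, s⟩)` of `G`. -/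
abbrev DualDeck : Type := Z2 ⧸ LinearMap.range (M.transpose).mulVecLin

/-- The action `γ` of `G` on `B`, given by `γ̃_t` for any representative `t`. -/
def deckAction (θ : ℝ) (g : Deck M) : QuantumTorus θ →⋆ₐ[ℂ] QuantumTorus θ :=
  deckTilde M θ (Quotient.out g)

/-- The fixed-point algebra `A = B^γ`. -/
def fixedAlg (θ : ℝ) : StarSubalgebra ℂ (QuantumTorus θ) where
  carrier := {b | ∀ g, deckAction M θ g b = b}
  mul_mem' := fun ha hb g => by rw [map_mul, ha g, hb g]
  add_mem' := fun ha hb g => by rw [map_add, ha g, hb g]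
  algebraMap_mem' := fun r g => AlgHomClass.commutes _ r
  star_mem' := fun ha g => by rw [map_star, ha g]

instance fixedAlg_isClosed (θ : ℝ) : IsClosed (fixedAlg M θ : Set (QuantumTorus θ)) := by
  have h : (fixedAlg M θ : Set (QuantumTorus θ)) =
      ⋂ g, {b | deckAction M θ g b = b} := by
    ext b
    simp [fixedAlg]
  rw [h]
  exact isClosed_iInter fun g => isClosed_eq (map_continuous (deckAction M θ g)) continuous_id

theorem W_conj_mem (θ : ℝ) (x : Z2) {a : QuantumTorus θ} (ha : a ∈ fixedAlg M θ) :
    W θ x * a * star (W θ x) ∈ fixedAlg M θ := by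
  intro g
  have h1 : star (deckChar M (Quotient.out g) x) * deckChar M (Quotient.out g) x = 1 := by
    rw [← deckChar_neg_right, ← deckChar_add_right, neg_add_cancel, deckChar_zero_right]
  have h2 : deckAction M θ g (W θ x) = deckChar M (Quotient.out g) x • W θ x :=
    deckTilde_W M θ _ x
  rw [map_mul, map_mul, map_star, ha g, h2, star_smul, smul_mul_assoc, smul_mul_smul_comm,
    mul_comm, h1, one_smul]

theorem deckChar_add_left (t t' x : Z2) :
    deckChar M (t + t') x = deckChar M t x * deckChar M t' x := by
  have h : (fun i => (((t + t') i : ℤ) : ℝ)) = (fun i => (t i : ℝ)) + fun i => (t' i : ℝ) := by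
    funext i
    simp
  rw [deckChar, deckChar, deckChar, ← Complex.exp_add, ← mul_add, ← Complex.ofReal_add, h,
    Matrix.mulVec_add, add_dotProduct]

/-- The section `s : Ĝ → ℤ²`, `s(ĝ) = Mᵀ ζ(ĝ)`, where `ζ(ĝ) ∈ [0,1)²` is the representative of `ĝ`
in the half-open unit square: if `n` is any representative of `ĝ` modulo `Mᵀ ℤ²`, then
`ζ(ĝ) = M̂ n - ⌊M̂ n⌋` and `s(ĝ) = n - Mᵀ ⌊M̂ n⌋`. -/
def sect (g : DualDeck M) : Z2 :=
  Quotient.out g - M.transpose.mulVec fun i =>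
    ⌊((M.map (Int.cast : ℤ → ℝ))⁻¹).transpose.mulVec (fun k => ((Quotient.out g : Z2) k : ℝ)) i⌋

theorem mk_sect (g : DualDeck M) : Submodule.Quotient.mk (sect M g) = g := by
  rw [sect, Submodule.Quotient.mk_sub]
  have h : (Submodule.Quotient.mk (M.transpose.mulVec fun i =>
      ⌊((M.map (Int.cast : ℤ → ℝ))⁻¹).transpose.mulVec
        (fun k => ((Quotient.out g : Z2) k : ℝ)) i⌋) : DualDeck M) = 0 :=
    (Submodule.Quotient.mk_eq_zero _).2 ⟨_, Matrix.mulVecLin_apply _ _⟩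
  rw [h, sub_zero]
  exact Quotient.out_eq g

section Nondeg

variable [hM : Fact (1 < M.det)]

theorem det_real_ne_zero : (M.map (Int.cast : ℤ → ℝ)).det ≠ 0 := by
  have h : (M.map (Int.cast : ℤ → ℝ)).det = (M.det : ℝ) := by
    simp [Matrix.det_fin_two]
  rw [h]
  have := hM.out
  exact_mod_cast (by lia : M.det ≠ 0)

theorem inv_transpose_mulVec (k : Z2) :
    ((M.map (Int.cast : ℤ → ℝ))⁻¹).transpose.mulVec
      (fun i => ((M.transpose.mulVec k i : ℤ) : ℝ)) = fun i => (k i : ℝ) := by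
  have h : (fun i => ((M.transpose.mulVec k i : ℤ) : ℝ)) =
      (M.map (Int.cast : ℤ → ℝ)).transpose.mulVec fun i => (k i : ℝ) := by
    funext i
    simp [Matrix.mulVec, dotProduct, Fin.sum_univ_two]
  rw [h, Matrix.mulVec_mulVec, ← Matrix.transpose_mul,
    Matrix.mul_nonsing_inv _ (isUnit_iff_ne_zero.2 (det_real_ne_zero M)), Matrix.transpose_one,
    Matrix.one_mulVec]

theorem deckChar_range (t k : Z2) : deckChar M t (M.transpose.mulVec k) = 1 := by
  have h : (M.map (Int.cast : ℤ → ℝ))⁻¹.mulVec (fun i => (t i : ℝ)) ⬝ᵥ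
      (fun i => ((M.transpose.mulVec k i : ℤ) : ℝ)) = ((∑ i, t i * k i : ℤ) : ℝ) := by
    rw [dotProduct_comm, Matrix.dotProduct_mulVec, ← Matrix.mulVec_transpose,
      inv_transpose_mulVec, dotProduct_comm]
    simp [dotProduct]
  rw [deckChar, h, Complex.exp_eq_one_iff]
  exact ⟨∑ i, t i * k i, by push_cast; ring⟩

theorem deckChar_range_left (k x : Z2) : deckChar M (M.mulVec k) x = 1 := by
  have h0 : (fun i => ((M.mulVec k i : ℤ) : ℝ)) =
      (M.map (Int.cast : ℤ → ℝ)).mulVec fun i => (k i : ℝ) := by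
    funext i
    simp [Matrix.mulVec, dotProduct, Fin.sum_univ_two]
  rw [deckChar, h0, Matrix.mulVec_mulVec,
    Matrix.nonsing_inv_mul _ (isUnit_iff_ne_zero.2 (det_real_ne_zero M)), Matrix.one_mulVec,
    Complex.exp_eq_one_iff]
  exact ⟨∑ i, k i * x i, by simp [dotProduct]; ring⟩

/-- The action `γ` is given by any representative. -/
theorem deckAction_mk (θ : ℝ) (t : Z2) :
    deckAction M θ (Submodule.Quotient.mk t) = deckTilde M θ t := by
  have h : (Submodule.Quotient.mk (Quotient.out (Submodule.Quotient.mk t : Deck M)) : Deck M) =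
      Submodule.Quotient.mk t := Quotient.out_eq _
  obtain ⟨k, hk⟩ := (Submodule.Quotient.eq _).1 h
  have h1 : ∀ x, deckChar M (Quotient.out (Submodule.Quotient.mk t : Deck M)) x =
      deckChar M t x := fun x => by
    rw [← sub_add_cancel (Quotient.out (Submodule.Quotient.mk t : Deck M)) t, ← hk,
      deckChar_add_left, Matrix.mulVecLin_apply, deckChar_range_left, one_mul]
  have h2 : deckDiag M (Quotient.out (Submodule.Quotient.mk t : Deck M)) = deckDiag M t := by
    ext f z
    rw [deckDiag_apply, deckDiag_apply, h1]
  ext b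
  apply torusIncl_injective
  change deckDiag M (Quotient.out (Submodule.Quotient.mk t : Deck M)) * torusIncl θ b *
    star (deckDiag M (Quotient.out (Submodule.Quotient.mk t : Deck M))) =
    deckDiag M t * torusIncl θ b * star (deckDiag M t)
  rw [h2]

instance : Finite (DualDeck M) := by
  refine Module.finite_of_fg_torsion _ ?_
  intro q
  obtain ⟨x, rfl⟩ := Submodule.Quotient.mk_surjective _ q
  have hd : M.det ≠ 0 := by have := hM.out; lia
  refine ⟨⟨M.det, mem_nonZeroDivisors_of_ne_zero hd⟩, ?_⟩
  change M.det • (Submodule.Quotient.mk x : DualDeck M) = 0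
  rw [← Submodule.Quotient.mk_smul, Submodule.Quotient.mk_eq_zero]
  refine ⟨M.transpose.adjugate.mulVec x, ?_⟩
  rw [Matrix.mulVecLin_apply, Matrix.mulVec_mulVec, Matrix.mul_adjugate, Matrix.det_transpose,
    Matrix.smul_mulVec, Matrix.one_mulVec]

instance : Fintype (DualDeck M) := Fintype.ofFinite _

theorem sect_zero : sect M 0 = 0 := by
  have h : (Submodule.Quotient.mk (Quotient.out (0 : DualDeck M)) : DualDeck M) = 0 :=
    Quotient.out_eq _
  obtain ⟨k, hk⟩ := (Submodule.Quotient.mk_eq_zero _).1 h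
  rw [sect, ← hk, Matrix.mulVecLin_apply, inv_transpose_mulVec]
  simp

theorem deckChar_sect (t : Z2) (j k : DualDeck M) :
    deckChar M t (sect M j + sect M k - sect M (j + k)) = 1 := by
  have h : (Submodule.Quotient.mk (sect M j + sect M k - sect M (j + k)) : DualDeck M) = 0 := by
    rw [Submodule.Quotient.mk_sub, Submodule.Quotient.mk_add, mk_sect, mk_sect, mk_sect, sub_self]
  obtain ⟨l, hl⟩ := (Submodule.Quotient.mk_eq_zero _).1 h
  rw [← hl, Matrix.mulVecLin_apply, deckChar_range]

/-- The frame `μ_ĝ = W_{s(ĝ)}`. -/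
def frame (θ : ℝ) (j : DualDeck M) : unitary (QuantumTorus θ) :=
  ⟨W θ (sect M j), W_mem_unitary θ (sect M j)⟩

/-- The twisting pair `(ρ, σ)` of `Ĝ` on `A` determined by the frame `μ`. -/
def coveringPair (θ : ℝ) : TwistingPair (fixedAlg M θ) (DualDeck M) :=
  frameTwistingPair (fixedAlg M θ) (frame M θ)
    (by ext; simp [frame, sect_zero, W_zero])
    (fun j a ha => W_conj_mem M θ _ ha)
    (fun j a ha => by
      have h := W_conj_mem M θ (-sect M j) ha
      rwa [W_star, neg_neg, ← W_star] at h)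
    (fun j k g => by
      change deckTilde M θ (Quotient.out g)
        (W θ (sect M j) * W θ (sect M k) * star (W θ (sect M (j + k)))) =
        W θ (sect M j) * W θ (sect M k) * star (W θ (sect M (j + k)))
      rw [W_star, W_mul, smul_mul_assoc, W_mul, map_smul, map_smul, deckTilde_W,
        ← sub_eq_add_neg, deckChar_sect, one_smul])

/-- The element `W_{Mᵀ x}` of `A`. -/
def WA (θ : ℝ) (x : Z2) : fixedAlg M θ :=
  ⟨W θ (M.transpose.mulVec x), fun g => by
    change deckTilde M θ (Quotient.out g) _ = _
    rw [deckTilde_W, deckChar_range, one_smul]⟩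

/-- The smooth subalgebra `𝒯_A = A ∩ 𝒯_B` of `A`. -/
def smoothFixed (θ : ℝ) : Set (fixedAlg M θ) := {a | (a : QuantumTorus θ) ∈ smoothTorus θ}

/-- `ε(x₁, x₂) = [[0, x₁ - i x₂], [x₁ + i x₂, 0]]`. -/
def eps (x : Z2) : Matrix (Fin 2) (Fin 2) ℂ :=
  !![0, (x 0 : ℂ) - Complex.I * x 1; (x 0 : ℂ) + Complex.I * x 1, 0]

/-- The length function `ℓ(ĝ) = ε(s(ĝ))` on `Ĝ`. -/
def lengthFun (j : DualDeck M) : Matrix (Fin 2) (Fin 2) ℂ := eps (sect M j)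

/-- The Dirac operator `D̃` of the equivariant construction. -/
def diracTilde (θ : ℝ) : EquivHilb (DualDeck M) (L2B θ) →ₗ.[ℂ] EquivHilb (DualDeck M) (L2B θ) :=
  equivDirac (diracPlus θ) (diracMinus θ) (lengthFun M)

/-- The operator `(π̂ × L̂)(a δ_j)` of the equivariant construction from `π = π_B|_A` and
`U(j) = π_B(μ_j)`. -/
def hatRep (θ : ℝ) (a : fixedAlg M θ) (j : DualDeck M) :
    EquivHilb (DualDeck M) (L2B θ) →L[ℂ] EquivHilb (DualDeck M) (L2B θ) :=
  equivRep (piTau θ a * piTau θ (frame M θ j)) (piTau θ a * piTau θ (frame M θ j)) j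

/-- The explicit formula for a representation of `A ⋊_r Ĝ` on the elements `W_{Mᵀx} δ_j` and the
vectors `(ι_B(W_m) ⊗ δ_g ⊗ v, ι_B(W_n) ⊗ δ_h ⊗ w)`. -/
def HasExplicitFormula {K : Type*} [NormedAddCommGroup K] [InnerProductSpace ℂ K] [CompleteSpace K]
    (θ : ℝ) (π₀ : fixedAlg M θ →⋆ₐ[ℂ] (K →L[ℂ] K))
    (R : reducedCrossedProduct (coveringPair M θ) π₀ →⋆ₐ[ℂ]
      (EquivHilb (DualDeck M) (L2B θ) →L[ℂ] EquivHilb (DualDeck M) (L2B θ))) : Prop :=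
  ∀ (x : Z2) (j : DualDeck M) (m n : Z2) (g h : DualDeck M) (v w : EuclideanSpace ℂ (Fin 2)),
    R (crossedElem (coveringPair M θ) π₀ (WA M θ x) j)
        (WithLp.toLp 2 (tens (iotaB θ (W θ m)) g v, tens (iotaB θ (W θ n)) h w)) =
      WithLp.toLp 2
        (Complex.exp (-(Real.pi * Complex.I) *
            ((thetaForm θ (M.transpose.mulVec x) (sect M j) +
              thetaForm θ (M.transpose.mulVec x + sect M j) m : ℝ) : ℂ)) •
          tens (iotaB θ (W θ (m + M.transpose.mulVec x + sect M j))) (j + g) v,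
        Complex.exp (-(Real.pi * Complex.I) *
            ((thetaForm θ (M.transpose.mulVec x) (sect M j) +
              thetaForm θ (M.transpose.mulVec x + sect M j) n : ℝ) : ℂ)) •
          tens (iotaB θ (W θ (n + M.transpose.mulVec x + sect M j))) (j + h) w)

end Nondeg

end Covering

end QTorus

end

open QTorus

/-!
The frame `μ_j = W_{s(j)}` consists of homogeneous unitaries for the grading of `B` by `Ĝ` whose
degree-zero part is `A`; reading off the homogeneous components identifies `B` with the crossed
product and turns `π̂ × L̂` into a representation of `B`.

The Fourier basis `ι(W_m)` splits `D̃` into self-adjoint `4 × 4` blocks, one for each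
`(m, g) ∈ ℤ² × Ĝ`, whose squares are the scalars `|s(g)|² + 4π²|m|²`. These scalars tend to
infinity, hence the resolvent is compact, and `|D̃|` is diagonal. In the same basis `W_r` acts as a
weighted shift by `(r, [r])`. A commutator with `D̃` or `|D̃|` multiplies its weights by increments
of the blocks along the shift, which are `O(1 + |r|²)`, so an iterated commutator of `W_r` grows
polynomially in `r`, and the rapid decay of the coefficients of a smooth element makes the series of
iterated commutators converge.
-/

noncomputable section

namespace QTorus

/-! ### Bounded commutators -/

section Commutator

variable {H : Type*} [NormedAddCommGroup H] [InnerProductSpace ℂ H]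

theorem isBddCommutator_iff {D : H →ₗ.[ℂ] H} {S C : H →L[ℂ] H} :
    IsBddCommutator D S C ↔ ∀ x y, (x, y) ∈ D.graph → (S x, C x + S y) ∈ D.graph := by
  constructor
  · intro h x y hxy
    obtain ⟨x', rfl, rfl⟩ := D.mem_graph_iff.1 hxy
    obtain ⟨hS, hC⟩ := h x'
    rw [← hC, sub_add_cancel]
    exact D.mem_graph ⟨S x', hS⟩
  · intro h x
    obtain ⟨⟨z, hzD⟩, hzS : z = S x, hz : D ⟨z, hzD⟩ = C x + S (D x)⟩ :=
      D.mem_graph_iff.1 (h _ _ (D.mem_graph x))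
    subst hzS
    exact ⟨hzD, by rw [hz, add_sub_cancel_right]⟩

theorem IsBddCommutator.smul {D : H →ₗ.[ℂ] H} {S C : H →L[ℂ] H}
    (h : IsBddCommutator D S C) (a : ℂ) : IsBddCommutator D (a • S) (a • C) := by
  rw [isBddCommutator_iff] at h ⊢
  intro x y hxy
  have hmem := D.graph.smul_mem a (h x y hxy)
  rwa [Prod.smul_mk, smul_add] at hmem

theorem IsBddCommutator.hasSum {D : H →ₗ.[ℂ] H} (hD : D.IsClosed) {ι : Type*}
    {S C : ι → H →L[ℂ] H} {s c : H →L[ℂ] H} (h : ∀ i, IsBddCommutator D (S i) (C i))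
    (hs : HasSum S s) (hc : HasSum C c) : IsBddCommutator D s c := by
  rw [isBddCommutator_iff]
  intro x y hxy
  have hasSum_apply {T : ι → H →L[ℂ] H} {t : H →L[ℂ] H} (hT : HasSum T t) (v : H) :
      HasSum (fun i => T i v) (t v) := (ContinuousLinearMap.apply ℂ H v).hasSum hT
  have hgraph : HasSum (fun i => (S i x, C i x + S i y)) (s x, c x + s y) :=
    (hasSum_apply hs x).prodMk ((hasSum_apply hc x).add (hasSum_apply hs y))
  exact hD.mem_of_tendsto hgraph (Filter.Eventually.of_forall fun F =>
    Submodule.sum_mem _ fun i _ => isBddCommutator_iff.1 (h i) x y hxy)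

end Commutator

/-! ### Block diagonal operators -/

section Block

variable {I K H : Type*} [NormedAddCommGroup K] [InnerProductSpace ℂ K]
  [NormedAddCommGroup H] [InnerProductSpace ℂ H]

/-- The graph of the block diagonal operator with blocks `L i`, in the coordinates given by `U`. -/
def blockGraph (U : H ≃ₗᵢ[ℂ] Ell2 I K) (L : I → K →L[ℂ] K) : Submodule ℂ (H × H) where
  carrier := {p | ∀ i, U p.2 i = L i (U p.1 i)}
  add_mem' := fun {p q} hp hq i => by
    simp only [Prod.fst_add, Prod.snd_add, map_add, lp.coeFn_add, Pi.add_apply, hp i, hq i]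
  zero_mem' := fun i => by simp
  smul_mem' := fun c p hp i => by
    simp only [Prod.smul_fst, Prod.smul_snd, map_smul, lp.coeFn_smul, Pi.smul_apply, hp i]

/-- The block diagonal operator with blocks `L i` on its maximal domain, in the coordinates given
by `U`. -/
def blockOp (U : H ≃ₗᵢ[ℂ] Ell2 I K) (L : I → K →L[ℂ] K) : H →ₗ.[ℂ] H :=
  (blockGraph U L).toLinearPMap

theorem ell2_ext (U : H ≃ₗᵢ[ℂ] Ell2 I K) {x y : H} (h : ∀ i, U x i = U y i) : x = y :=
  U.injective (lp.ext (funext h))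

theorem mem_graph_blockOp {U : H ≃ₗᵢ[ℂ] Ell2 I K} {L : I → K →L[ℂ] K} {x y : H} :
    (x, y) ∈ (blockOp U L).graph ↔ ∀ i, U y i = L i (U x i) := by
  rw [blockOp, Submodule.toLinearPMap_graph_eq]
  · rfl
  · rintro ⟨x, y⟩ h (rfl : x = 0)
    exact ell2_ext U fun i => by simp [h i]

theorem blockOp_isClosed (U : H ≃ₗᵢ[ℂ] Ell2 I K) (L : I → K →L[ℂ] K) :
    (blockOp U L).IsClosed := by
  have hgraph : ((blockOp U L).graph : Set (H × H)) =
      ⋂ i, {p : H × H | U p.2 i = L i (U p.1 i)} := by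
    ext ⟨x, y⟩
    rw [SetLike.mem_coe, mem_graph_blockOp, Set.mem_iInter]
    rfl
  have hcoord (i : I) : Continuous fun x : H => U x i :=
    (lp.evalCLM ℂ (fun _ : I => K) 2 i).continuous.comp U.continuous
  rw [LinearPMap.IsClosed, hgraph]
  exact isClosed_iInter fun i => isClosed_eq ((hcoord i).comp continuous_snd)
    ((L i).continuous.comp ((hcoord i).comp continuous_fst))

open Classical in
theorem mem_graph_blockOp_single (U : H ≃ₗᵢ[ℂ] Ell2 I K) (L : I → K →L[ℂ] K) (i : I) (v : K) :
    (U.symm (lp.single 2 i v), U.symm (lp.single 2 i (L i v))) ∈ (blockOp U L).graph := by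
  rw [mem_graph_blockOp]
  intro k
  rw [U.apply_symm_apply, U.apply_symm_apply]
  obtain rfl | h := eq_or_ne k i
  · simp
  · simp [h]

theorem blockOp_dense_domain (U : H ≃ₗᵢ[ℂ] Ell2 I K) (L : I → K →L[ℂ] K) :
    Dense ((blockOp U L).domain : Set H) := by
  classical
  intro x
  have hsum : HasSum (fun i => U.symm (lp.single 2 i (U x i))) x := by
    simpa using (U.symm.toContinuousLinearEquiv : Ell2 I K →L[ℂ] H).hasSum
      (lp.hasSum_single (p := 2) (by norm_num) (U x))
  exact mem_closure_of_tendsto hsum (Filter.Eventually.of_forall fun F =>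
    Submodule.sum_mem _ fun i _ =>
      LinearPMap.mem_domain_of_mem_graph (mem_graph_blockOp_single U L i (U x i)))

theorem blockOp_isSelfAdjoint [CompleteSpace K] [CompleteSpace H] (U : H ≃ₗᵢ[ℂ] Ell2 I K)
    {L : I → K →L[ℂ] K} (hL : ∀ i, IsSelfAdjoint (L i)) : IsSelfAdjoint (blockOp U L) := by
  classical
  have hsymm (i v w) : ⟪L i v, w⟫_ℂ = ⟪v, L i w⟫_ℂ := (hL i).isSymmetric v w
  rw [LinearPMap.isSelfAdjoint_def]
  apply LinearPMap.eq_of_eq_graph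
  rw [LinearPMap.adjoint_graph_eq_graph_adjoint (blockOp_dense_domain U L)]
  ext ⟨y, z⟩
  rw [Submodule.mem_adjoint_iff, mem_graph_blockOp]
  constructor
  · intro h i
    refine ext_inner_left ℂ fun v => ?_
    have hi := sub_eq_zero.1 (h _ _ (mem_graph_blockOp_single U L i v))
    rw [← U.inner_map_map, ← U.inner_map_map (U.symm _) z, U.apply_symm_apply, U.apply_symm_apply,
      lp.inner_single_left, lp.inner_single_left, hsymm] at hi
    exact hi.symm
  · intro h a b hab
    rw [mem_graph_blockOp] at hab
    rw [sub_eq_zero, ← U.inner_map_map, ← U.inner_map_map a z, lp.inner_eq_tsum, lp.inner_eq_tsum]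
    exact tsum_congr fun i => by rw [hab i, hsymm, h i]

/-- The shift along `e` with operator weights `Q`, in the coordinates given by `U`. -/
def blockShift (U : H ≃ₗᵢ[ℂ] Ell2 I K) (e : I ≃ I) (Q : I → K →L[ℂ] K) (c : ℝ)
    (hQ : ∀ i, ‖Q i‖ ≤ c) : H →L[ℂ] H :=
  (U.symm.toContinuousLinearEquiv : Ell2 I K →L[ℂ] H) ∘L weightedShift e Q c hQ ∘L
    (U.toContinuousLinearEquiv : H →L[ℂ] Ell2 I K)

theorem blockShift_apply (U : H ≃ₗᵢ[ℂ] Ell2 I K) (e : I ≃ I) (Q : I → K →L[ℂ] K) (c : ℝ)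
    (hQ : ∀ i, ‖Q i‖ ≤ c) (x : H) (i : I) :
    U (blockShift U e Q c hQ x) i = Q i (U x (e i)) := by
  change U (U.symm (weightedShift e Q c hQ (U x))) i = _
  rw [U.apply_symm_apply, weightedShift_apply]

theorem norm_blockShift_le (U : H ≃ₗᵢ[ℂ] Ell2 I K) (e : I ≃ I) (Q : I → K →L[ℂ] K) (c : ℝ)
    (hQ : ∀ i, ‖Q i‖ ≤ c) : ‖blockShift U e Q c hQ‖ ≤ |c| := by
  refine ContinuousLinearMap.opNorm_le_bound _ (abs_nonneg c) fun x => ?_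
  calc ‖U.symm (weightedShift e Q c hQ (U x))‖
      = ‖weightedShift e Q c hQ (U x)‖ := U.symm.norm_map _
    _ ≤ |c| * ‖U x‖ := ContinuousLinearMap.le_of_opNorm_le _
        (LinearMap.mkContinuous_norm_le _ (abs_nonneg _) _) _
    _ = |c| * ‖x‖ := by rw [U.norm_map]

theorem isBddCommutator_blockShift (U : H ≃ₗᵢ[ℂ] Ell2 I K) (L : I → K →L[ℂ] K) (e : I ≃ I)
    {Q Q' : I → K →L[ℂ] K} {c c' : ℝ} (hQ : ∀ i, ‖Q i‖ ≤ c) (hQ' : ∀ i, ‖Q' i‖ ≤ c')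
    (h : ∀ i, Q' i = L i * Q i - Q i * L (e i)) :
    IsBddCommutator (blockOp U L) (blockShift U e Q c hQ) (blockShift U e Q' c' hQ') := by
  rw [isBddCommutator_iff]
  intro x y hxy
  rw [mem_graph_blockOp] at hxy ⊢
  intro i
  rw [map_add, lp.coeFn_add, Pi.add_apply, blockShift_apply, blockShift_apply, blockShift_apply,
    h, hxy]
  simp

section Compact

open Classical in
/-- The operator whose only nonzero block, in row `i` and column `k`, is `Q`, in the coordinates
given by `U`. -/
def blockEntry (U : H ≃ₗᵢ[ℂ] Ell2 I K) (i k : I) (Q : K →L[ℂ] K) : H →L[ℂ] H :=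
  ((U.symm.toContinuousLinearEquiv : Ell2 I K →L[ℂ] H) ∘L
    lp.singleContinuousLinearMap ℂ (fun _ : I => K) 2 i) ∘L Q ∘L
    (lp.evalCLM ℂ (fun _ : I => K) 2 k ∘L (U.toContinuousLinearEquiv : H →L[ℂ] Ell2 I K))

open Classical in
theorem blockEntry_apply (U : H ≃ₗᵢ[ℂ] Ell2 I K) (i k : I) (Q : K →L[ℂ] K) (x : H) :
    U (blockEntry U i k Q x) = lp.single 2 i (Q (U x k)) :=
  U.apply_symm_apply _

theorem isCompactOperator_blockEntry (U : H ≃ₗᵢ[ℂ] Ell2 I K) (i k : I) {Q : K →L[ℂ] K}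
    (hQ : IsCompactOperator Q) : IsCompactOperator (blockEntry U i k Q) := by
  classical
  exact (hQ.comp_clm (lp.evalCLM ℂ (fun _ : I => K) 2 k ∘L
    (U.toContinuousLinearEquiv : H →L[ℂ] Ell2 I K))).clm_comp
    ((U.symm.toContinuousLinearEquiv : Ell2 I K →L[ℂ] H) ∘L
      lp.singleContinuousLinearMap ℂ (fun _ : I => K) 2 i)

open Classical in
theorem sum_blockEntry_apply (U : H ≃ₗᵢ[ℂ] Ell2 I K) (e : I ≃ I) (Q : I → K →L[ℂ] K)
    (F : Finset I) (x : H) (k : I) :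
    U ((∑ i ∈ F, blockEntry U i (e i) (Q i)) x) k = if k ∈ F then Q k (U x (e k)) else 0 := by
  simp only [sum_apply, map_sum, blockEntry_apply, lp.coeFn_sum, Finset.sum_apply,
    lp.coeFn_single, Pi.single_apply]
  exact Finset.sum_ite_eq F k fun i => Q i (U x (e i))

theorem norm_blockShift_sub_sum_blockEntry_le (U : H ≃ₗᵢ[ℂ] Ell2 I K) (e : I ≃ I)
    {Q : I → K →L[ℂ] K} {c : ℝ} (hQ : ∀ i, ‖Q i‖ ≤ c) (F : Finset I) {ε : ℝ} (hε : 0 ≤ ε)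
    (hF : ∀ i ∉ F, ‖Q i‖ ≤ ε) :
    ‖blockShift U e Q c hQ - ∑ i ∈ F, blockEntry U i (e i) (Q i)‖ ≤ ε := by
  classical
  have htail (i : I) : ‖if i ∈ F then 0 else Q i‖ ≤ ε := by
    split_ifs with hi
    · simpa using hε
    · exact hF i hi
  have hdiff : blockShift U e Q c hQ - ∑ i ∈ F, blockEntry U i (e i) (Q i) =
      blockShift U e (fun i => if i ∈ F then 0 else Q i) ε htail := by
    ext x
    refine ell2_ext U fun k => ?_
    rw [blockShift_apply, sub_apply, map_sub, lp.coeFn_sub, Pi.sub_apply, blockShift_apply,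
      sum_blockEntry_apply]
    split_ifs <;> simp
  rw [hdiff]
  exact (norm_blockShift_le _ _ _ _ _).trans_eq (abs_of_nonneg hε)

theorem isCompactOperator_blockShift [CompleteSpace H] (U : H ≃ₗᵢ[ℂ] Ell2 I K) (e : I ≃ I)
    {Q : I → K →L[ℂ] K} {c : ℝ} (hQ : ∀ i, ‖Q i‖ ≤ c) (hcomp : ∀ i, IsCompactOperator (Q i))
    (hlim : Filter.Tendsto (fun i => ‖Q i‖) Filter.cofinite (nhds 0)) :
    IsCompactOperator (blockShift U e Q c hQ) := by
  have hfinite (F : Finset I) : IsCompactOperator ⇑(∑ i ∈ F, blockEntry U i (e i) (Q i)) :=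
    Submodule.sum_mem (compactOperator (RingHom.id ℂ) H H) fun i _ =>
      isCompactOperator_blockEntry U i (e i) (hcomp i)
  refine isCompactOperator_of_tendsto (l := Filter.atTop) ?_ (Filter.Eventually.of_forall hfinite)
  rw [Metric.tendsto_nhds]
  intro ε hε
  have hsmall : {i | ¬ ‖Q i‖ < ε / 2}.Finite :=
    Filter.eventually_cofinite.1 (hlim.eventually_lt_const (half_pos hε))
  filter_upwards [Filter.eventually_ge_atTop hsmall.toFinset] with F hF
  rw [dist_comm, dist_eq_norm]
  refine (norm_blockShift_sub_sum_blockEntry_le U e hQ F (half_pos hε).le fun i hi => ?_).trans_lt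
    (half_lt_self hε)
  by_contra hlt
  exact hi (hF (hsmall.mem_toFinset.2 fun h => hlt h.le))

end Compact

theorem isPositive_blockShift_refl (U : H ≃ₗᵢ[ℂ] Ell2 I K) {Q : I → K →L[ℂ] K} {c : ℝ}
    (hQ : ∀ i, ‖Q i‖ ≤ c) (hpos : ∀ i, (Q i).IsPositive) :
    (blockShift U (Equiv.refl I) Q c hQ).IsPositive := by
  rw [ContinuousLinearMap.isPositive_iff]
  constructor
  · intro x y
    change ⟪blockShift U (Equiv.refl I) Q c hQ x, y⟫_ℂ =
      ⟪x, blockShift U (Equiv.refl I) Q c hQ y⟫_ℂ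
    rw [← U.inner_map_map, ← U.inner_map_map x, lp.inner_eq_tsum, lp.inner_eq_tsum]
    refine tsum_congr fun i => ?_
    rw [blockShift_apply, blockShift_apply]
    exact (hpos i).isSymmetric _ _
  · intro x
    rw [← U.inner_map_map, lp.inner_eq_tsum]
    refine tsum_nonneg fun i => ?_
    rw [blockShift_apply]
    exact (hpos i).inner_nonneg_left _

theorem isPositive_real_smul_one {a : ℝ} (ha : 0 ≤ a) :
    ((a : ℂ) • (1 : K →L[ℂ] K)).IsPositive :=
  ContinuousLinearMap.isPositive_one.smul_of_nonneg (by exact_mod_cast ha)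

section Square

variable [CompleteSpace K] {L : I → K →L[ℂ] K}

theorem sqGraph_blockOp (U : H ≃ₗᵢ[ℂ] Ell2 I K) (hL : ∀ i, IsSelfAdjoint (L i)) :
    sqGraph (blockOp U L) = {p | ∀ i, U p.2 i = (L i * L i) (U p.1 i)} := by
  ext ⟨x, z⟩
  simp only [sqGraph, Set.mem_ofPred_eq, mem_graph_blockOp]
  refine ⟨fun ⟨y, hy, hz⟩ i => by rw [hz, hy, mul_apply_eq_comp], fun h => ?_⟩
  have hnorm (i : I) : ‖L i (U x i)‖ ^ (2 : ENNReal).toReal = ‖⟪U x i, U z i⟫_ℂ‖ := by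
    have hinner : ⟪U x i, U z i⟫_ℂ = ⟪L i (U x i), L i (U x i)⟫_ℂ := by
      rw [h i]
      exact ((hL i).isSymmetric (U x i) (L i (U x i))).symm
    rw [hinner, inner_self_eq_norm_sq_to_K]
    simp
  have hmem : Memℓp (fun i => L i (U x i)) 2 :=
    memℓp_gen ((summable_congr hnorm).2 (lp.summable_inner (𝕜 := ℂ) (U x) (U z)).norm)
  refine ⟨U.symm ⟨_, hmem⟩, fun i => ?_, fun i => ?_⟩
  · rw [U.apply_symm_apply]
  · rw [U.apply_symm_apply, h i, mul_apply_eq_comp]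

theorem isAbs_blockOp [CompleteSpace H] (U : H ≃ₗᵢ[ℂ] Ell2 I K) {T : I → K →L[ℂ] K}
    (hL : ∀ i, IsSelfAdjoint (L i)) (hT : ∀ i, (T i).IsPositive)
    (hsq : ∀ i, T i * T i = L i * L i) : IsAbs (blockOp U L) (blockOp U T) := by
  have hT_sa (i : I) : IsSelfAdjoint (T i) := (hT i).isSelfAdjoint
  refine ⟨blockOp_isSelfAdjoint U hT_sa, fun x => ?_, ?_⟩
  · have hx := mem_graph_blockOp.1 ((blockOp U T).mem_graph x)
    rw [← U.inner_map_map, lp.inner_eq_tsum]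
    exact tsum_nonneg fun i => hx i ▸ (hT i).inner_nonneg_right _
  · simp only [sqGraph_blockOp U hL, sqGraph_blockOp U hT_sa, hsq]

theorem isInvSqrtOneAddSq_blockShift (U : H ≃ₗᵢ[ℂ] Ell2 I K) {Q : I → K →L[ℂ] K} {c : ℝ}
    (hQ : ∀ i, ‖Q i‖ ≤ c) (hL : ∀ i, IsSelfAdjoint (L i)) (hpos : ∀ i, (Q i).IsPositive)
    (hinv : ∀ i, (1 + L i * L i) * (Q i * Q i) = 1) :
    IsInvSqrtOneAddSq (blockOp U L) (blockShift U (Equiv.refl I) Q c hQ) := by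
  refine ⟨isPositive_blockShift_refl U hQ hpos, fun x => ?_⟩
  rw [sqGraph_blockOp U hL]
  intro i
  have hx : (1 + L i * L i) ((Q i * Q i) (U x i)) = U x i := by
    rw [← mul_apply_eq_comp, hinv, one_apply_eq_self]
  rw [add_apply, one_apply_eq_self, ← eq_sub_iff_add_eq'] at hx
  simpa only [map_sub, lp.coeFn_sub, Pi.sub_apply, blockShift_apply, Equiv.refl_apply,
    mul_apply_eq_comp] using hx.symm

theorem exists_isInvSqrtOneAddSq_blockOp [CompleteSpace H] [FiniteDimensional ℂ K]
    (U : H ≃ₗᵢ[ℂ] Ell2 I K) (hL : ∀ i, IsSelfAdjoint (L i)) {lam : I → ℝ}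
    (hsq : ∀ i, L i * L i = ((lam i ^ 2 : ℝ) : ℂ) • 1)
    (hlim : Filter.Tendsto lam Filter.cofinite Filter.atTop) :
    ∃ R : H →L[ℂ] H, IsInvSqrtOneAddSq (blockOp U L) R ∧ IsCompactOperator R := by
  set r : I → ℝ := fun i => (√(1 + lam i ^ 2))⁻¹
  have hr_nonneg (i : I) : 0 ≤ r i := by positivity
  have hr_le (i : I) : r i ≤ 1 :=
    inv_le_one_of_one_le₀ (Real.one_le_sqrt.2 (le_add_of_nonneg_right (sq_nonneg _)))
  have hr_sq (i : I) : (1 + lam i ^ 2) * (r i * r i) = 1 := by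
    rw [← mul_inv, Real.mul_self_sqrt (by positivity), mul_inv_cancel₀ (by positivity)]
  have hr_lim : Filter.Tendsto r Filter.cofinite (nhds 0) :=
    tendsto_inv_atTop_zero.comp (Filter.tendsto_atTop_mono
      (fun i => Real.le_sqrt_of_sq_le (le_add_of_nonneg_left zero_le_one)) hlim)
  have hQ_le (i : I) : ‖(r i : ℂ) • (1 : K →L[ℂ] K)‖ ≤ r i := by
    rw [norm_smul, Complex.norm_of_nonneg (hr_nonneg i)]
    exact mul_le_of_le_one_right (hr_nonneg i) ContinuousLinearMap.norm_id_le
  have hcompact (i : I) : IsCompactOperator ((r i : ℂ) • (1 : K →L[ℂ] K)) :=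
    (isCompactOperator_id_iff_finiteDimensional.2 ‹_›).smul _
  refine ⟨blockShift U (Equiv.refl I) (fun i => (r i : ℂ) • 1) 1 fun i => (hQ_le i).trans (hr_le i),
    isInvSqrtOneAddSq_blockShift U _ hL (fun i => isPositive_real_smul_one (hr_nonneg i)) ?_,
    isCompactOperator_blockShift U _ _ hcompact
      (squeeze_zero (fun i => norm_nonneg _) hQ_le hr_lim)⟩
  intro i
  have hone : (1 : K →L[ℂ] K) + ((lam i ^ 2 : ℝ) : ℂ) • 1 = ((1 + lam i ^ 2 : ℝ) : ℂ) • 1 := by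
    rw [Complex.ofReal_add, add_smul, Complex.ofReal_one, one_smul]
  rw [hsq, hone, smul_mul_smul_comm, smul_mul_smul_comm, one_mul, one_mul, ← Complex.ofReal_mul,
    ← Complex.ofReal_mul, hr_sq, Complex.ofReal_one, one_smul]

end Square

end Block

/-! ### Graded ⋆-algebras -/

section Graded

variable {B C G : Type*} [Ring B] [StarRing B] [Algebra ℂ B]
  [Ring C] [StarRing C] [Algebra ℂ C] [AddGroup G]

/-- A grading `B = ⨁ 𝒜 j` over a group is compatible with the involution of `B` if the involution
maps the component of `j` to the component of `-j`. -/
class StarGraded (𝒜 : G → Submodule ℂ B) : Prop where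
  star_mem : ∀ {j b}, b ∈ 𝒜 j → star b ∈ 𝒜 (-j)

variable [DecidableEq G] (𝒜 : G → Submodule ℂ B) [GradedAlgebra 𝒜] [StarGraded 𝒜]

/-- The ⋆-homomorphism on a graded ⋆-algebra with prescribed restrictions `F j` to the homogeneous
components. -/
def gradedStarHom (F : ∀ j, 𝒜 j →ₗ[ℂ] C) (hone : F 0 ⟨1, SetLike.GradedOne.one_mem⟩ = 1)
    (hmul : ∀ {j k} (b : 𝒜 j) (c : 𝒜 k),
      F (j + k) ⟨b * c, SetLike.GradedMul.mul_mem b.2 c.2⟩ = F j b * F k c)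
    (hstar : ∀ {j} (b : 𝒜 j), F (-j) ⟨star b, StarGraded.star_mem b.2⟩ = star (F j b)) :
    B →⋆ₐ[ℂ] C :=
  { (DirectSum.toAlgebra ℂ (fun j => 𝒜 j) F hone fun b c => hmul b c).comp
      (DirectSum.decomposeAlgEquiv 𝒜).toAlgHom with
    map_star' := fun b => by
      change DirectSum.toModule ℂ G C F (DirectSum.decompose 𝒜 (star b)) =
        star (DirectSum.toModule ℂ G C F (DirectSum.decompose 𝒜 b))
      induction b using DirectSum.Decomposition.inductionOn 𝒜 with
      | zero => simp
      | homogeneous b =>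
        rw [DirectSum.decompose_coe, DirectSum.decompose_of_mem _ (StarGraded.star_mem b.2)]
        exact (DirectSum.toModule_lof ℂ _ _).trans
          ((hstar b).trans (congrArg star (DirectSum.toModule_lof ℂ _ _).symm))
      | add b c hb hc =>
        rw [star_add, DirectSum.decompose_add, map_add, hb, hc, ← star_add, ← map_add,
          ← DirectSum.decompose_add] }

theorem gradedStarHom_coe (F : ∀ j, 𝒜 j →ₗ[ℂ] C) (hone hmul hstar) {j : G} (b : 𝒜 j) :
    gradedStarHom 𝒜 F hone hmul hstar (b : B) = F j b := by
  change DirectSum.toModule ℂ G C F (DirectSum.decompose 𝒜 (b : B)) = _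
  rw [DirectSum.decompose_coe]
  exact DirectSum.toModule_lof ℂ _ _

end Graded

/-! ### Graded C⋆-algebras as twisted crossed products -/

section LeftRegular

variable {A G K : Type*} [CStarAlgebra A] [AddGroup G]
  [NormedAddCommGroup K] [InnerProductSpace ℂ K] [CompleteSpace K]

theorem leftRegular_apply (P : TwistingPair A G) (π : A →⋆ₐ[ℂ] (K →L[ℂ] K)) (a : A) (x : G)
    (f : Ell2 G K) (z : G) :
    leftRegular P π a x f z = π (P.ρ (-z) a * (P.σ (-z) x : A)) (f (-x + z)) := rfl

/-- The left regular representation as a linear map in the coefficient. -/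
def leftRegularLin (P : TwistingPair A G) (π : A →⋆ₐ[ℂ] (K →L[ℂ] K)) (x : G) :
    A →ₗ[ℂ] (Ell2 G K →L[ℂ] Ell2 G K) where
  toFun a := leftRegular P π a x
  map_add' a b := by
    ext f z
    rw [add_apply, lp.coeFn_add, Pi.add_apply]
    simp only [leftRegular_apply, map_add, add_mul, add_apply]
  map_smul' c a := by
    ext f z
    rw [smul_apply, lp.coeFn_smul, Pi.smul_apply]
    simp only [leftRegular_apply, map_smul, smul_mul_assoc, smul_apply, RingHom.id_apply]

end LeftRegular

section GradedFrame

variable {B G : Type*} [CStarAlgebra B] [AddGroup G]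

/-- The unitaries `μ j` form a frame of a graded C⋆-algebra with neutral component `A`: each `μ j`
is homogeneous of degree `j`, so that the component of `j` is `A μ_j`. -/
structure IsGradedFrame (𝒜 : G → Submodule ℂ B) (A : StarSubalgebra ℂ B) (μ : G → unitary B) :
    Prop where
  mem_iff : ∀ {b}, b ∈ A ↔ b ∈ 𝒜 0
  frame_mem : ∀ j, (μ j : B) ∈ 𝒜 j
  frame_zero : μ 0 = 1

namespace IsGradedFrame

variable [DecidableEq G] {𝒜 : G → Submodule ℂ B} [GradedAlgebra 𝒜]
  {A : StarSubalgebra ℂ B} {μ : G → unitary B}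

theorem mul_frame_mem (h : IsGradedFrame 𝒜 A μ) (a : A) (j : G) : (a : B) * (μ j : B) ∈ 𝒜 j := by
  simpa using SetLike.GradedMul.mul_mem (h.mem_iff.1 a.2) (h.frame_mem j)

variable [StarGraded 𝒜]

theorem frame_mul_mul_star_frame_mem (h : IsGradedFrame 𝒜 A μ) {b : B} {j : G}
    (hb : b ∈ 𝒜 j) (z : G) : (μ z : B) * b * star (μ (z + j) : B) ∈ A := by
  simpa [h.mem_iff] using SetLike.GradedMul.mul_mem
    (SetLike.GradedMul.mul_mem (h.frame_mem z) hb) (StarGraded.star_mem (h.frame_mem (z + j)))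

theorem conj_mem (h : IsGradedFrame 𝒜 A μ) (j : G) :
    ∀ a ∈ A, (μ j : B) * a * star (μ j : B) ∈ A := fun a ha => by
  simpa using h.frame_mul_mul_star_frame_mem (h.mem_iff.1 ha) j

theorem star_conj_mem (h : IsGradedFrame 𝒜 A μ) (j : G) :
    ∀ a ∈ A, star (μ j : B) * a * (μ j : B) ∈ A := fun a ha => by
  simpa [h.mem_iff] using SetLike.GradedMul.mul_mem (SetLike.GradedMul.mul_mem
    (StarGraded.star_mem (h.frame_mem j)) (h.mem_iff.1 ha)) (h.frame_mem j)

theorem cocycle_mem (h : IsGradedFrame 𝒜 A μ) (j k : G) :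
    ((μ j * μ k * star (μ (j + k)) : unitary B) : B) ∈ A :=
  h.frame_mul_mul_star_frame_mem (h.frame_mem k) j

variable [IsClosed (A : Set B)] (h : IsGradedFrame 𝒜 A μ)

/-- The twisting pair of a frame of a graded C⋆-algebra. -/
abbrev pair : TwistingPair A G :=
  frameTwistingPair A μ h.frame_zero h.conj_mem h.star_conj_mem h.cocycle_mem

/-- The coefficient `a ∈ A` of the homogeneous element `b = a μ_j`. -/
def coeff (j : G) : 𝒜 j →ₗ[ℂ] A where
  toFun b := ⟨b * star (μ j : B), by
    simpa [h.frame_zero] using h.frame_mul_mul_star_frame_mem b.2 0⟩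
  map_add' a b := by ext; simp [add_mul]
  map_smul' c a := by ext; simp

theorem coe_coeff {j : G} (b : 𝒜 j) : (h.coeff j b : B) = b * star (μ j : B) := rfl

theorem coeff_mul_frame (a : A) (j : G) :
    h.coeff j ⟨a * (μ j : B), h.mul_frame_mem a j⟩ = a := by
  ext
  simp [h.coe_coeff, mul_assoc]

theorem coe_pair_coeff {j : G} (b : 𝒜 j) (z : G) :
    ((h.pair.ρ z (h.coeff j b) * (h.pair.σ z j : A) : A) : B) =
      (μ z : B) * b * star (μ (z + j) : B) := by
  change (μ z : B) * (b * star (μ j : B)) * star (μ z : B) *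
    ((μ z : B) * (μ j : B) * star (μ (z + j) : B)) = _
  simp [mul_assoc, ← mul_assoc (star (μ z : B)) (μ z : B), ← mul_assoc (star (μ j : B)) (μ j : B)]

variable {K : Type*} [NormedAddCommGroup K] [InnerProductSpace ℂ K] [CompleteSpace K]
  (π : A →⋆ₐ[ℂ] (K →L[ℂ] K))

/-- The restriction to the component of `j` of the left regular representation. -/
def regularPiece (j : G) : 𝒜 j →ₗ[ℂ] (Ell2 G K →L[ℂ] Ell2 G K) :=
  leftRegularLin h.pair π j ∘ₗ h.coeff j

theorem regularPiece_apply {j : G} (b : 𝒜 j) (f : Ell2 G K) (z : G) :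
    h.regularPiece π j b f z =
      π ⟨(μ (-z) : B) * b * star (μ (-z + j) : B), h.frame_mul_mul_star_frame_mem b.2 (-z)⟩
        (f (-j + z)) :=
  congrArg (fun a => π a (f (-j + z))) (Subtype.ext (h.coe_pair_coeff b (-z)))

theorem regularPiece_one : h.regularPiece π 0 ⟨1, SetLike.GradedOne.one_mem⟩ = 1 := by
  ext f z
  have hweight : (⟨(μ (-z) : B) * 1 * star (μ (-z + 0) : B),
      h.frame_mul_mul_star_frame_mem SetLike.GradedOne.one_mem (-z)⟩ : A) = 1 := by
    ext
    simp
  rw [h.regularPiece_apply, hweight, map_one, neg_zero, zero_add]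
  rfl

theorem regularPiece_mul {j k : G} (b : 𝒜 j) (c : 𝒜 k) :
    h.regularPiece π (j + k) ⟨b * c, SetLike.GradedMul.mul_mem b.2 c.2⟩ =
      h.regularPiece π j b * h.regularPiece π k c := by
  ext f z
  rw [mul_apply_eq_comp, h.regularPiece_apply, h.regularPiece_apply, h.regularPiece_apply,
    ← mul_apply_eq_comp, ← map_mul]
  congr 2
  · ext
    have hunit : star (μ (-z + j) : B) * (μ (-z + j) : B) = 1 := by simp
    simp only [MulMemClass.mk_mul_mk, neg_add_rev, neg_neg, add_assoc, mul_assoc]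
    rw [← mul_assoc (star (μ (-z + j) : B)), hunit, one_mul]
  · rw [neg_add_rev, add_assoc]

theorem regularPiece_star {j : G} (b : 𝒜 j) :
    h.regularPiece π (-j) ⟨star b, StarGraded.star_mem b.2⟩ = star (h.regularPiece π j b) := by
  rw [ContinuousLinearMap.star_eq_adjoint, ContinuousLinearMap.eq_adjoint_iff]
  intro f g
  rw [lp.inner_eq_tsum, lp.inner_eq_tsum, ← (Equiv.addLeft j).tsum_eq fun z =>
    ⟪f z, h.regularPiece π j b g z⟫_ℂ]
  refine tsum_congr fun z => ?_
  rw [h.regularPiece_apply, h.regularPiece_apply, Equiv.coe_addLeft, neg_neg, neg_add_cancel_left,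
    ← ContinuousLinearMap.adjoint_inner_left, ← ContinuousLinearMap.star_eq_adjoint, ← map_star]
  congr 3
  ext
  simp [mul_assoc]

/-- The left regular representation of a graded C⋆-algebra, in the frame `μ`. -/
def regularHom : B →⋆ₐ[ℂ] (Ell2 G K →L[ℂ] Ell2 G K) :=
  gradedStarHom 𝒜 (h.regularPiece π) (h.regularPiece_one π) (h.regularPiece_mul π)
    (h.regularPiece_star π)

theorem regularHom_coe {j : G} (b : 𝒜 j) : h.regularHom π b = h.regularPiece π j b :=
  gradedStarHom_coe 𝒜 ..

theorem regularHom_mul_frame (a : A) (j : G) :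
    h.regularHom π (a * (μ j : B)) = leftRegular h.pair π a j :=
  (h.regularHom_coe π ⟨_, h.mul_frame_mem a j⟩).trans
    (congrArg (leftRegularLin h.pair π j) (h.coeff_mul_frame a j))

theorem regularHom_mem (b : B) : h.regularHom π b ∈ reducedCrossedProduct h.pair π := by
  induction b using DirectSum.Decomposition.inductionOn 𝒜 with
  | zero => simp
  | @homogeneous j b =>
    rw [h.regularHom_coe]
    exact (crossedElem h.pair π (h.coeff j b) j).2
  | add b c hb hc => simpa using add_mem hb hc

open Classical in
theorem regularHom_single_zero (b : B) (ξ : K) (z : G) :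
    h.regularHom π b (lp.single 2 0 ξ) z =
      π (h.pair.ρ (-z) (h.coeff z (DirectSum.decompose 𝒜 b z)) * (h.pair.σ (-z) z : A)) ξ := by
  induction b using DirectSum.Decomposition.inductionOn 𝒜 with
  | zero => simp
  | @homogeneous j b =>
    rw [h.regularHom_coe]
    change π _ ((lp.single 2 0 ξ : Ell2 G K) (-j + z)) = _
    obtain rfl | hjz := eq_or_ne j z
    · rw [neg_add_cancel, lp.single_apply_self, DirectSum.decompose_coe, DirectSum.of_eq_same]
    · have hne : -j + z ≠ 0 := fun heq => hjz (neg_add_eq_zero.1 heq)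
      rw [lp.single_apply_ne _ _ _ hne, DirectSum.decompose_coe,
        DirectSum.of_eq_of_ne _ _ _ hjz.symm]
      simp
  | add b c hb hc =>
    rw [map_add, add_apply, lp.coeFn_add, Pi.add_apply, hb, hc]
    simp [add_mul]

theorem regularHom_injective (hπ : Function.Injective π) :
    Function.Injective (h.regularHom π) := by
  classical
  rw [injective_iff_map_eq_zero]
  intro b hb
  suffices hcomp : ∀ z, DirectSum.decompose 𝒜 b z = 0 from
    (DirectSum.decompose 𝒜).injective (by ext z; simp [hcomp])
  intro z
  have hweight : h.pair.ρ (-z) (h.coeff z (DirectSum.decompose 𝒜 b z)) *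
      (h.pair.σ (-z) z : A) = 0 := by
    refine hπ ((map_zero π).symm ▸ ContinuousLinearMap.ext fun ξ => ?_)
    rw [← h.regularHom_single_zero, hb]
    rfl
  have hzero : (μ (-z) : B) * DirectSum.decompose 𝒜 b z = 0 := by
    simpa [h.coe_pair_coeff, h.frame_zero] using congrArg Subtype.val hweight
  ext
  simpa [← mul_assoc] using congrArg (star (μ (-z) : B) * ·) hzero

theorem reducedCrossedProduct_le_range (hπ : Function.Injective π) :
    reducedCrossedProduct h.pair π ≤ (h.regularHom π).range := by
  refine StarSubalgebra.topologicalClosure_minimal (StarAlgebra.adjoin_le ?_) ?_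
  · rintro _ ⟨⟨a, j⟩, rfl⟩
    exact ⟨_, h.regularHom_mul_frame π a j⟩
  · exact (NonUnitalStarAlgHom.isometry (h.regularHom π)
      (h.regularHom_injective π hπ)).isClosedEmbedding.isClosed_range

/-- The isomorphism of a graded C⋆-algebra with a frame onto the reduced twisted crossed product of
its neutral component. -/
def regularEquiv (hπ : Function.Injective π) : B ≃⋆ₐ[ℂ] reducedCrossedProduct h.pair π :=
  StarAlgEquiv.ofBijective (StarAlgHom.codRestrict (h.regularHom π) _ (h.regularHom_mem π))
    ⟨fun _ _ hab => h.regularHom_injective π hπ (congrArg Subtype.val hab), fun c =>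
      let ⟨b, hb⟩ := h.reducedCrossedProduct_le_range π hπ c.2
      ⟨b, Subtype.ext hb⟩⟩

theorem regularEquiv_symm_crossedElem (hπ : Function.Injective π) (a : A) (j : G) :
    (h.regularEquiv π hπ).symm (crossedElem h.pair π a j) = (a : B) * (μ j : B) :=
  (StarAlgEquiv.symm_apply_eq _).2 (Subtype.ext (h.regularHom_mul_frame π a j).symm)

end IsGradedFrame

end GradedFrame

/-! ### The representation of the equivariant construction -/

section EquivRep

variable {G H : Type*} [Fintype G] [NormedAddCommGroup H]

theorem equivHilb_ext {x y : EquivHilb G H} (hfst : ∀ p, x.fst p = y.fst p)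
    (hsnd : ∀ p, x.snd p = y.snd p) : x = y :=
  WithLp.ofLp_injective 2 (Prod.ext (PiLp.ext hfst) (PiLp.ext hsnd))

variable [AddGroup G] [InnerProductSpace ℂ H]

theorem equivRep_fst (S T : H →L[ℂ] H) (g : G) (x : EquivHilb G H) (p : G × Fin 2) :
    (equivRep S T g x).fst p = S (x.fst (-g + p.1, p.2)) := rfl

theorem equivRep_snd (S T : H →L[ℂ] H) (g : G) (x : EquivHilb G H) (p : G × Fin 2) :
    (equivRep S T g x).snd p = T (x.snd (-g + p.1, p.2)) := rfl

theorem equivRep_one : equivRep (1 : H →L[ℂ] H) 1 (0 : G) = 1 := by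
  ext1 x
  refine equivHilb_ext (fun p => ?_) fun p => ?_
  · rw [equivRep_fst, neg_zero, zero_add]; rfl
  · rw [equivRep_snd, neg_zero, zero_add]; rfl

theorem equivRep_mul (S S' T T' : H →L[ℂ] H) (g k : G) :
    equivRep (S * S') (T * T') (g + k) = equivRep S T g * equivRep S' T' k := by
  ext1 x
  rw [mul_apply_eq_comp]
  refine equivHilb_ext (fun p => ?_) fun p => ?_
  · rw [equivRep_fst, equivRep_fst, equivRep_fst, neg_add_rev, add_assoc]; rfl
  · rw [equivRep_snd, equivRep_snd, equivRep_snd, neg_add_rev, add_assoc]; rfl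

theorem equivRep_star [CompleteSpace H] (S T : H →L[ℂ] H) (g : G) :
    equivRep (star S) (star T) (-g) = star (equivRep S T g) := by
  have hsum (R : H →L[ℂ] H) (u v : G × Fin 2 → H) :
      ∑ p, ⟪star R (u (- -g + p.1, p.2)), v p⟫_ℂ = ∑ p, ⟪u p, R (v (-g + p.1, p.2))⟫_ℂ := by
    rw [← Equiv.sum_comp ((Equiv.addLeft g).prodCongr (Equiv.refl (Fin 2)))
      fun p => ⟪u p, R (v (-g + p.1, p.2))⟫_ℂ]
    refine Finset.sum_congr rfl fun p _ => ?_
    rw [ContinuousLinearMap.star_eq_adjoint, ContinuousLinearMap.adjoint_inner_left, neg_neg]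
    simp [Prod.map]
  rw [ContinuousLinearMap.star_eq_adjoint (equivRep S T g), ContinuousLinearMap.eq_adjoint_iff]
  intro x y
  rw [WithLp.prod_inner_apply, WithLp.prod_inner_apply]
  exact congrArg₂ (· + ·) (hsum S x.fst y.fst) (hsum T x.snd y.snd)

variable {B : Type*} [CStarAlgebra B] [CompleteSpace H]

/-- The restriction to the component of `j` of the representation of a graded C⋆-algebra given by
`b ↦ diag(π⁺(b) ⊗ λ_j ⊗ 1, π⁻(b) ⊗ λ_j ⊗ 1)` for `b` homogeneous of degree `j`. -/
def equivRepPiece (πp πm : B →⋆ₐ[ℂ] (H →L[ℂ] H)) (j : G) :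
    B →ₗ[ℂ] (EquivHilb G H →L[ℂ] EquivHilb G H) where
  toFun b := equivRep (πp b) (πm b) j
  map_add' a b := by
    ext1 x
    rw [add_apply]
    refine equivHilb_ext (fun p => ?_) fun p => ?_
    · simp only [WithLp.add_fst, PiLp.add_apply, equivRep_fst, map_add, add_apply]
    · simp only [WithLp.add_snd, PiLp.add_apply, equivRep_snd, map_add, add_apply]
  map_smul' c a := by
    ext1 x
    rw [smul_apply]
    refine equivHilb_ext (fun p => ?_) fun p => ?_
    · simp only [WithLp.smul_fst, PiLp.smul_apply, equivRep_fst, map_smul, smul_apply,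
        RingHom.id_apply]
    · simp only [WithLp.smul_snd, PiLp.smul_apply, equivRep_snd, map_smul, smul_apply,
        RingHom.id_apply]

variable [DecidableEq G] (𝒜 : G → Submodule ℂ B) [GradedAlgebra 𝒜] [StarGraded 𝒜]

/-- The representation of a graded C⋆-algebra on `(H ⊗ ℓ²(G) ⊗ ℂ²)²` given by
`b ↦ diag(π⁺(b) ⊗ λ_j ⊗ 1, π⁻(b) ⊗ λ_j ⊗ 1)` for `b` homogeneous of degree `j`. -/
def equivRepHom (πp πm : B →⋆ₐ[ℂ] (H →L[ℂ] H)) :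
    B →⋆ₐ[ℂ] (EquivHilb G H →L[ℂ] EquivHilb G H) :=
  gradedStarHom 𝒜 (fun j => equivRepPiece πp πm j ∘ₗ (𝒜 j).subtype)
    (by
      change equivRep (πp 1) (πm 1) 0 = 1
      rw [map_one, map_one, equivRep_one])
    (fun {j k} b c => by
      change equivRep (πp (b * c)) (πm (b * c)) (j + k) = _
      rw [map_mul, map_mul, equivRep_mul]
      rfl)
    (fun {j} b => by
      change equivRep (πp (star b)) (πm (star b)) (-j) = _
      rw [map_star, map_star, equivRep_star]
      rfl)

theorem equivRepHom_of_mem (πp πm : B →⋆ₐ[ℂ] (H →L[ℂ] H)) {j : G} {b : B} (hb : b ∈ 𝒜 j) :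
    equivRepHom 𝒜 πp πm b = equivRep (πp b) (πm b) j :=
  gradedStarHom_coe 𝒜 _ _ _ _ ⟨b, hb⟩

end EquivRep

/-! ### The Fourier basis of `L²(B, τ_B)` -/

section Fourier

variable {θ : ℝ}

/-- The ⋆-algebra of noncommutative trigonometric polynomials, the linear span of the `W_x`. -/
def trigPoly (θ : ℝ) : StarSubalgebra ℂ (QuantumTorus θ) where
  carrier := Submodule.span ℂ (Set.range (W θ))
  mul_mem' := fun {a b} ha hb => by
    have hab := Submodule.mul_mem_mul ha hb
    rw [Submodule.span_mul_span] at hab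
    refine Submodule.span_le.2 ?_ hab
    rintro _ ⟨_, ⟨x, rfl⟩, _, ⟨y, rfl⟩, rfl⟩
    simp only [W_mul]
    exact Submodule.smul_mem _ _ (Submodule.subset_span ⟨_, rfl⟩)
  add_mem' := add_mem
  algebraMap_mem' := fun r => by
    rw [Algebra.algebraMap_eq_smul_one, ← W_zero]
    exact Submodule.smul_mem _ _ (Submodule.subset_span ⟨_, rfl⟩)
  star_mem' := fun {a} ha => by
    induction ha using Submodule.span_induction with
    | mem _ hx =>
      obtain ⟨x, rfl⟩ := hx
      rw [W_star]
      exact Submodule.subset_span ⟨_, rfl⟩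
    | zero => rw [star_zero]; exact zero_mem _
    | add _ _ _ _ hx hy => rw [star_add]; exact add_mem hx hy
    | smul c _ _ hx => rw [star_smul]; exact Submodule.smul_mem _ _ hx

theorem leftRegular_torusPair (c : ℂ) (x : Z2) :
    leftRegular (torusPair θ) scalarRep c x = torusIncl θ (c • W θ x) := by
  rw [map_smul]
  ext f z
  change scalarRep (c * sigmaTheta θ (-z) x) (f (-x + z)) =
    c * scalarRep (1 * sigmaTheta θ (-z) x) (f (-x + z))
  rw [map_mul, map_mul, map_one, one_mul]
  change algebraMap ℂ (ℂ →L[ℂ] ℂ) c _ = _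
  rw [Algebra.algebraMap_eq_smul_one]
  rfl

theorem dense_trigPoly : Dense (trigPoly θ : Set (QuantumTorus θ)) := by
  have hle : StarAlgebra.adjoin ℂ
      (Set.range fun p : ℂ × Z2 => leftRegular (torusPair θ) scalarRep p.1 p.2) ≤
      (trigPoly θ).map (torusIncl θ) := by
    refine StarAlgebra.adjoin_le ?_
    rintro _ ⟨⟨c, x⟩, rfl⟩
    exact ⟨c • W θ x, Submodule.smul_mem _ _ (Submodule.subset_span ⟨x, rfl⟩),
      (leftRegular_torusPair c x).symm⟩
  intro b
  have hb : torusIncl θ b ∈ closure ((trigPoly θ).map (torusIncl θ) :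
      Set (Ell2 Z2 ℂ →L[ℂ] Ell2 Z2 ℂ)) := closure_mono hle b.2
  exact closure_subtype.2 hb

theorem torus_ext {E : Type*} [AddCommMonoid E] [Module ℂ E] [TopologicalSpace E] [T2Space E]
    {f g : QuantumTorus θ →L[ℂ] E} (h : ∀ x, f (W θ x) = g (W θ x)) : f = g :=
  ContinuousLinearMap.ext_on dense_trigPoly (Set.forall_mem_range.2 h)

theorem inner_iotaB (a b : QuantumTorus θ) :
    ⟪iotaB θ a, iotaB θ b⟫_ℂ = torusTrace θ (star a * b) := by
  rw [iotaB, iotaB, UniformSpace.Completion.inner_coe]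
  rfl

theorem piTau_iotaB (a b : QuantumTorus θ) : piTau θ a (iotaB θ b) = iotaB θ (a * b) := by
  change (torusTrace θ).gnsNonUnitalStarAlgHom a _ = _
  rw [iotaB, PositiveLinearMap.gnsNonUnitalStarAlgHom_apply_coe]
  rfl

theorem iotaB_smul (c : ℂ) (b : QuantumTorus θ) : iotaB θ (c • b) = c • iotaB θ b := by
  simp [iotaB]

/-- The map `ι_B : B → L²(B, τ_B)` as a continuous linear map. -/
def iotaCLM (θ : ℝ) : QuantumTorus θ →L[ℂ] L2B θ where
  toFun := iotaB θ
  map_add' a b := by simp [iotaB, UniformSpace.Completion.coe_add]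
  map_smul' := iotaB_smul
  cont := by
    have heq : iotaB θ = fun b => piTau θ b (iotaB θ 1) := by
      funext b
      rw [piTau_iotaB, mul_one]
    rw [heq]
    exact (ContinuousLinearMap.apply ℂ (L2B θ) (iotaB θ 1)).continuous.comp
      (map_continuous (piTau θ))

theorem denseRange_iotaB : DenseRange (iotaB θ) :=
  UniformSpace.Completion.denseRange_coe (α := (torusTrace θ).PreGNS)

theorem orthonormal_iotaB_W : Orthonormal ℂ fun r => iotaB θ (W θ r) := by
  rw [orthonormal_iff_ite]
  intro r s
  rw [inner_iotaB, W_star, W_mul, map_smul, torusTrace_W]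
  by_cases h : r = s
  · subst h
    simp [sigmaTheta, thetaForm_neg_left, thetaForm_self]
  · simp [h, neg_add_eq_zero]

theorem topologicalClosure_span_iotaB_W :
    (Submodule.span ℂ (Set.range fun r => iotaB θ (W θ r))).topologicalClosure = ⊤ := by
  have hdense := denseRange_iotaB.dense_image (iotaCLM θ).continuous (dense_trigPoly (θ := θ))
  refine top_unique fun x _ => closure_mono ?_ (hdense x)
  rintro _ ⟨b, hb, rfl⟩
  have himage := Submodule.mem_map_of_mem (f := (iotaCLM θ : QuantumTorus θ →ₗ[ℂ] L2B θ)) hb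
  rw [Submodule.map_span, ← Set.range_comp] at himage
  exact himage

/-- The Hilbert basis `ι_B(W_r)`, `r ∈ ℤ²`, of `L²(B, τ_B)`. -/
def fourier (θ : ℝ) : HilbertBasis Z2 ℂ (L2B θ) :=
  HilbertBasis.mk orthonormal_iotaB_W topologicalClosure_span_iotaB_W.ge

theorem fourier_apply (r : Z2) : fourier θ r = iotaB θ (W θ r) := by
  rw [fourier, HilbertBasis.coe_mk]

theorem fourier_repr_of_hasSum {α : Z2 → ℂ} {y : L2B θ}
    (h : HasSum (fun r => α r • iotaB θ (W θ r)) y) (n : Z2) : (fourier θ).repr y n = α n := by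
  have hinner := (innerSL ℂ (fourier θ n)).hasSum h
  have hsingle (r : Z2) : innerSL ℂ (fourier θ n) (α r • iotaB θ (W θ r)) =
      if r = n then α n else 0 := by
    rw [innerSL_apply_apply, inner_smul_right, ← fourier_apply,
      orthonormal_iff_ite.1 (fourier θ).orthonormal]
    rcases eq_or_ne r n with rfl | hr
    · simp
    · simp [hr, hr.symm]
  simp only [hsingle] at hinner
  rw [HilbertBasis.repr_apply_apply]
  exact hinner.unique (hasSum_ite_eq n (α n))

theorem hasSum_iotaB {α : Z2 → ℂ} {b : QuantumTorus θ} (h : HasSum (fun r => α r • W θ r) b) :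
    HasSum (fun r => α r • iotaB θ (W θ r)) (iotaB θ b) :=
  ((iotaCLM θ).hasSum h).congr_fun fun _ => (iotaB_smul _ _).symm

end Fourier

/-! ### Diagonal operators -/

section Diagonal

variable {ι H : Type*} [NormedAddCommGroup H] [InnerProductSpace ℂ H]
  {b : HilbertBasis ι ℂ H} {c d : ι → ℂ} {f g : H →ₗ.[ℂ] H}

/-- The unbounded operator `f` is diagonal in the Hilbert basis `b`, with eigenvalues `c`. Its
domain contains the basis but need not be maximal. -/
structure IsDiagonal (b : HilbertBasis ι ℂ H) (c : ι → ℂ) (f : H →ₗ.[ℂ] H) : Prop where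
  basis_mem (n : ι) : b n ∈ f.domain
  repr_apply (x : f.domain) (n : ι) : b.repr (f x) n = c n * b.repr (x : H) n

namespace IsDiagonal

theorem add (hf : IsDiagonal b c f) (hg : IsDiagonal b d g) :
    IsDiagonal b (fun n => c n + d n) (f + g) where
  basis_mem n := ⟨hf.basis_mem n, hg.basis_mem n⟩
  repr_apply x n := by
    rw [LinearPMap.add_apply, map_add, lp.coeFn_add, Pi.add_apply, hf.repr_apply, hg.repr_apply,
      add_mul]

theorem sub (hf : IsDiagonal b c f) (hg : IsDiagonal b d g) :
    IsDiagonal b (fun n => c n - d n) (f - g) where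
  basis_mem n := ⟨hf.basis_mem n, hg.basis_mem n⟩
  repr_apply x n := by
    rw [LinearPMap.sub_apply, map_sub, lp.coeFn_sub, Pi.sub_apply, hf.repr_apply, hg.repr_apply,
      sub_mul]

theorem smul (hf : IsDiagonal b c f) (z : ℂ) : IsDiagonal b (fun n => z * c n) (z • f) where
  basis_mem n := hf.basis_mem n
  repr_apply x n := by
    rw [LinearPMap.smul_apply, map_smul, lp.coeFn_smul, Pi.smul_apply, hf.repr_apply, smul_eq_mul,
      mul_assoc]

theorem apply_basis (hf : IsDiagonal b c f) (n : ι) : f ⟨b n, hf.basis_mem n⟩ = c n • b n := by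
  refine ell2_ext b.repr fun k => ?_
  classical
  rw [hf.repr_apply, map_smul, lp.coeFn_smul, Pi.smul_apply, b.repr_self, lp.single_apply,
    smul_eq_mul]
  rcases eq_or_ne k n with rfl | hk
  · rfl
  · simp [Pi.single_eq_of_ne hk]

theorem le_blockOp (hf : IsDiagonal b c f) : f ≤ blockOp b.repr fun n => c n • 1 := by
  refine LinearPMap.le_of_le_graph fun p hp => ?_
  obtain ⟨y, hy, hfy⟩ := f.mem_graph_iff.1 hp
  rw [← Prod.mk.eta (p := p), ← hy, ← hfy, mem_graph_blockOp]
  exact hf.repr_apply y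

theorem closure_eq_blockOp (hf : IsDiagonal b c f) :
    f.closure = blockOp b.repr fun n => c n • 1 := by
  have hclosed := blockOp_isClosed b.repr fun n => c n • (1 : ℂ →L[ℂ] ℂ)
  apply LinearPMap.eq_of_eq_graph
  rw [← (hclosed.isClosable.leIsClosable hf.le_blockOp).graph_closure_eq_closure_graph]
  refine le_antisymm (Submodule.topologicalClosure_minimal _
    (LinearPMap.le_graph_of_le hf.le_blockOp) hclosed) ?_
  rintro ⟨y, z⟩ hyz
  rw [mem_graph_blockOp] at hyz
  refine mem_closure_of_tendsto ((b.hasSum_repr y).prodMk (b.hasSum_repr z))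
    (Filter.Eventually.of_forall fun s => Submodule.sum_mem _ fun n _ => ?_)
  have hterm := Submodule.smul_mem _ (b.repr y n) (f.mem_graph ⟨b n, hf.basis_mem n⟩)
  rw [hf.apply_basis, Prod.smul_mk, smul_smul, mul_comm] at hterm
  rw [hyz n]
  exact hterm

end IsDiagonal

end Diagonal

/-! ### The operators `D^±` -/

section Dirac

variable {θ : ℝ}

theorem fourier_repr_of_mem_derivGraph {j : Fin 2} {y z : L2B θ} (h : (y, z) ∈ derivGraph θ j)
    (n : Z2) :
    (fourier θ).repr z n = 2 * Real.pi * Complex.I * (n j : ℂ) * (fourier θ).repr y n := by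
  obtain ⟨α, b, -, hb, rfl : y = iotaB θ b, hz⟩ := h
  rw [fourier_repr_of_hasSum hz, fourier_repr_of_hasSum (hasSum_iotaB hb)]

theorem graph_torusDeriv (j : Fin 2) : (torusDeriv θ j).graph = derivGraph θ j := by
  refine Submodule.toLinearPMap_graph_eq _ ?_
  rintro ⟨y, z⟩ hyz (rfl : y = 0)
  refine ell2_ext (fourier θ).repr fun n => ?_
  rw [fourier_repr_of_mem_derivGraph hyz n]
  simp

theorem isSchwartz_single (n : Z2) : IsSchwartz (Pi.single n 1) := by
  intro k
  refine ⟨(1 + (n 0 : ℝ) ^ 2 + (n 1 : ℝ) ^ 2) ^ k, ?_⟩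
  rintro _ ⟨r, rfl⟩
  rcases eq_or_ne r n with rfl | hr
  · simp
  · simp only [Pi.single_eq_of_ne hr, norm_zero, ne_eq, OfNat.ofNat_ne_zero, not_false_eq_true,
      zero_pow, mul_zero]
    positivity

theorem iotaB_W_mem_derivGraph (j : Fin 2) (n : Z2) :
    (iotaB θ (W θ n), (2 * Real.pi * Complex.I * (n j : ℂ)) • iotaB θ (W θ n)) ∈
      derivGraph θ j := by
  refine ⟨Pi.single n 1, W θ n, isSchwartz_single n, ?_, rfl, ?_⟩
  · convert hasSum_ite_eq n (W θ n) using 2 with r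
    rcases eq_or_ne r n with rfl | hr <;> simp [*]
  · convert hasSum_ite_eq n ((2 * Real.pi * Complex.I * (n j : ℂ)) • iotaB θ (W θ n)) using 2
      with r
    rcases eq_or_ne r n with rfl | hr <;> simp [*]

theorem isDiagonal_torusDeriv (j : Fin 2) :
    IsDiagonal (fourier θ) (fun n => 2 * Real.pi * Complex.I * n j) (torusDeriv θ j) where
  basis_mem n := by
    rw [fourier_apply]
    exact LinearPMap.mem_domain_of_mem_graph
      (graph_torusDeriv j ▸ iotaB_W_mem_derivGraph j n)
  repr_apply x n :=
    fourier_repr_of_mem_derivGraph (graph_torusDeriv j ▸ (torusDeriv θ j).mem_graph x) n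

/-- The complex number `n₁ + i n₂`. -/
def Z2.toComplex (n : Z2) : ℂ := (n 0 : ℂ) + Complex.I * n 1

theorem Z2.star_toComplex (n : Z2) : star n.toComplex = (n 0 : ℂ) - Complex.I * n 1 := by
  simp [Z2.toComplex, sub_eq_add_neg]

theorem diracPlus_eq_blockOp :
    diracPlus θ = blockOp (fourier θ).repr fun n => (2 * Real.pi * n.toComplex) • 1 := by
  refine (((isDiagonal_torusDeriv 0).add ((isDiagonal_torusDeriv 1).smul Complex.I)).smul
    (-Complex.I)).closure_eq_blockOp.trans ?_
  congr! 3 with n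
  rw [Z2.toComplex]
  linear_combination (-(2 * Real.pi * (n 0 : ℂ)) -
    2 * Real.pi * (n 1 : ℂ) * Complex.I) * Complex.I_sq

theorem diracMinus_eq_blockOp :
    diracMinus θ = blockOp (fourier θ).repr fun n => (2 * Real.pi * star n.toComplex) • 1 := by
  refine (((isDiagonal_torusDeriv 0).sub ((isDiagonal_torusDeriv 1).smul Complex.I)).smul
    (-Complex.I)).closure_eq_blockOp.trans ?_
  congr! 3 with n
  rw [Z2.star_toComplex]
  linear_combination (-(2 * Real.pi * (n 0 : ℂ)) +
    2 * Real.pi * (n 1 : ℂ) * Complex.I) * Complex.I_sq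

end Dirac

/-! ### Coordinates on `(H ⊗ ℓ²(G) ⊗ ℂ²) ⊕ (H ⊗ ℓ²(G) ⊗ ℂ²)` -/

theorem hasSum_prod_fintype {ι G E : Type*} [Fintype G] [AddCommMonoid E] [TopologicalSpace E]
    [ContinuousAdd E] {f : ι × G → E} {a : G → E} (h : ∀ g, HasSum (fun m => f (m, g)) (a g)) :
    HasSum f (∑ g, a g) := by
  classical
  have hslice (g : G) : HasSum (fun i : ι × G => if i.2 = g then f i else 0) (a g) := by
    refine ((Prod.mk_left_injective g).hasSum_iff ?_).1 ?_
    · rintro ⟨m, g'⟩ hm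
      exact if_neg fun hg => hm ⟨m, by rw [← hg]⟩
    · simpa [Function.comp_def] using h g
  convert hasSum_sum (s := Finset.univ) fun g _ => hslice g using 2 with i
  simp

section Coordinates

variable {ι G H : Type*} [Fintype G] [NormedAddCommGroup H] [InnerProductSpace ℂ H]
  (b : HilbertBasis ι ℂ H)

/-- The coordinates of a vector: an element of `ℂ² ⊕ ℂ²` for each basis vector of `H` and each
group element. -/
def coordFun (x : EquivHilb G H) (i : ι × G) : EuclideanSpace ℂ (Fin 2 ⊕ Fin 2) :=
  WithLp.toLp 2 (Sum.elim (fun k => b.repr (x.fst (i.2, k)) i.1)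
    fun k => b.repr (x.snd (i.2, k)) i.1)

theorem hasSum_norm_sq_repr (y : H) : HasSum (fun m => ‖b.repr y m‖ ^ 2) (‖y‖ ^ 2) := by
  have hsum := lp.hasSum_norm (p := 2) (by norm_num) (b.repr y)
  rw [b.repr.norm_map] at hsum
  simpa using hsum

theorem hasSum_norm_sq_coordFun (x : EquivHilb G H) :
    HasSum (fun i => ‖coordFun b x i‖ ^ 2) (‖x‖ ^ 2) := by
  have hnorm : ‖x‖ ^ 2 = ∑ g, ∑ k, (‖x.fst (g, k)‖ ^ 2 + ‖x.snd (g, k)‖ ^ 2) := by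
    rw [WithLp.prod_norm_sq_eq_of_L2, PiLp.norm_sq_eq_of_L2, PiLp.norm_sq_eq_of_L2,
      Fintype.sum_prod_type, Fintype.sum_prod_type, ← Finset.sum_add_distrib]
    simp only [Finset.sum_add_distrib]
  rw [hnorm]
  refine hasSum_prod_fintype fun g => ?_
  convert hasSum_sum (s := Finset.univ) fun k (_ : k ∈ Finset.univ) =>
    (hasSum_norm_sq_repr b (x.fst (g, k))).add (hasSum_norm_sq_repr b (x.snd (g, k)))
    using 2 with m
  rw [EuclideanSpace.norm_sq_eq, Fintype.sum_sum_type, ← Finset.sum_add_distrib]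
  rfl

/-- The passage to coordinates as a linear isometry. -/
def coordIsometry : EquivHilb G H →ₗᵢ[ℂ] Ell2 (ι × G) (EuclideanSpace ℂ (Fin 2 ⊕ Fin 2)) where
  toFun x := ⟨coordFun b x, memℓp_gen (by simpa using (hasSum_norm_sq_coordFun b x).summable)⟩
  map_add' x y := by
    refine lp.ext (funext fun i => PiLp.ext fun k => ?_)
    change _ = coordFun b x i k + coordFun b y i k
    rcases k with k | k <;> simp [coordFun]
  map_smul' c x := by
    refine lp.ext (funext fun i => PiLp.ext fun k => ?_)
    rcases k with k | k <;> simp [coordFun]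
  norm_map' x := by
    have hsum := lp.hasSum_norm (p := 2) (by norm_num)
      (⟨coordFun b x, memℓp_gen (by simpa using (hasSum_norm_sq_coordFun b x).summable)⟩ :
        Ell2 (ι × G) (EuclideanSpace ℂ (Fin 2 ⊕ Fin 2)))
    simp only [ENNReal.toReal_ofNat, Real.rpow_ofNat] at hsum
    exact (sq_eq_sq₀ (norm_nonneg _) (norm_nonneg _)).1
      (hsum.unique (hasSum_norm_sq_coordFun b x))

theorem coordIsometry_surjective : Function.Surjective (coordIsometry (G := G) b) := by
  intro f
  have hmem (g : G) (s : Fin 2 ⊕ Fin 2) : Memℓp (fun m => f (m, g) s) 2 :=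
    memℓp_gen <| .of_nonneg_of_le (fun m => by positivity)
      (fun m => Real.rpow_le_rpow (norm_nonneg _) (PiLp.norm_apply_le _ _) (by norm_num))
      ((lp.hasSum_norm (p := 2) (by norm_num) f).summable.comp_injective
        (Prod.mk_left_injective g))
  refine ⟨WithLp.toLp 2 (WithLp.toLp 2 fun p => b.repr.symm ⟨_, hmem p.1 (Sum.inl p.2)⟩,
    WithLp.toLp 2 fun p => b.repr.symm ⟨_, hmem p.1 (Sum.inr p.2)⟩), ?_⟩
  refine lp.ext (funext fun i => PiLp.ext fun k => ?_)
  rcases k with k | k <;>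
  · change b.repr (b.repr.symm _) _ = _
    rw [b.repr.apply_symm_apply]

/-- The passage to coordinates as a unitary. -/
def coord : EquivHilb G H ≃ₗᵢ[ℂ] Ell2 (ι × G) (EuclideanSpace ℂ (Fin 2 ⊕ Fin 2)) :=
  LinearIsometryEquiv.ofSurjective (coordIsometry b) (coordIsometry_surjective b)

theorem coord_inl (x : EquivHilb G H) (i : ι × G) (k : Fin 2) :
    coord b x i (Sum.inl k) = b.repr (x.fst (i.2, k)) i.1 := rfl

theorem coord_inr (x : EquivHilb G H) (i : ι × G) (k : Fin 2) :
    coord b x i (Sum.inr k) = b.repr (x.snd (i.2, k)) i.1 := rfl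

end Coordinates

/-! ### The blocks of the equivariant Dirac operator -/

section DiracBlock

/-- The block `[[A, c̄], [c, -A]]` of the equivariant Dirac operator. -/
def diracBlock (A : Matrix (Fin 2) (Fin 2) ℂ) (c : ℂ) :
    EuclideanSpace ℂ (Fin 2 ⊕ Fin 2) →L[ℂ] EuclideanSpace ℂ (Fin 2 ⊕ Fin 2) :=
  Matrix.toEuclideanCLM (𝕜 := ℂ) (Matrix.fromBlocks A (star c • 1) (c • 1) (-A))

theorem diracBlock_inl (A : Matrix (Fin 2) (Fin 2) ℂ) (c : ℂ)
    (v : EuclideanSpace ℂ (Fin 2 ⊕ Fin 2)) (k : Fin 2) :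
    diracBlock A c v (Sum.inl k) = ∑ l, A k l * v (Sum.inl l) + star c * v (Sum.inr k) := by
  rw [diracBlock, Matrix.ofLp_toEuclideanCLM, Matrix.fromBlocks_mulVec]
  fin_cases k <;> simp

theorem diracBlock_inr (A : Matrix (Fin 2) (Fin 2) ℂ) (c : ℂ)
    (v : EuclideanSpace ℂ (Fin 2 ⊕ Fin 2)) (k : Fin 2) :
    diracBlock A c v (Sum.inr k) = c * v (Sum.inl k) - ∑ l, A k l * v (Sum.inr l) := by
  rw [diracBlock, Matrix.ofLp_toEuclideanCLM, Matrix.fromBlocks_mulVec]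
  fin_cases k <;> simp [sub_eq_add_neg, add_comm]

theorem diracBlock_isSelfAdjoint {A : Matrix (Fin 2) (Fin 2) ℂ} (hA : A.IsHermitian) (c : ℂ) :
    IsSelfAdjoint (diracBlock A c) := by
  refine IsSelfAdjoint.map ?_ (Matrix.toEuclideanCLM (n := Fin 2 ⊕ Fin 2) (𝕜 := ℂ))
  rw [IsSelfAdjoint, Matrix.star_eq_conjTranspose, Matrix.fromBlocks_conjTranspose]
  simp [hA.eq]

theorem diracBlock_mul_self {A : Matrix (Fin 2) (Fin 2) ℂ} {a : ℂ} (hA : A * A = a • 1) (c : ℂ) :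
    diracBlock A c * diracBlock A c = (a + star c * c) • 1 := by
  rw [diracBlock, ← map_mul, Matrix.fromBlocks_multiply, ← map_one (Matrix.toEuclideanCLM (𝕜 := ℂ)),
    ← map_smul, ← Matrix.fromBlocks_one, Matrix.fromBlocks_smul]
  congr 2
  · simp [hA, add_smul, smul_smul, mul_comm]
  · simp
  · simp
  · simp [hA, add_smul, smul_smul, mul_comm, add_comm]

theorem diracBlock_add (A A' : Matrix (Fin 2) (Fin 2) ℂ) (c c' : ℂ) :
    diracBlock A c + diracBlock A' c' = diracBlock (A + A') (c + c') := by
  simp only [diracBlock, ← map_add, Matrix.fromBlocks_add, ← add_smul, ← star_add, neg_add]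

theorem diracBlock_sub (A A' : Matrix (Fin 2) (Fin 2) ℂ) (c c' : ℂ) :
    diracBlock A c - diracBlock A' c' = diracBlock (A - A') (c - c') := by
  rw [sub_eq_iff_eq_add, diracBlock_add, sub_add_cancel, sub_add_cancel]

theorem norm_diracBlock_sq {A : Matrix (Fin 2) (Fin 2) ℂ} (hA : A.IsHermitian) {a : ℝ}
    (hsq : A * A = ((a ^ 2 : ℝ) : ℂ) • 1) (c : ℂ) : ‖diracBlock A c‖ ^ 2 = a ^ 2 + ‖c‖ ^ 2 := by
  have hreal : (((a ^ 2 : ℝ) : ℂ) + star c * c) = ((a ^ 2 + ‖c‖ ^ 2 : ℝ) : ℂ) := by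
    rw [Complex.star_def, Complex.conj_mul']
    push_cast
    rfl
  have hstar := CStarRing.norm_star_mul_self (x := diracBlock A c)
  rw [(diracBlock_isSelfAdjoint hA c).star_eq, diracBlock_mul_self hsq, hreal, norm_smul, norm_one,
    mul_one, Complex.norm_real, Real.norm_of_nonneg (by positivity)] at hstar
  rw [sq ‖diracBlock A c‖, hstar]

theorem norm_diracBlock_zero_left (c : ℂ) : ‖diracBlock 0 c‖ = ‖c‖ := by
  have hsq := norm_diracBlock_sq Matrix.isHermitian_zero (a := 0) (by simp) c
  rw [zero_pow two_ne_zero, zero_add] at hsq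
  exact (sq_eq_sq₀ (norm_nonneg _) (norm_nonneg _)).1 hsq

theorem norm_diracBlock_le (A : Matrix (Fin 2) (Fin 2) ℂ) (c : ℂ) :
    ‖diracBlock A c‖ ≤ ‖diracBlock A 0‖ + ‖c‖ :=
  calc ‖diracBlock A c‖ = ‖diracBlock A 0 + diracBlock 0 c‖ := by
        rw [diracBlock_add, add_zero, zero_add]
    _ ≤ ‖diracBlock A 0‖ + ‖diracBlock 0 c‖ := norm_add_le _ _
    _ = ‖diracBlock A 0‖ + ‖c‖ := by rw [norm_diracBlock_zero_left]

theorem exists_norm_diracBlock_sub_le {G : Type*} [Finite G] (ℓ : G → Matrix (Fin 2) (Fin 2) ℂ) :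
    ∃ C, 0 ≤ C ∧ ∀ g g' c c', ‖diracBlock (ℓ g) c - diracBlock (ℓ g') c'‖ ≤
      C * (1 + ‖c - c'‖) := by
  obtain ⟨N, hN⟩ := (Set.finite_range fun p : G × G => ‖diracBlock (ℓ p.1 - ℓ p.2) 0‖).bddAbove
  refine ⟨|N| + 1, by positivity, fun g g' c c' => ?_⟩
  have hle : ‖diracBlock (ℓ g - ℓ g') 0‖ ≤ |N| := (hN ⟨(g, g'), rfl⟩).trans (le_abs_self N)
  rw [diracBlock_sub]
  refine (norm_diracBlock_le _ _).trans ?_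
  nlinarith [mul_nonneg (abs_nonneg N) (norm_nonneg (c - c'))]

end DiracBlock

section EquivDirac

variable {ι G H : Type*} [Fintype G] [NormedAddCommGroup H] [InnerProductSpace ℂ H]

theorem mem_graph_equivDirac {Dp Dm : H →ₗ.[ℂ] H} {ℓ : G → Matrix (Fin 2) (Fin 2) ℂ}
    {x y : EquivHilb G H} : (x, y) ∈ (equivDirac Dp Dm ℓ).graph ↔
      (∀ p, (x.fst p, y.snd p + lengthMul ℓ x.snd p) ∈ Dp.graph) ∧
      ∀ p, (x.snd p, y.fst p - lengthMul ℓ x.fst p) ∈ Dm.graph := by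
  constructor
  · intro h
    obtain ⟨x', rfl, rfl⟩ := (LinearPMap.mem_graph_iff _).1 h
    refine ⟨fun p => ?_, fun p => ?_⟩
    · convert Dp.mem_graph ⟨_, x'.2.1 p⟩ using 2
      exact sub_add_cancel (Dp ⟨_, x'.2.1 p⟩) _
    · convert Dm.mem_graph ⟨_, x'.2.2 p⟩ using 2
      exact add_sub_cancel_left _ (Dm ⟨_, x'.2.2 p⟩)
  · rintro ⟨hp, hm⟩
    have hDp p := (LinearPMap.image_iff (LinearPMap.mem_domain_of_mem_graph (hp p))).2 (hp p)
    have hDm p := (LinearPMap.image_iff (LinearPMap.mem_domain_of_mem_graph (hm p))).2 (hm p)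
    refine (LinearPMap.mem_graph_iff _).2 ⟨⟨x, fun p => LinearPMap.mem_domain_of_mem_graph (hp p),
      fun p => LinearPMap.mem_domain_of_mem_graph (hm p)⟩, rfl, ?_⟩
    apply WithLp.ofLp_injective 2
    apply Prod.ext <;> ext p
    · change lengthMul ℓ x.fst p + Dm ⟨_, _⟩ = y.fst p
      rw [← hDm, add_sub_cancel]
    · change Dp ⟨_, _⟩ - lengthMul ℓ x.snd p = y.snd p
      rw [← hDp, add_sub_cancel_right]

theorem repr_lengthMul (b : HilbertBasis ι ℂ H) (ℓ : G → Matrix (Fin 2) (Fin 2) ℂ) (u : Tens G H)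
    (p : G × Fin 2) (n : ι) :
    b.repr (lengthMul ℓ u p) n = ∑ l, ℓ p.1 p.2 l * b.repr (u (p.1, l)) n := by
  change b.repr (∑ l, ℓ p.1 p.2 l • u (p.1, l)) n = _
  rw [map_sum, lp.coeFn_sum, Finset.sum_apply]
  simp only [map_smul, lp.coeFn_smul, Pi.smul_apply, smul_eq_mul]

theorem equivDirac_eq_blockOp (b : HilbertBasis ι ℂ H) (c : ι → ℂ)
    (ℓ : G → Matrix (Fin 2) (Fin 2) ℂ) :
    equivDirac (blockOp b.repr fun n => c n • 1) (blockOp b.repr fun n => star (c n) • 1) ℓ =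
      blockOp (coord b) fun i => diracBlock (ℓ i.2) (c i.1) := by
  apply LinearPMap.eq_of_eq_graph
  ext ⟨x, y⟩
  have hblock (i : ι × G) : coord b y i = diracBlock (ℓ i.2) (c i.1) (coord b x i) ↔
      (∀ k, b.repr (y.snd (i.2, k)) i.1 + ∑ l, ℓ i.2 k l * b.repr (x.snd (i.2, l)) i.1 =
        c i.1 * b.repr (x.fst (i.2, k)) i.1) ∧
      ∀ k, b.repr (y.fst (i.2, k)) i.1 - ∑ l, ℓ i.2 k l * b.repr (x.fst (i.2, l)) i.1 =
        star (c i.1) * b.repr (x.snd (i.2, k)) i.1 := by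
    rw [PiLp.ext_iff, Sum.forall, and_comm]
    simp only [diracBlock_inl, diracBlock_inr, coord_inl, coord_inr, eq_sub_iff_add_eq,
      sub_eq_iff_eq_add']
  simp only [mem_graph_equivDirac, mem_graph_blockOp, map_add, map_sub, lp.coeFn_add, lp.coeFn_sub,
    Pi.add_apply, Pi.sub_apply, repr_lengthMul, hblock, forall_and, Prod.forall]
  exact and_congr ⟨fun h n g k => h g k n, fun h g k n => h n g k⟩
    ⟨fun h n g k => h g k n, fun h g k n => h n g k⟩

end EquivDirac

/-! ### The grading of `B` by the dual group -/

section Grading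

variable (M : Matrix (Fin 2) (Fin 2) ℤ) [Fact (1 < M.det)]

instance : Finite (Deck M) :=
  haveI : Fact (1 < M.transpose.det) := ⟨by rw [Matrix.det_transpose]; exact Fact.out⟩
  inferInstanceAs (Finite (DualDeck M.transpose))

instance : Fintype (Deck M) := Fintype.ofFinite _

instance : DecidableEq (DualDeck M) := Classical.decEq _

theorem deckChar_out (t x : Z2) :
    deckChar M (Quotient.out (Submodule.Quotient.mk t : Deck M)) x = deckChar M t x := by
  have hmk : (Submodule.Quotient.mk (Quotient.out (Submodule.Quotient.mk t : Deck M)) : Deck M) =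
      Submodule.Quotient.mk t := Quotient.out_eq _
  obtain ⟨k, hk⟩ := (Submodule.Quotient.eq _).1 hmk
  rw [← sub_add_cancel (Quotient.out (Submodule.Quotient.mk t : Deck M)) t, ← hk,
    deckChar_add_left, Matrix.mulVecLin_apply, deckChar_range_left, one_mul]

theorem deckChar_eq_of_mk_eq (t : Z2) {x y : Z2}
    (h : (Submodule.Quotient.mk x : DualDeck M) = Submodule.Quotient.mk y) :
    deckChar M t x = deckChar M t y := by
  obtain ⟨k, hk⟩ := (Submodule.Quotient.eq _).1 h
  rw [← sub_add_cancel x y, ← hk, deckChar_add_right, Matrix.mulVecLin_apply, deckChar_range,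
    one_mul]

theorem mk_eq_zero_of_inv_transpose_mulVec_eq {x n : Z2}
    (h : (M.map (Int.cast : ℤ → ℝ))⁻¹.transpose.mulVec (fun i => (x i : ℝ)) = fun i => (n i : ℝ)) :
    (Submodule.Quotient.mk x : DualDeck M) = 0 := by
  refine (Submodule.Quotient.mk_eq_zero _).2 ⟨n, ?_⟩
  have hreal : (M.map (Int.cast : ℤ → ℝ)).transpose.mulVec (fun i => (n i : ℝ)) =
      fun i => (x i : ℝ) := by
    rw [← h, Matrix.mulVec_mulVec, ← Matrix.transpose_mul,
      Matrix.nonsing_inv_mul _ (isUnit_iff_ne_zero.2 (det_real_ne_zero M)), Matrix.transpose_one,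
      Matrix.one_mulVec]
  funext i
  rw [Matrix.mulVecLin_apply]
  have hcast : ((M.transpose.mulVec n i : ℤ) : ℝ) = (x i : ℝ) := by
    rw [← congrFun hreal i]
    simp [Matrix.mulVec, dotProduct, Fin.sum_univ_two]
  exact_mod_cast hcast

theorem mk_eq_zero_of_deckChar_eq_one {x : Z2} (h : ∀ t, deckChar M t x = 1) :
    (Submodule.Quotient.mk x : DualDeck M) = 0 := by
  have hint (k : Fin 2) : ∃ n : ℤ,
      (M.map (Int.cast : ℤ → ℝ))⁻¹.transpose.mulVec (fun i => (x i : ℝ)) k = n := by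
    obtain ⟨n, hn⟩ := Complex.exp_eq_one_iff.1 (h (Pi.single k 1))
    have hsingle : (fun i => ((Pi.single k 1 : Z2) i : ℝ)) = Pi.single k 1 := by
      funext i
      rcases eq_or_ne i k with rfl | hi <;> simp [*]
    rw [hsingle, mul_comm] at hn
    have hdot := mul_right_cancel₀ Complex.two_pi_I_ne_zero hn
    rw [Matrix.mulVec_single_one] at hdot
    exact ⟨n, by exact_mod_cast hdot⟩
  choose n hn using hint
  exact mk_eq_zero_of_inv_transpose_mulVec_eq M (funext hn)

/-- The character `t ↦ exp(2πi ⟨M⁻¹ t, x⟩)` of `G = ℤ² / M ℤ²`. -/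
def deckAddChar (x : Z2) : AddChar (Deck M) ℂ where
  toFun g := deckChar M (Quotient.out g) x
  map_zero_eq_one' := by
    rw [← Submodule.Quotient.mk_zero, deckChar_out, ← Matrix.mulVec_zero M, deckChar_range_left]
  map_add_eq_mul' g h := by
    conv_lhs => rw [← Quotient.out_eq g, ← Quotient.out_eq h]
    exact (deckChar_out M (Quotient.out g + Quotient.out h) x).trans (deckChar_add_left M _ _ x)

theorem deckAddChar_eq_zero_iff {x : Z2} :
    deckAddChar M x = 0 ↔ (Submodule.Quotient.mk x : DualDeck M) = 0 := by
  constructor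
  · intro h
    refine mk_eq_zero_of_deckChar_eq_one M fun t => ?_
    rw [← deckChar_out]
    exact DFunLike.congr_fun h (Submodule.Quotient.mk t)
  · intro h
    ext g
    change deckChar M (Quotient.out g) x = 1
    rw [deckChar_eq_of_mk_eq M _ (y := 0) (by rw [h, Submodule.Quotient.mk_zero]),
      deckChar_zero_right]

theorem sum_deckChar (x : Z2) : ∑ g : Deck M, deckChar M (Quotient.out g) x =
    if (Submodule.Quotient.mk x : DualDeck M) = 0 then (Fintype.card (Deck M) : ℂ) else 0 := by
  classical
  refine (AddChar.sum_eq_ite (deckAddChar M x)).trans ?_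
  simp only [deckAddChar_eq_zero_iff]

variable (θ : ℝ)

/-- The spectral subspace of `B` for the character `j` of `G`. -/
def homog (j : DualDeck M) : Submodule ℂ (QuantumTorus θ) where
  carrier := {b | ∀ t, deckTilde M θ t b = deckChar M t (sect M j) • b}
  add_mem' := fun ha hb t => by rw [map_add, ha t, hb t, smul_add]
  zero_mem' := fun t => by simp
  smul_mem' := fun c a ha t => by rw [map_smul, ha t, smul_comm]

variable {M θ}

theorem W_mem_homog (x : Z2) : W θ x ∈ homog M θ (Submodule.Quotient.mk x) := fun t => by
  rw [deckTilde_W, deckChar_eq_of_mk_eq M t (mk_sect M _)]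

theorem mem_homog_zero_iff {a : QuantumTorus θ} : a ∈ homog M θ 0 ↔ a ∈ fixedAlg M θ := by
  constructor
  · intro h g
    have hg := h (Quotient.out g)
    rwa [sect_zero, deckChar_zero_right, one_smul] at hg
  · intro h t
    rw [sect_zero, deckChar_zero_right, one_smul, ← deckAction_mk]
    exact h _

theorem mul_mem_homog {j k : DualDeck M} {a b : QuantumTorus θ} (ha : a ∈ homog M θ j)
    (hb : b ∈ homog M θ k) : a * b ∈ homog M θ (j + k) := fun t => by
  have hchar : deckChar M t (sect M (j + k)) =
      deckChar M t (sect M j) * deckChar M t (sect M k) := by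
    rw [← deckChar_add_right]
    exact deckChar_eq_of_mk_eq M t (by rw [Submodule.Quotient.mk_add, mk_sect, mk_sect, mk_sect])
  rw [map_mul, ha t, hb t, smul_mul_smul_comm, hchar]

instance : StarGraded (homog M θ) where
  star_mem := fun {j b} hb t => by
    have hchar : deckChar M t (sect M (-j)) = star (deckChar M t (sect M j)) := by
      rw [← deckChar_neg_right]
      exact deckChar_eq_of_mk_eq M t (by rw [Submodule.Quotient.mk_neg, mk_sect, mk_sect])
    rw [map_star, hb t, star_smul, hchar]

theorem isGradedFrame_frame : IsGradedFrame (homog M θ) (fixedAlg M θ) (frame M θ) where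
  mem_iff := mem_homog_zero_iff.symm
  frame_mem _ t := deckTilde_W M θ t _
  frame_zero := by ext; simp [frame, sect_zero, W_zero]

variable (M θ)

/-- The automorphism `deckTilde M θ t` of `B` as a bounded linear map. -/
def deckCLM (t : Z2) : QuantumTorus θ →L[ℂ] QuantumTorus θ where
  toLinearMap := (deckTilde M θ t).toAlgHom.toLinearMap
  cont := map_continuous (deckTilde M θ t)

/-- The projection of `B` onto the spectral subspace of the character `j`, obtained by averaging
over `G`. -/
def specProj (j : DualDeck M) : QuantumTorus θ →L[ℂ] QuantumTorus θ :=
  (Fintype.card (Deck M) : ℂ)⁻¹ • ∑ g : Deck M, star (deckChar M (Quotient.out g) (sect M j)) •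
    deckCLM M θ (Quotient.out g)

variable {M θ}

theorem specProj_of_mem {j k : DualDeck M} {b : QuantumTorus θ} (hb : b ∈ homog M θ k) :
    specProj M θ j b = if k = j then b else 0 := by
  have hterm (g : Deck M) : star (deckChar M (Quotient.out g) (sect M j)) •
      deckCLM M θ (Quotient.out g) b =
        deckChar M (Quotient.out g) (-sect M j + sect M k) • b := by
    change _ • deckTilde M θ (Quotient.out g) b = _
    rw [hb, smul_smul, deckChar_add_right, deckChar_neg_right]
  have hcard : (Fintype.card (Deck M) : ℂ) ≠ 0 := by exact_mod_cast Fintype.card_ne_zero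
  have hdeg : -j + k = 0 ↔ k = j := by rw [neg_add_eq_zero, eq_comm]
  simp only [specProj, smul_apply, sum_apply, hterm, ← Finset.sum_smul, sum_deckChar,
    Submodule.Quotient.mk_add, Submodule.Quotient.mk_neg, mk_sect, hdeg]
  split_ifs
  · rw [smul_smul, inv_mul_cancel₀ hcard, one_smul]
  · rw [zero_smul, smul_zero]

theorem specProj_W (j : DualDeck M) (x : Z2) :
    specProj M θ j (W θ x) = if Submodule.Quotient.mk x = j then W θ x else 0 :=
  specProj_of_mem (W_mem_homog x)

theorem sum_specProj : ∑ j, specProj M θ j = ContinuousLinearMap.id ℂ (QuantumTorus θ) :=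
  torus_ext fun x => by simp [specProj_W]

theorem specProj_mem (j : DualDeck M) (b : QuantumTorus θ) : specProj M θ j b ∈ homog M θ j := by
  intro t
  refine DFunLike.congr_fun (f := deckCLM M θ t ∘L specProj M θ j)
    (g := deckChar M t (sect M j) • specProj M θ j) (torus_ext fun x => ?_) b
  change deckTilde M θ t (specProj M θ j (W θ x)) = deckChar M t (sect M j) • specProj M θ j (W θ x)
  rw [specProj_W]
  split_ifs with hx
  · rw [← hx]
    exact W_mem_homog x t
  · rw [map_zero, smul_zero]

instance : SetLike.GradedMonoid (homog M θ) where
  one_mem := mem_homog_zero_iff.2 (one_mem _)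
  mul_mem _ _ _ _ := mul_mem_homog

theorem codRestrict_specProj_of_mem {j k : DualDeck M} (b : homog M θ k) :
    (specProj M θ j : QuantumTorus θ →ₗ[ℂ] QuantumTorus θ).codRestrict _ (specProj_mem j) b =
      if h : k = j then h ▸ b else 0 := by
  ext
  rw [LinearMap.codRestrict_apply]
  refine (specProj_of_mem b.2).trans ?_
  split_ifs with h
  · subst h; rfl
  · rfl

instance : GradedAlgebra (homog M θ) where
  __ := DirectSum.Decomposition.ofLinearMap (homog M θ)
    (∑ j, DirectSum.lof ℂ _ (fun j => homog M θ j) j ∘ₗ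
      (specProj M θ j : QuantumTorus θ →ₗ[ℂ] QuantumTorus θ).codRestrict _ (specProj_mem j))
    (by
      ext b
      simpa using DFunLike.congr_fun (sum_specProj (M := M) (θ := θ)) b)
    (by
      ext j b k
      simp only [LinearMap.comp_apply, LinearMap.sum_apply, DirectSum.coeLinearMap_lof,
        LinearMap.id_apply, codRestrict_specProj_of_mem]
      rw [Finset.sum_eq_single j]
      · simp
      · intro i _ hij
        simp [hij.symm]
      · simp)

end Grading

/-! ### The smooth noncommutative torus -/

section Schwartz

/-- The weight `1 + r₁² + r₂²` in the definition of Schwartz sequences. -/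
def wt (r : Z2) : ℝ := 1 + (r 0 : ℝ) ^ 2 + (r 1 : ℝ) ^ 2

theorem one_le_wt (r : Z2) : 1 ≤ wt r := by
  rw [wt]
  nlinarith [sq_nonneg (r 0 : ℝ), sq_nonneg (r 1 : ℝ)]

theorem wt_pos (r : Z2) : 0 < wt r := one_pos.trans_le (one_le_wt r)

theorem wt_pow_mul_norm_nonneg (r : Z2) (k : ℕ) (z : ℂ) : 0 ≤ wt r ^ k * ‖z‖ :=
  mul_nonneg (pow_nonneg (wt_pos r).le _) (norm_nonneg _)

theorem wt_neg (r : Z2) : wt (-r) = wt r := by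
  simp [wt]

theorem wt_add_le (r s : Z2) : wt (r + s) ≤ 2 * (wt r * wt s) := by
  simp only [wt, Pi.add_apply]
  push_cast
  nlinarith [sq_nonneg ((r 0 : ℝ) - s 0), sq_nonneg ((r 1 : ℝ) - s 1),
    mul_nonneg (add_nonneg (sq_nonneg (r 0 : ℝ)) (sq_nonneg (r 1 : ℝ)))
      (add_nonneg (sq_nonneg (s 0 : ℝ)) (sq_nonneg (s 1 : ℝ)))]

theorem summable_inv_one_add_int_sq : Summable fun n : ℤ => (1 + (n : ℝ) ^ 2)⁻¹ := by
  refine Summable.of_norm_bounded_eventually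
    (Real.summable_one_div_int_pow (p := 2).2 one_lt_two) ?_
  filter_upwards [(Set.finite_singleton (0 : ℤ)).compl_mem_cofinite] with n (hn : n ≠ 0)
  rw [Real.norm_of_nonneg (by positivity), one_div]
  exact inv_anti₀ (by positivity) (by linarith)

theorem summable_inv_wt_sq : Summable fun r : Z2 => (wt r ^ 2)⁻¹ := by
  have hprod : Summable fun r : Z2 => (1 + (r 0 : ℝ) ^ 2)⁻¹ * (1 + (r 1 : ℝ) ^ 2)⁻¹ :=
    (finTwoArrowEquiv ℤ).summable_iff.2 <|
      summable_inv_one_add_int_sq.mul_of_nonneg summable_inv_one_add_int_sq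
        (fun n => by positivity) fun n => by positivity
  refine Summable.of_nonneg_of_le (fun r => by positivity) (fun r => ?_) hprod
  rw [← mul_inv]
  refine inv_anti₀ (by positivity) ?_
  rw [wt]
  nlinarith [sq_nonneg (r 0 : ℝ), sq_nonneg (r 1 : ℝ),
    mul_nonneg (sq_nonneg (r 0 : ℝ)) (sq_nonneg (r 1 : ℝ))]

theorem isSchwartz_iff_summable {α : Z2 → ℂ} :
    IsSchwartz α ↔ ∀ k : ℕ, Summable fun r => wt r ^ k * ‖α r‖ := by
  constructor
  · intro h k
    obtain ⟨b, hb⟩ := h (2 * (k + 2))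
    refine Summable.of_nonneg_of_le (fun r => wt_pow_mul_norm_nonneg r k _) (fun r => ?_)
      (summable_inv_wt_sq.mul_left (Real.sqrt b))
    have hsq : (wt r ^ (k + 2) * ‖α r‖) ^ 2 ≤ b := by
      rw [mul_pow, ← pow_mul, mul_comm (k + 2)]
      exact hb ⟨r, rfl⟩
    rw [← div_eq_mul_inv, le_div_iff₀ (pow_pos (wt_pos r) 2)]
    calc wt r ^ k * ‖α r‖ * wt r ^ 2 = wt r ^ (k + 2) * ‖α r‖ := by ring
      _ ≤ Real.sqrt b := Real.le_sqrt_of_sq_le hsq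
  · intro h k
    have hle (m : ℕ) (r : Z2) : wt r ^ m * ‖α r‖ ≤ ∑' s, wt s ^ m * ‖α s‖ :=
      (h m).le_tsum r fun s _ => wt_pow_mul_norm_nonneg s m _
    refine ⟨(∑' r, wt r ^ k * ‖α r‖) * ∑' r, wt r ^ 0 * ‖α r‖, ?_⟩
    rintro _ ⟨r, rfl⟩
    calc wt r ^ k * ‖α r‖ ^ 2 = (wt r ^ k * ‖α r‖) * (wt r ^ 0 * ‖α r‖) := by ring
      _ ≤ _ := mul_le_mul (hle k r) (hle 0 r) (wt_pow_mul_norm_nonneg r 0 _)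
        ((wt_pow_mul_norm_nonneg r k _).trans (hle k r))

theorem IsSchwartz.summable_norm {α : Z2 → ℂ} (h : IsSchwartz α) : Summable fun r => ‖α r‖ := by
  simpa using isSchwartz_iff_summable.1 h 0

theorem IsSchwartz.of_norm_le {α β : Z2 → ℂ} (h : IsSchwartz α) (hle : ∀ r, ‖β r‖ ≤ ‖α r‖) :
    IsSchwartz β := by
  rw [isSchwartz_iff_summable] at h ⊢
  exact fun k => Summable.of_nonneg_of_le (fun r => wt_pow_mul_norm_nonneg r k _)
    (fun r => mul_le_mul_of_nonneg_left (hle r) (pow_nonneg (wt_pos r).le _)) (h k)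

theorem IsSchwartz.star_neg {α : Z2 → ℂ} (h : IsSchwartz α) :
    IsSchwartz fun r => star (α (-r)) := by
  rw [isSchwartz_iff_summable] at h ⊢
  exact fun k => ((Equiv.neg Z2).summable_iff.2 (h k)).congr fun r => by simp [wt_neg]

/-- The reindexing `(t, r) ↦ (r, t - r)` of a double series by its diagonals `r + s = t`. -/
def diagEquiv : Z2 × Z2 ≃ Z2 × Z2 where
  toFun p := (p.2, p.1 - p.2)
  invFun p := (p.1 + p.2, p.1)
  left_inv p := by simp
  right_inv p := by simp

theorem IsSchwartz.summable_wt_pow_mul_diag {α β : Z2 → ℂ} (hα : IsSchwartz α)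
    (hβ : IsSchwartz β) (k : ℕ) :
    Summable fun p : Z2 × Z2 => wt p.1 ^ k * (‖α p.2‖ * ‖β (p.1 - p.2)‖) := by
  have hprod : Summable fun p : Z2 × Z2 => (wt p.1 ^ k * ‖α p.1‖) * (wt p.2 ^ k * ‖β p.2‖) :=
    (isSchwartz_iff_summable.1 hα k).mul_of_nonneg (isSchwartz_iff_summable.1 hβ k)
      (fun r => wt_pow_mul_norm_nonneg r k _) fun r => wt_pow_mul_norm_nonneg r k _
  refine Summable.of_nonneg_of_le (fun p => ?_) (fun p => ?_)
    ((diagEquiv.summable_iff.2 hprod).mul_left (2 ^ k))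
  · exact mul_nonneg (pow_nonneg (wt_pos _).le _) (by positivity)
  · change _ ≤ 2 ^ k * ((wt p.2 ^ k * ‖α p.2‖) * (wt (p.1 - p.2) ^ k * ‖β (p.1 - p.2)‖))
    have hwt : wt p.1 ≤ 2 * (wt p.2 * wt (p.1 - p.2)) := by
      simpa using wt_add_le p.2 (p.1 - p.2)
    calc _ ≤ (2 * (wt p.2 * wt (p.1 - p.2))) ^ k * (‖α p.2‖ * ‖β (p.1 - p.2)‖) :=
          mul_le_mul_of_nonneg_right (pow_le_pow_left₀ (wt_pos _).le hwt k) (by positivity)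
      _ = _ := by rw [mul_pow, mul_pow]; ring

variable {θ : ℝ}

theorem norm_W (r : Z2) : ‖W θ r‖ = ‖(1 : QuantumTorus θ)‖ := by
  simpa using CStarRing.norm_mul_coe_unitary (1 : QuantumTorus θ) ⟨W θ r, W_mem_unitary θ r⟩

theorem norm_sigmaTheta (x y : Z2) : ‖sigmaTheta θ x y‖ = 1 := by
  rw [sigmaTheta, Complex.norm_exp]
  simp

theorem IsSchwartz.summable_norm_W {α : Z2 → ℂ} (h : IsSchwartz α) :
    Summable fun r => ‖α r • W θ r‖ := by
  simp only [norm_smul, norm_W]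
  exact h.summable_norm.mul_right _

variable (θ) in
/-- The twisted convolution of two sequences on `ℤ²`: the Fourier coefficients of a product. -/
def twistedConv (α β : Z2 → ℂ) (t : Z2) : ℂ :=
  ∑' r, α r * β (t - r) * sigmaTheta θ r (t - r)

theorem IsSchwartz.summable_norm_twisted {α β : Z2 → ℂ} (hα : IsSchwartz α) (hβ : IsSchwartz β)
    (t : Z2) : Summable fun r => ‖α r * β (t - r) * sigmaTheta θ r (t - r)‖ := by
  simpa [norm_sigmaTheta] using (hα.summable_wt_pow_mul_diag hβ 0).prod_factor t

theorem IsSchwartz.twistedConv {α β : Z2 → ℂ} (hα : IsSchwartz α) (hβ : IsSchwartz β) :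
    IsSchwartz (twistedConv θ α β) := by
  rw [isSchwartz_iff_summable]
  intro k
  refine Summable.of_nonneg_of_le (fun t => wt_pow_mul_norm_nonneg t k _) (fun t => ?_)
    (hα.summable_wt_pow_mul_diag hβ k).prod
  change wt t ^ k * _ ≤ ∑' r, wt t ^ k * (‖α r‖ * ‖β (t - r)‖)
  rw [tsum_mul_left]
  refine mul_le_mul_of_nonneg_left ?_ (pow_nonneg (wt_pos t).le _)
  refine (norm_tsum_le_tsum_norm (hα.summable_norm_twisted hβ t)).trans_eq
    (tsum_congr fun r => ?_)
  rw [norm_mul, norm_mul, norm_sigmaTheta, mul_one]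

theorem hasSum_twistedConv_smul_W {α β : Z2 → ℂ} {a b : QuantumTorus θ} (hα : IsSchwartz α)
    (hβ : IsSchwartz β) (ha : HasSum (fun r => α r • W θ r) a)
    (hb : HasSum (fun r => β r • W θ r) b) :
    HasSum (fun t => twistedConv θ α β t • W θ t) (a * b) := by
  have hprod : Summable fun p : Z2 × Z2 => (α p.1 • W θ p.1) * (β p.2 • W θ p.2) :=
    summable_mul_of_summable_norm (f := fun r => α r • W θ r) (g := fun r => β r • W θ r)
      hα.summable_norm_W hβ.summable_norm_W
  refine HasSum.prod_fiberwise (diagEquiv.hasSum_iff.2 (ha.mul hb hprod)) fun t => ?_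
  have hconv : HasSum (fun r => α r * β (t - r) * sigmaTheta θ r (t - r)) (twistedConv θ α β t) :=
    (Summable.of_norm (hα.summable_norm_twisted hβ t)).hasSum
  convert hconv.smul_const (W θ t) using 2 with r
  change (α r • W θ r) * (β (t - r) • W θ (t - r)) = _
  rw [smul_mul_smul_comm, W_mul, smul_smul, add_sub_cancel]

theorem W_mem_smoothTorus (r : Z2) : W θ r ∈ smoothTorus θ := by
  refine ⟨Pi.single r 1, isSchwartz_single r, ?_⟩
  convert hasSum_ite_eq r (W θ r) using 2 with s
  rcases eq_or_ne s r with rfl | hs <;> simp [*]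

variable (θ) in
/-- The smooth noncommutative torus `𝒯_B` as a ⋆-subalgebra of `B`. -/
def smoothSubalgebra : StarSubalgebra ℂ (QuantumTorus θ) where
  carrier := smoothTorus θ
  mul_mem' := by
    rintro a b ⟨α, hα, ha⟩ ⟨β, hβ, hb⟩
    exact ⟨_, hα.twistedConv hβ, hasSum_twistedConv_smul_W hα hβ ha hb⟩
  add_mem' := by
    rintro a b ⟨α, hα, ha⟩ ⟨β, hβ, hb⟩
    exact ⟨α + β, hα.add hβ, by simpa [add_smul] using ha.add hb⟩
  algebraMap_mem' := fun c => by
    obtain ⟨α, hα, h⟩ := W_mem_smoothTorus (θ := θ) 0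
    refine ⟨c • α, hα.smul c, ?_⟩
    rw [Algebra.algebraMap_eq_smul_one, ← W_zero]
    simpa [mul_smul] using h.const_smul c
  star_mem' := by
    rintro a ⟨α, hα, ha⟩
    refine ⟨_, hα.star_neg, ?_⟩
    convert (Equiv.neg Z2).hasSum_iff.2 ha.star using 2 with r
    simp [W_star]

theorem W_mem_smoothSubalgebra (r : Z2) : W θ r ∈ smoothSubalgebra θ := W_mem_smoothTorus r

theorem dense_smoothSubalgebra : Dense (smoothSubalgebra θ : Set (QuantumTorus θ)) := by
  have hle : Submodule.span ℂ (Set.range (W θ)) ≤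
      Subalgebra.toSubmodule (smoothSubalgebra θ).toSubalgebra :=
    Submodule.span_le.2 (Set.range_subset_iff.2 W_mem_smoothTorus)
  exact dense_trigPoly.mono hle

variable {M : Matrix (Fin 2) (Fin 2) ℤ} [Fact (1 < M.det)]

theorem specProj_mem_smoothSubalgebra (j : DualDeck M) {b : QuantumTorus θ}
    (hb : b ∈ smoothSubalgebra θ) : specProj M θ j b ∈ smoothSubalgebra θ := by
  obtain ⟨α, hα, hsum⟩ := hb
  refine ⟨fun r => if Submodule.Quotient.mk r = j then α r else 0, hα.of_norm_le fun r => ?_, ?_⟩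
  · split_ifs <;> simp
  · convert hsum.mapL (specProj M θ j) using 2 with r
    rw [map_smul, specProj_W]
    split_ifs with hr <;> simp [hr]

variable {K : Type*} [NormedAddCommGroup K] [InnerProductSpace ℂ K] [CompleteSpace K]
  (π₀ : fixedAlg M θ →⋆ₐ[ℂ] (K →L[ℂ] K)) (hπ₀ : Function.Injective π₀)

/-- The inverse `B ≃ A ⋊ Ĝ` of the isomorphism `Φ`. -/
abbrev torusEquiv : QuantumTorus θ ≃⋆ₐ[ℂ] reducedCrossedProduct (coveringPair M θ) π₀ :=
  isGradedFrame_frame.regularEquiv π₀ hπ₀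

theorem torusEquiv_symm_crossedElem (a : fixedAlg M θ) (j : DualDeck M) :
    (torusEquiv π₀ hπ₀).symm (crossedElem (coveringPair M θ) π₀ a j) =
      (a : QuantumTorus θ) * (frame M θ j : QuantumTorus θ) :=
  isGradedFrame_frame.regularEquiv_symm_crossedElem π₀ hπ₀ a j

theorem crossedSmooth_eq_preimage :
    crossedSmooth (coveringPair M θ) π₀ (smoothFixed M θ) =
      (torusEquiv π₀ hπ₀).symm ⁻¹' smoothSubalgebra θ := by
  ext c
  constructor
  · rintro ⟨f, hf, rfl⟩
    rw [Set.mem_preimage, SetLike.mem_coe, map_sum]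
    refine sum_mem fun j _ => ?_
    rw [torusEquiv_symm_crossedElem]
    exact mul_mem (hf j) (W_mem_smoothSubalgebra _)
  · intro hc
    obtain ⟨b, rfl⟩ : ∃ b, torusEquiv π₀ hπ₀ b = c := ⟨_, StarAlgEquiv.apply_symm_apply _ c⟩
    rw [Set.mem_preimage, StarAlgEquiv.symm_apply_apply, SetLike.mem_coe] at hc
    refine ⟨fun j => isGradedFrame_frame.coeff j ⟨_, specProj_mem j b⟩, fun j => ?_, ?_⟩
    · exact mul_mem (specProj_mem_smoothSubalgebra j hc)
        (star_mem (W_mem_smoothSubalgebra _))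
    · apply EquivLike.injective (torusEquiv π₀ hπ₀).symm
      rw [StarAlgEquiv.symm_apply_apply, map_sum]
      conv_lhs => rw [← ContinuousLinearMap.id_apply (R₁ := ℂ) b, ← sum_specProj (M := M),
        sum_apply]
      refine Finset.sum_congr rfl fun j _ => ?_
      rw [torusEquiv_symm_crossedElem, isGradedFrame_frame.coe_coeff, mul_assoc,
        Unitary.coe_star_mul_self, mul_one]

end Schwartz

/-! ### The operator `D̃` in Fourier coordinates -/

section DiracTilde

variable (M : Matrix (Fin 2) (Fin 2) ℤ)

/-- The block of `D̃` at the Fourier mode `m` and the point `g` of `Ĝ`, for `i = (m, g)`. -/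
def torusBlock (i : Z2 × DualDeck M) :
    EuclideanSpace ℂ (Fin 2 ⊕ Fin 2) →L[ℂ] EuclideanSpace ℂ (Fin 2 ⊕ Fin 2) :=
  diracBlock (lengthFun M i.2) (2 * Real.pi * i.1.toComplex)

theorem eps_isHermitian (x : Z2) : (eps x).IsHermitian := by
  ext i j
  fin_cases i <;> fin_cases j <;> simp [eps, sub_eq_add_neg]

theorem eps_mul_self (x : Z2) :
    eps x * eps x = ((‖x.toComplex‖ ^ 2 : ℝ) : ℂ) • (1 : Matrix (Fin 2) (Fin 2) ℂ) := by
  have hnorm : ((‖x.toComplex‖ ^ 2 : ℝ) : ℂ) =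
      ((x 0 : ℂ) + Complex.I * x 1) * ((x 0 : ℂ) - Complex.I * x 1) := by
    rw [Complex.ofReal_pow, ← Complex.mul_conj', ← Complex.star_def, Z2.star_toComplex,
      Z2.toComplex]
  rw [hnorm]
  simp only [eps, Matrix.mul_fin_two, Matrix.one_fin_two, Matrix.smul_of, Matrix.smul_cons,
    Matrix.smul_empty, smul_eq_mul, mul_one, mul_zero, zero_mul, zero_add, add_zero]
  rw [mul_comm ((x 0 : ℂ) - Complex.I * x 1)]

theorem Z2.norm_toComplex_sq (n : Z2) : ‖n.toComplex‖ ^ 2 = (n 0 : ℝ) ^ 2 + (n 1 : ℝ) ^ 2 := by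
  rw [← Complex.normSq_eq_norm_sq, Complex.normSq_apply]
  simp [Z2.toComplex]
  ring

theorem Z2.norm_le_norm_toComplex (n : Z2) : ‖n‖ ≤ ‖n.toComplex‖ := by
  refine (pi_norm_le_iff_of_nonneg (norm_nonneg _)).2 fun k => ?_
  refine le_of_sq_le_sq ?_ (norm_nonneg _)
  rw [Z2.norm_toComplex_sq, Int.norm_eq_abs, sq_abs]
  fin_cases k
  · exact le_add_of_nonneg_right (sq_nonneg _)
  · exact le_add_of_nonneg_left (sq_nonneg _)

theorem Z2.norm_toComplex_le_wt (n : Z2) : ‖n.toComplex‖ ≤ wt n := by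
  rw [wt, add_assoc, ← Z2.norm_toComplex_sq]
  nlinarith [sq_nonneg (‖n.toComplex‖ - 1), norm_nonneg n.toComplex]

theorem norm_two_pi_mul (z : ℂ) : ‖2 * Real.pi * z‖ = 2 * Real.pi * ‖z‖ := by
  simp [abs_of_pos Real.pi_pos]

theorem torusBlock_isSelfAdjoint (i : Z2 × DualDeck M) : IsSelfAdjoint (torusBlock M i) :=
  diracBlock_isSelfAdjoint (eps_isHermitian _) _

theorem norm_torusBlock_sq (i : Z2 × DualDeck M) : ‖torusBlock M i‖ ^ 2 =
    ‖(sect M i.2).toComplex‖ ^ 2 + ‖2 * Real.pi * i.1.toComplex‖ ^ 2 :=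
  norm_diracBlock_sq (eps_isHermitian _) (eps_mul_self _) _

theorem torusBlock_mul_self (i : Z2 × DualDeck M) :
    torusBlock M i * torusBlock M i = ((‖torusBlock M i‖ ^ 2 : ℝ) : ℂ) • 1 := by
  rw [norm_torusBlock_sq, torusBlock, lengthFun, diracBlock_mul_self (eps_mul_self _),
    Complex.star_def, Complex.conj_mul']
  push_cast
  rfl

theorem norm_le_norm_torusBlock (i : Z2 × DualDeck M) : ‖i.1‖ ≤ ‖torusBlock M i‖ := by
  refine i.1.norm_le_norm_toComplex.trans (le_of_sq_le_sq ?_ (norm_nonneg _))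
  rw [norm_torusBlock_sq, norm_two_pi_mul]
  nlinarith [Real.pi_gt_three, sq_nonneg ‖(sect M i.2).toComplex‖, sq_nonneg ‖i.1.toComplex‖,
    mul_nonneg (sq_nonneg ‖i.1.toComplex‖) (sub_nonneg.2 Real.pi_gt_three.le)]

/-- The permutation of the index set `ℤ² × Ĝ` along which `W_r` acts as a weighted shift. -/
def shiftEquiv (r : Z2) : Z2 × DualDeck M ≃ Z2 × DualDeck M :=
  (Equiv.addLeft (-r)).prodCongr (Equiv.addLeft (-Submodule.Quotient.mk r))

variable [Fact (1 < M.det)]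

theorem tendsto_norm_torusBlock :
    Filter.Tendsto (fun i => ‖torusBlock M i‖) Filter.cofinite Filter.atTop := by
  have hfst : Filter.Tendsto (Prod.fst : Z2 × DualDeck M → Z2) Filter.cofinite Filter.cofinite :=
    Filter.Tendsto.cofinite_of_finite_preimage_singleton fun m =>
      ((Set.finite_singleton m).prod Set.finite_univ).subset fun i hi => ⟨hi, Set.mem_univ _⟩
  have hnorm : Filter.Tendsto (fun m : Z2 => ‖m‖) Filter.cofinite Filter.atTop := by
    rw [← Filter.cocompact_eq_cofinite]
    exact tendsto_norm_cocompact_atTop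
  exact Filter.tendsto_atTop_mono (norm_le_norm_torusBlock M) (hnorm.comp hfst)

theorem exists_norm_torusBlock_sub_le : ∃ C, ∀ r z,
    ‖torusBlock M z - torusBlock M (shiftEquiv M r z)‖ ≤ C * wt r := by
  obtain ⟨C, hC, hsub⟩ := exists_norm_diracBlock_sub_le (lengthFun M)
  refine ⟨C * (1 + 2 * Real.pi), fun r z => (hsub _ _ _ _).trans ?_⟩
  rw [mul_assoc C]
  refine mul_le_mul_of_nonneg_left ?_ hC
  have hdiff : (2 * Real.pi * z.1.toComplex - 2 * Real.pi * (-r + z.1).toComplex : ℂ) =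
      2 * Real.pi * r.toComplex := by
    simp only [Z2.toComplex, Pi.add_apply, Pi.neg_apply]
    push_cast
    ring
  change 1 + ‖(2 * Real.pi * z.1.toComplex - 2 * Real.pi * (-r + z.1).toComplex : ℂ)‖ ≤ _
  rw [hdiff, norm_two_pi_mul, add_mul, one_mul]
  gcongr
  · exact one_le_wt r
  · exact r.norm_toComplex_le_wt

variable (θ : ℝ)

/-- The identification of `(L²(B) ⊗ ℓ²(Ĝ) ⊗ ℂ²)²` with `ℓ²(ℤ² × Ĝ, ℂ⁴)` by Fourier
coefficients. -/
def torusCoord : EquivHilb (DualDeck M) (L2B θ) ≃ₗᵢ[ℂ]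
    Ell2 (Z2 × DualDeck M) (EuclideanSpace ℂ (Fin 2 ⊕ Fin 2)) :=
  coord (fourier θ)

theorem diracTilde_eq_blockOp : diracTilde M θ = blockOp (torusCoord M θ) (torusBlock M) := by
  have hstar (n : Z2) :
      (2 * Real.pi * star n.toComplex : ℂ) = star (2 * Real.pi * n.toComplex) := by
    simp
  rw [diracTilde, diracPlus_eq_blockOp, diracMinus_eq_blockOp]
  simp only [hstar]
  exact equivDirac_eq_blockOp (fourier θ) _ _

/-- The operator `|D̃|`, whose blocks are scalars because those of `D̃` have scalar squares. -/
def absDiracTilde : EquivHilb (DualDeck M) (L2B θ) →ₗ.[ℂ] EquivHilb (DualDeck M) (L2B θ) :=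
  blockOp (torusCoord M θ) fun i => ((‖torusBlock M i‖ : ℝ) : ℂ) • 1

theorem isAbs_absDiracTilde : IsAbs (diracTilde M θ) (absDiracTilde M θ) := by
  rw [diracTilde_eq_blockOp, absDiracTilde]
  refine isAbs_blockOp _ (torusBlock_isSelfAdjoint M)
    (fun i => isPositive_real_smul_one (norm_nonneg _)) fun i => ?_
  rw [torusBlock_mul_self, smul_mul_smul_comm, one_mul, ← Complex.ofReal_mul, sq]

theorem fourier_repr_piTau_W {θ : ℝ} (r n : Z2) (y : L2B θ) :
    (fourier θ).repr (piTau θ (W θ r) y) n = sigmaTheta θ r n * (fourier θ).repr y (-r + n) := by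
  rw [HilbertBasis.repr_apply_apply, HilbertBasis.repr_apply_apply,
    ← ContinuousLinearMap.adjoint_inner_left, ← ContinuousLinearMap.star_eq_adjoint, ← map_star,
    W_star, fourier_apply, fourier_apply, piTau_iotaB, W_mul, iotaB_smul, inner_smul_left]
  congr 1
  rw [← Complex.star_def, sigmaTheta_star, sigmaTheta, thetaForm_neg_left]
  push_cast
  ring_nf

/-- The representation of `B` on `(L²(B) ⊗ ℓ²(Ĝ) ⊗ ℂ²)²` that corresponds to `π̂ × L̂` under `Φ`. -/
def hatHom : QuantumTorus θ →⋆ₐ[ℂ]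
    (EquivHilb (DualDeck M) (L2B θ) →L[ℂ] EquivHilb (DualDeck M) (L2B θ)) :=
  equivRepHom (homog M θ) (piTau θ) (piTau θ)

variable {M θ}

theorem hatHom_mul_frame (a : fixedAlg M θ) (j : DualDeck M) :
    hatHom M θ ((a : QuantumTorus θ) * (frame M θ j : QuantumTorus θ)) = hatRep M θ a j := by
  rw [hatHom, equivRepHom_of_mem _ _ _ (isGradedFrame_frame.mul_frame_mem a j), map_mul, hatRep]

theorem norm_sigmaTheta_smul_one_le {K : Type*} [NormedAddCommGroup K] [NormedSpace ℂ K]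
    (r n : Z2) : ‖sigmaTheta θ r n • (1 : K →L[ℂ] K)‖ ≤ 1 * wt r ^ 0 := by
  rw [norm_smul, norm_sigmaTheta, one_mul, pow_zero, mul_one]
  exact ContinuousLinearMap.norm_id_le

theorem hatHom_W (r : Z2) : hatHom M θ (W θ r) = blockShift (torusCoord M θ) (shiftEquiv M r)
    (fun z => sigmaTheta θ r z.1 • 1) (1 * wt r ^ 0)
    (fun z => norm_sigmaTheta_smul_one_le r z.1) := by
  rw [hatHom, equivRepHom_of_mem _ _ _ (W_mem_homog r)]
  ext1 x
  refine ell2_ext (torusCoord M θ) fun i => ?_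
  rw [blockShift_apply]
  refine PiLp.ext ?_
  rintro (k | k)
  · exact fourier_repr_piTau_W r i.1 _
  · exact fourier_repr_piTau_W r i.1 _

end DiracTilde

/-! ### Rapidly convergent series of weighted shifts -/

section Regularity

variable {I K H : Type*} [NormedAddCommGroup K] [InnerProductSpace ℂ K]
  [NormedAddCommGroup H] [InnerProductSpace ℂ H] [CompleteSpace H] (U : H ≃ₗᵢ[ℂ] Ell2 I K)
  (e : Z2 → I ≃ I) {α : Z2 → ℂ}

theorem summable_smul_blockShift (hα : IsSchwartz α) {Q : Z2 → I → K →L[ℂ] K} {C : ℝ} {p : ℕ}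
    (hQ : ∀ r z, ‖Q r z‖ ≤ C * wt r ^ p) :
    Summable fun r => α r • blockShift U (e r) (Q r) (C * wt r ^ p) (hQ r) := by
  refine Summable.of_norm_bounded ((isSchwartz_iff_summable.1 hα p).mul_left |C|) fun r => ?_
  rw [norm_smul]
  refine (mul_le_mul_of_nonneg_left (norm_blockShift_le _ _ _ _ _) (norm_nonneg _)).trans_eq ?_
  rw [abs_mul, abs_of_pos (pow_pos (wt_pos r) p)]
  ring

theorem isBddCommutator_tsum_blockShift (hα : IsSchwartz α) {L : I → K →L[ℂ] K}
    {Q Q' : Z2 → I → K →L[ℂ] K} {C C' : ℝ} {p p' : ℕ} (hQ : ∀ r z, ‖Q r z‖ ≤ C * wt r ^ p)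
    (hQ' : ∀ r z, ‖Q' r z‖ ≤ C' * wt r ^ p')
    (h : ∀ r z, Q' r z = L z * Q r z - Q r z * L (e r z)) :
    IsBddCommutator (blockOp U L)
      (∑' r, α r • blockShift U (e r) (Q r) (C * wt r ^ p) (hQ r))
      (∑' r, α r • blockShift U (e r) (Q' r) (C' * wt r ^ p') (hQ' r)) :=
  IsBddCommutator.hasSum (blockOp_isClosed U L)
    (fun r => (isBddCommutator_blockShift U L (e r) (hQ r) (hQ' r) (h r)).smul (α r))
    (summable_smul_blockShift U e hα hQ).hasSum (summable_smul_blockShift U e hα hQ').hasSum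

/-- A commutator with the scalar blocks `lam` multiplies the weights of the `r`-th shift by the
increments of `lam`, so it raises the degree `p` of their polynomial bound by one. -/
theorem memDomDelta_tsum_blockShift (hα : IsSchwartz α) {lam : I → ℝ} {B : ℝ}
    (hlam : ∀ r z, |lam z - lam (e r z)| ≤ B * wt r) (k : ℕ) :
    ∀ {Q : Z2 → I → K →L[ℂ] K} {C : ℝ} {p : ℕ} (hQ : ∀ r z, ‖Q r z‖ ≤ C * wt r ^ p),
      MemDomDelta (blockOp U fun i => (lam i : ℂ) • 1) k
        (∑' r, α r • blockShift U (e r) (Q r) (C * wt r ^ p) (hQ r)) := by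
  induction k with
  | zero => exact fun _ => trivial
  | succ k ih =>
    intro Q C p hQ
    have hQ' (r : Z2) (z : I) :
        ‖((lam z - lam (e r z) : ℝ) : ℂ) • Q r z‖ ≤ (B * C) * wt r ^ (p + 1) := by
      rw [norm_smul, Complex.norm_real, Real.norm_eq_abs]
      refine (mul_le_mul (hlam r z) (hQ r z) (norm_nonneg _)
        ((abs_nonneg _).trans (hlam r z))).trans_eq ?_
      ring
    refine ⟨_, isBddCommutator_tsum_blockShift U e hα hQ hQ' fun r z => ?_, ih hQ'⟩
    rw [smul_mul_assoc, one_mul, mul_smul_comm, mul_one, ← sub_smul, Complex.ofReal_sub]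

end Regularity

section SmoothElements

variable {θ : ℝ}

theorem map_eq_tsum_smul_map_W {H : Type*} [NormedAddCommGroup H] [InnerProductSpace ℂ H]
    [CompleteSpace H] (π : QuantumTorus θ →⋆ₐ[ℂ] (H →L[ℂ] H)) {α : Z2 → ℂ} {b : QuantumTorus θ}
    (h : HasSum (fun r => α r • W θ r) b) : π b = ∑' r, α r • π (W θ r) := by
  rw [← (h.map π (map_continuous π)).tsum_eq]
  refine tsum_congr fun r => ?_
  rw [Function.comp_apply, map_smul]

variable {M : Matrix (Fin 2) (Fin 2) ℤ} [Fact (1 < M.det)]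

theorem hatHom_eq_tsum {α : Z2 → ℂ} {b : QuantumTorus θ}
    (h : HasSum (fun r => α r • W θ r) b) :
    hatHom M θ b = ∑' r, α r • blockShift (torusCoord M θ) (shiftEquiv M r)
      (fun z => sigmaTheta θ r z.1 • 1) (1 * wt r ^ 0)
      (fun z => norm_sigmaTheta_smul_one_le r z.1) := by
  rw [map_eq_tsum_smul_map_W (hatHom M θ) h]
  refine tsum_congr fun r => ?_
  rw [hatHom_W]

theorem exists_isBddCommutator_hatHom {b : QuantumTorus θ} (hb : b ∈ smoothSubalgebra θ) :
    MemDomDeltaInf (absDiracTilde M θ) (hatHom M θ b) ∧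
    ∃ E, IsBddCommutator (diracTilde M θ) (hatHom M θ b) E ∧
      MemDomDeltaInf (absDiracTilde M θ) E := by
  obtain ⟨α, hα, hsum⟩ := hb
  obtain ⟨C, hsub⟩ := exists_norm_torusBlock_sub_le M
  have hincr (r : Z2) (z : Z2 × DualDeck M) :
      |‖torusBlock M z‖ - ‖torusBlock M (shiftEquiv M r z)‖| ≤ C * wt r :=
    (abs_norm_sub_norm_le _ _).trans (hsub r z)
  have hQ' (r : Z2) (z : Z2 × DualDeck M) :
      ‖sigmaTheta θ r z.1 • (torusBlock M z - torusBlock M (shiftEquiv M r z))‖ ≤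
        C * wt r ^ 1 := by
    rw [norm_smul, norm_sigmaTheta, one_mul, pow_one]
    exact hsub r z
  rw [hatHom_eq_tsum hsum]
  refine ⟨fun k => memDomDelta_tsum_blockShift _ _ hα hincr k _, _, ?_,
    fun k => memDomDelta_tsum_blockShift _ _ hα hincr k hQ'⟩
  rw [diracTilde_eq_blockOp]
  refine isBddCommutator_tsum_blockShift _ _ hα _ hQ' fun r z => ?_
  rw [mul_smul_comm, mul_one, smul_mul_assoc, one_mul, smul_sub]

end SmoothElements

/-! ### Elementary tensors -/

section Tensors

variable {ι G H : Type*} [Fintype G] [NormedAddCommGroup H] [InnerProductSpace ℂ H]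

open Classical in
theorem tens_apply (ξ : H) (g : G) (v : EuclideanSpace ℂ (Fin 2)) (p : G × Fin 2) :
    tens ξ g v p = if p.1 = g then v p.2 • ξ else 0 := rfl

theorem tens_smul (c : ℂ) (ξ : H) (g : G) (v : EuclideanSpace ℂ (Fin 2)) :
    tens (c • ξ) g v = c • tens ξ g v := by
  refine PiLp.ext fun p => ?_
  rw [PiLp.smul_apply, tens_apply, tens_apply, smul_ite, smul_zero, smul_comm]

theorem lengthMul_tens (ℓ : G → Matrix (Fin 2) (Fin 2) ℂ) (ξ : H) (g : G)
    (v : EuclideanSpace ℂ (Fin 2)) :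
    lengthMul ℓ (tens ξ g v) = tens ξ g (WithLp.toLp 2 ((ℓ g).mulVec v)) := by
  refine PiLp.ext fun p => ?_
  change ∑ k, ℓ p.1 p.2 k • tens ξ g v (p.1, k) = _
  simp only [tens_apply]
  by_cases h : p.1 = g
  · simp only [h, if_true, smul_smul, ← Finset.sum_smul]
    rfl
  · simp [h]

theorem tens_mem_graph {D : H →ₗ.[ℂ] H} {ξ : H} {c : ℂ} (h : (ξ, c • ξ) ∈ D.graph) (g : G)
    (v : EuclideanSpace ℂ (Fin 2)) (p : G × Fin 2) :
    (tens ξ g v p, c • tens ξ g v p) ∈ D.graph := by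
  rw [tens_apply]
  split_ifs with hp
  · have hsmul := D.graph.smul_mem (v p.2) h
    rwa [Prod.smul_mk, smul_comm] at hsmul
  · rw [smul_zero]
    exact D.graph.zero_mem

theorem equivDirac_tens {Dp Dm : H →ₗ.[ℂ] H} {ξ η : H} {c d : ℂ} (hξ : (ξ, c • ξ) ∈ Dp.graph)
    (hη : (η, d • η) ∈ Dm.graph) (ℓ : G → Matrix (Fin 2) (Fin 2) ℂ) (g h : G)
    (v w : EuclideanSpace ℂ (Fin 2)) :
    ((WithLp.toLp 2 (tens ξ g v, tens η h w) : EquivHilb G H),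
      (WithLp.toLp 2
        (tens ξ g (WithLp.toLp 2 ((ℓ g).mulVec v)) + d • tens η h w,
          c • tens ξ g v - tens η h (WithLp.toLp 2 ((ℓ h).mulVec w))) : EquivHilb G H)) ∈
      (equivDirac Dp Dm ℓ).graph := by
  rw [mem_graph_equivDirac]
  refine ⟨fun p => ?_, fun p => ?_⟩
  · change (_, (c • tens ξ g v - tens η h _) p + lengthMul ℓ (tens η h w) p) ∈ _
    rw [lengthMul_tens, PiLp.sub_apply, sub_add_cancel]
    exact tens_mem_graph hξ g v p
  · change (_, (tens ξ g _ + d • tens η h w) p - lengthMul ℓ (tens ξ g v) p) ∈ _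
    rw [lengthMul_tens, PiLp.add_apply, add_sub_cancel_left]
    exact tens_mem_graph hη h w p

theorem map_tens_neg_add {G : Type*} [AddCommGroup G] [Fintype G] (S : H →L[ℂ] H) (ξ : H)
    (j g : G) (v : EuclideanSpace ℂ (Fin 2)) (p : G × Fin 2) :
    S (tens ξ g v (-j + p.1, p.2)) = tens (S ξ) (j + g) v p := by
  classical
  rw [tens_apply, tens_apply, apply_ite S, map_smul, map_zero]
  exact if_congr neg_add_eq_iff_eq_add rfl rfl

theorem equivRep_tens {G : Type*} [AddCommGroup G] [Fintype G] (S T : H →L[ℂ] H) (j g h : G)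
    (ξ η : H) (v w : EuclideanSpace ℂ (Fin 2)) :
    equivRep S T j (WithLp.toLp 2 (tens ξ g v, tens η h w)) =
      WithLp.toLp 2 (tens (S ξ) (j + g) v, tens (T η) (j + h) w) :=
  equivHilb_ext (fun p => (equivRep_fst ..).trans (map_tens_neg_add S ξ j g v p))
    fun p => (equivRep_snd ..).trans (map_tens_neg_add T η j h w p)

variable (b : HilbertBasis ι ℂ H)

open Classical in
theorem repr_tens_basis (m n : ι) (g g' : G) (v : EuclideanSpace ℂ (Fin 2)) (k : Fin 2) :
    b.repr (tens (b m) g v (g', k)) n = if (n, g') = (m, g) then v k else 0 := by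
  rw [tens_apply]
  obtain rfl | hg := eq_or_ne g' g
  · obtain rfl | hn := eq_or_ne n m <;> simp [HilbertBasis.repr_self, *]
  · simp [hg]

open Classical in
theorem coord_symm_single (i : ι × G) (u : EuclideanSpace ℂ (Fin 2 ⊕ Fin 2)) :
    (coord b).symm (lp.single 2 i u) = WithLp.toLp 2
      (tens (b i.1) i.2 (WithLp.toLp 2 fun k => u (Sum.inl k)),
        tens (b i.1) i.2 (WithLp.toLp 2 fun k => u (Sum.inr k))) := by
  rw [LinearIsometryEquiv.symm_apply_eq]
  refine lp.ext (funext fun i' => PiLp.ext fun k => ?_)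
  have hsingle : (lp.single 2 i u : Ell2 (ι × G) (EuclideanSpace ℂ (Fin 2 ⊕ Fin 2))) i' k =
      if i' = i then u k else 0 := by
    obtain rfl | hi := eq_or_ne i' i
    · simp
    · simp [hi]
  rw [hsingle]
  rcases k with k | k
  · exact (repr_tens_basis b i.1 i'.1 i.2 i'.2 (WithLp.toLp 2 fun k => u (Sum.inl k)) k).symm
  · exact (repr_tens_basis b i.1 i'.1 i.2 i'.2 (WithLp.toLp 2 fun k => u (Sum.inr k)) k).symm

theorem equivHilb_clm_ext {S T : EquivHilb G H →L[ℂ] EquivHilb G H}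
    (h : ∀ m g v w, S (WithLp.toLp 2 (tens (b m) g v, tens (b m) g w)) =
      T (WithLp.toLp 2 (tens (b m) g v, tens (b m) g w))) : S = T := by
  classical
  let V : Ell2 (ι × G) (EuclideanSpace ℂ (Fin 2 ⊕ Fin 2)) →L[ℂ] EquivHilb G H :=
    (coord (G := G) b).symm.toContinuousLinearEquiv
  have hV (x : EquivHilb G H) : V (coord b x) = x := (coord b).symm_apply_apply x
  have hcomp : S.comp V = T.comp V := by
    refine lp.ext_continuousLinearMap ENNReal.ofNat_ne_top fun i => ?_
    ext1 u
    change S ((coord b).symm (lp.single 2 i u)) = T ((coord b).symm (lp.single 2 i u))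
    rw [coord_symm_single]
    exact h _ _ _ _
  ext1 x
  rw [← hV x]
  exact DFunLike.congr_fun hcomp (coord b x)

end Tensors

/-! ### The spectral triple on the crossed product -/

section DiracTensors

variable {θ : ℝ}

theorem basis_mem_graph_blockOp {ι H : Type*} [NormedAddCommGroup H] [InnerProductSpace ℂ H]
    (b : HilbertBasis ι ℂ H) (c : ι → ℂ) (n : ι) :
    (b n, c n • b n) ∈ (blockOp b.repr fun n => c n • 1).graph := by
  classical
  have hmem := mem_graph_blockOp_single b.repr (fun n => c n • (1 : ℂ →L[ℂ] ℂ)) n 1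
  rwa [smul_apply, one_apply_eq_self, lp.single_smul, map_smul, b.repr_symm_single] at hmem

theorem iotaB_W_mem_graph_diracPlus (n : Z2) :
    (iotaB θ (W θ n), (2 * Real.pi * ((n 0 : ℂ) + Complex.I * n 1)) • iotaB θ (W θ n)) ∈
      (diracPlus θ).graph := by
  rw [diracPlus_eq_blockOp, ← fourier_apply]
  exact basis_mem_graph_blockOp (fourier θ) _ n

theorem iotaB_W_mem_graph_diracMinus (n : Z2) :
    (iotaB θ (W θ n), (2 * Real.pi * ((n 0 : ℂ) - Complex.I * n 1)) • iotaB θ (W θ n)) ∈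
      (diracMinus θ).graph := by
  rw [diracMinus_eq_blockOp, ← fourier_apply, ← Z2.star_toComplex]
  exact basis_mem_graph_blockOp (fourier θ) (fun n => 2 * Real.pi * star n.toComplex) n

variable {M : Matrix (Fin 2) (Fin 2) ℤ} [Fact (1 < M.det)]

theorem diracTilde_tens (m n : Z2) (g h : DualDeck M) (v w : EuclideanSpace ℂ (Fin 2)) :
    ((WithLp.toLp 2 (tens (iotaB θ (W θ m)) g v, tens (iotaB θ (W θ n)) h w) :
        EquivHilb (DualDeck M) (L2B θ)),
      (WithLp.toLp 2
        (tens (iotaB θ (W θ m)) g (WithLp.toLp 2 ((lengthFun M g).mulVec v)) +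
            (2 * Real.pi * ((n 0 : ℂ) - Complex.I * n 1)) • tens (iotaB θ (W θ n)) h w,
          (2 * Real.pi * ((m 0 : ℂ) + Complex.I * m 1)) • tens (iotaB θ (W θ m)) g v -
            tens (iotaB θ (W θ n)) h (WithLp.toLp 2 ((lengthFun M h).mulVec w))) :
        EquivHilb (DualDeck M) (L2B θ))) ∈ (diracTilde M θ).graph :=
  equivDirac_tens (iotaB_W_mem_graph_diracPlus m) (iotaB_W_mem_graph_diracMinus n) _ g h v w

theorem diracTilde_isSelfAdjoint : IsSelfAdjoint (diracTilde M θ) := by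
  rw [diracTilde_eq_blockOp]
  exact blockOp_isSelfAdjoint _ (torusBlock_isSelfAdjoint M)

end DiracTensors

section CrossedRep

variable {M : Matrix (Fin 2) (Fin 2) ℤ} [Fact (1 < M.det)] {θ : ℝ}

theorem sigmaTheta_mul_sigmaTheta (x s m : Z2) :
    sigmaTheta θ x s * sigmaTheta θ (x + s) m = Complex.exp
      (-(Real.pi * Complex.I) * ((thetaForm θ x s + thetaForm θ (x + s) m : ℝ) : ℂ)) := by
  rw [sigmaTheta, sigmaTheta, ← Complex.exp_add]
  push_cast
  ring_nf

theorem piTau_WA_mul_frame (x : Z2) (j : DualDeck M) (m : Z2) :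
    (piTau θ (WA M θ x : QuantumTorus θ) * piTau θ (frame M θ j : QuantumTorus θ))
      (iotaB θ (W θ m)) =
    Complex.exp (-(Real.pi * Complex.I) *
      ((thetaForm θ (M.transpose.mulVec x) (sect M j) +
        thetaForm θ (M.transpose.mulVec x + sect M j) m : ℝ) : ℂ)) •
      iotaB θ (W θ (m + M.transpose.mulVec x + sect M j)) := by
  rw [← map_mul, piTau_iotaB]
  change iotaB θ (W θ (M.transpose.mulVec x) * W θ (sect M j) * W θ m) = _
  rw [W_mul, smul_mul_assoc, W_mul, smul_smul, iotaB_smul, sigmaTheta_mul_sigmaTheta,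
    add_assoc m, add_comm m]

theorem exists_W_eq_smul_WA_mul_frame (y : Z2) : ∃ (x : Z2) (j : DualDeck M) (c : ℂ),
    W θ y = c • ((WA M θ x : QuantumTorus θ) * (frame M θ j : QuantumTorus θ)) := by
  set j : DualDeck M := Submodule.Quotient.mk y
  obtain ⟨x, hx⟩ := (Submodule.Quotient.eq _).1 (mk_sect M j).symm
  rw [Matrix.mulVecLin_apply] at hx
  refine ⟨x, j, star (sigmaTheta θ (M.transpose.mulVec x) (sect M j)), ?_⟩
  change _ = _ • (W θ (M.transpose.mulVec x) * W θ (sect M j))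
  rw [W_mul, smul_smul, (Unitary.mem_iff.1 (sigmaTheta_mem_unitary θ _ _)).1, one_smul, hx,
    sub_add_cancel]

theorem torus_starAlgHom_ext {H : Type*} [NormedAddCommGroup H] [InnerProductSpace ℂ H]
    [CompleteSpace H] {S T : QuantumTorus θ →⋆ₐ[ℂ] (H →L[ℂ] H)}
    (h : ∀ y, S (W θ y) = T (W θ y)) : S = T := by
  ext1 b
  exact DFunLike.congr_fun (torus_ext (f := ⟨S.toAlgHom.toLinearMap, map_continuous S⟩)
    (g := ⟨T.toAlgHom.toLinearMap, map_continuous T⟩) h) b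

variable {K : Type*} [NormedAddCommGroup K] [InnerProductSpace ℂ K] [CompleteSpace K]
  (π₀ : fixedAlg M θ →⋆ₐ[ℂ] (K →L[ℂ] K))

theorem reducedCrossedProduct_starAlgHom_ext {H : Type*} [NormedAddCommGroup H]
    [InnerProductSpace ℂ H] [CompleteSpace H]
    (hπ₀ : Function.Injective π₀)
    {S T : reducedCrossedProduct (coveringPair M θ) π₀ →⋆ₐ[ℂ] (H →L[ℂ] H)}
    (h : ∀ x j, S (crossedElem (coveringPair M θ) π₀ (WA M θ x) j) =
      T (crossedElem (coveringPair M θ) π₀ (WA M θ x) j)) : S = T := by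
  let Ψ : QuantumTorus θ →⋆ₐ[ℂ] reducedCrossedProduct (coveringPair M θ) π₀ := torusEquiv π₀ hπ₀
  have hcomp : S.comp Ψ = T.comp Ψ := torus_starAlgHom_ext fun y => by
    obtain ⟨x, j, c, hy⟩ := exists_W_eq_smul_WA_mul_frame (M := M) (θ := θ) y
    have hΨ := (StarAlgEquiv.symm_apply_eq _).1 (torusEquiv_symm_crossedElem π₀ hπ₀ (WA M θ x) j)
    rw [hy, map_smul, map_smul]
    congr 1
    change S (torusEquiv π₀ hπ₀ _) = T (torusEquiv π₀ hπ₀ _)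
    rw [← hΨ, h]
  ext1 c
  have hc := DFunLike.congr_fun hcomp ((torusEquiv π₀ hπ₀).symm c)
  change S (torusEquiv π₀ hπ₀ _) = T (torusEquiv π₀ hπ₀ _) at hc
  rwa [StarAlgEquiv.apply_symm_apply] at hc

theorem continuous_torusEquiv (hπ₀ : Function.Injective π₀) : Continuous (torusEquiv π₀ hπ₀) :=
  (map_continuous (isGradedFrame_frame.regularHom π₀)).subtype_mk
    (isGradedFrame_frame.regularHom_mem π₀)

theorem dense_crossedSmooth (hπ₀ : Function.Injective π₀) :
    Dense (crossedSmooth (coveringPair M θ) π₀ (smoothFixed M θ)) := by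
  rw [crossedSmooth_eq_preimage π₀ hπ₀]
  refine ((EquivLike.surjective (torusEquiv π₀ hπ₀)).denseRange.dense_image
    (continuous_torusEquiv π₀ hπ₀) dense_smoothSubalgebra).mono ?_
  rintro _ ⟨b, hb, rfl⟩
  rwa [Set.mem_preimage, StarAlgEquiv.symm_apply_apply]

variable (hπ₀ : Function.Injective π₀)

/-- The representation `π̂ × L̂` of `A ⋊_r Ĝ`, transported from `B` along `Φ`. -/
def crossedRep : reducedCrossedProduct (coveringPair M θ) π₀ →⋆ₐ[ℂ]
    (EquivHilb (DualDeck M) (L2B θ) →L[ℂ] EquivHilb (DualDeck M) (L2B θ)) :=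
  (hatHom M θ).comp ((torusEquiv π₀ hπ₀).symm :
    reducedCrossedProduct (coveringPair M θ) π₀ →⋆ₐ[ℂ] QuantumTorus θ)

theorem crossedRep_apply (c : reducedCrossedProduct (coveringPair M θ) π₀) :
    crossedRep π₀ hπ₀ c = hatHom M θ ((torusEquiv π₀ hπ₀).symm c) := rfl

theorem crossedRep_crossedElem (a : fixedAlg M θ) (j : DualDeck M) :
    crossedRep π₀ hπ₀ (crossedElem (coveringPair M θ) π₀ a j) = hatRep M θ a j := by
  rw [crossedRep_apply, torusEquiv_symm_crossedElem, hatHom_mul_frame]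

theorem crossedRep_hasExplicitFormula : HasExplicitFormula M θ π₀ (crossedRep π₀ hπ₀) := by
  intro x j m n g h v w
  rw [crossedRep_crossedElem, hatRep, equivRep_tens, piTau_WA_mul_frame, piTau_WA_mul_frame,
    tens_smul, tens_smul]

theorem eq_crossedRep_of_hasExplicitFormula
    {R : reducedCrossedProduct (coveringPair M θ) π₀ →⋆ₐ[ℂ]
      (EquivHilb (DualDeck M) (L2B θ) →L[ℂ] EquivHilb (DualDeck M) (L2B θ))}
    (hR : HasExplicitFormula M θ π₀ R) : R = crossedRep π₀ hπ₀ := by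
  refine reducedCrossedProduct_starAlgHom_ext π₀ hπ₀ fun x j => ?_
  refine equivHilb_clm_ext (fourier θ) fun m g v w => ?_
  simp only [fourier_apply]
  rw [hR, crossedRep_hasExplicitFormula]

theorem isOddSpectralTriple_crossedRep :
    IsOddSpectralTriple (crossedSmooth (coveringPair M θ) π₀ (smoothFixed M θ))
      (crossedRep π₀ hπ₀) (diracTilde M θ) := by
  refine ⟨?_, dense_crossedSmooth π₀ hπ₀, diracTilde_isSelfAdjoint.dense_domain,
    diracTilde_isSelfAdjoint, ?_, fun a ha => ?_⟩
  · rw [crossedSmooth_eq_preimage π₀ hπ₀]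
    exact ⟨(smoothSubalgebra θ).comap ((torusEquiv π₀ hπ₀).symm :
      reducedCrossedProduct (coveringPair M θ) π₀ →⋆ₐ[ℂ] QuantumTorus θ), rfl⟩
  · rw [diracTilde_eq_blockOp]
    exact exists_isInvSqrtOneAddSq_blockOp _ (torusBlock_isSelfAdjoint M) (torusBlock_mul_self M)
      (tendsto_norm_torusBlock M)
  · rw [crossedSmooth_eq_preimage π₀ hπ₀] at ha
    obtain ⟨-, E, hE, -⟩ := exists_isBddCommutator_hatHom (M := M) ha
    exact ⟨E, hE⟩

theorem isRegularTriple_crossedRep :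
    IsRegularTriple (crossedSmooth (coveringPair M θ) π₀ (smoothFixed M θ))
      (crossedRep π₀ hπ₀) (diracTilde M θ) := by
  refine ⟨absDiracTilde M θ, isAbs_absDiracTilde M θ, fun a ha => ?_⟩
  rw [crossedSmooth_eq_preimage π₀ hπ₀] at ha
  exact exists_isBddCommutator_hatHom ha

end CrossedRep

end QTorus

end

theorem mainTheorem11_general (θ : ℝ) (M : Matrix (Fin 2) (Fin 2) ℤ)
    [Fact (1 < M.det)] {K : Type*} [NormedAddCommGroup K] [InnerProductSpace ℂ K] [CompleteSpace K]
    (π₀ : fixedAlg M θ →⋆ₐ[ℂ] (K →L[ℂ] K)) (hπ₀ : Function.Injective π₀) :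
    (∃ Φ : reducedCrossedProduct (coveringPair M θ) π₀ ≃⋆ₐ[ℂ] QuantumTorus θ,
      ∀ (a : fixedAlg M θ) (j : DualDeck M),
        Φ (crossedElem (coveringPair M θ) π₀ a j) =
          (a : QuantumTorus θ) * (frame M θ j : QuantumTorus θ)) ∧
    ∃ R : reducedCrossedProduct (coveringPair M θ) π₀ →⋆ₐ[ℂ]
        (EquivHilb (DualDeck M) (L2B θ) →L[ℂ] EquivHilb (DualDeck M) (L2B θ)),
      (∀ (a : fixedAlg M θ) (j : DualDeck M),
        R (crossedElem (coveringPair M θ) π₀ a j) = hatRep M θ a j) ∧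
      HasExplicitFormula M θ π₀ R ∧
      (∀ R' : reducedCrossedProduct (coveringPair M θ) π₀ →⋆ₐ[ℂ]
          (EquivHilb (DualDeck M) (L2B θ) →L[ℂ] EquivHilb (DualDeck M) (L2B θ)),
        HasExplicitFormula M θ π₀ R' → R' = R) ∧
      (∀ (m n : Z2) (g h : DualDeck M) (v w : EuclideanSpace ℂ (Fin 2)),
        ((WithLp.toLp 2 (tens (iotaB θ (W θ m)) g v, tens (iotaB θ (W θ n)) h w) :
            EquivHilb (DualDeck M) (L2B θ)),
          (WithLp.toLp 2
            (tens (iotaB θ (W θ m)) g (WithLp.toLp 2 ((lengthFun M g).mulVec v)) +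
                (2 * Real.pi * ((n 0 : ℂ) - Complex.I * n 1)) • tens (iotaB θ (W θ n)) h w,
              (2 * Real.pi * ((m 0 : ℂ) + Complex.I * m 1)) • tens (iotaB θ (W θ m)) g v -
                tens (iotaB θ (W θ n)) h (WithLp.toLp 2 ((lengthFun M h).mulVec w))) :
            EquivHilb (DualDeck M) (L2B θ))) ∈ (diracTilde M θ).graph) ∧
      IsOddSpectralTriple (crossedSmooth (coveringPair M θ) π₀ (smoothFixed M θ)) R
        (diracTilde M θ) ∧
      IsRegularTriple (crossedSmooth (coveringPair M θ) π₀ (smoothFixed M θ)) R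
        (diracTilde M θ) :=
  ⟨⟨(torusEquiv π₀ hπ₀).symm, torusEquiv_symm_crossedElem π₀ hπ₀⟩, crossedRep π₀ hπ₀,
    crossedRep_crossedElem π₀ hπ₀, crossedRep_hasExplicitFormula π₀ hπ₀,
    fun _ => eq_crossedRep_of_hasExplicitFormula π₀ hπ₀, diracTilde_tens,
    isOddSpectralTriple_crossedRep π₀ hπ₀, isRegularTriple_crossedRep π₀ hπ₀⟩

theorem mainTheorem11 (θ : ℝ) (hθ : Irrational θ) (M : Matrix (Fin 2) (Fin 2) ℤ)
    [Fact (1 < M.det)] {K : Type*} [NormedAddCommGroup K] [InnerProductSpace ℂ K] [CompleteSpace K]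
    (π₀ : fixedAlg M θ →⋆ₐ[ℂ] (K →L[ℂ] K)) (hπ₀ : Function.Injective π₀) :
    (∃ Φ : reducedCrossedProduct (coveringPair M θ) π₀ ≃⋆ₐ[ℂ] QuantumTorus θ,
      ∀ (a : fixedAlg M θ) (j : DualDeck M),
        Φ (crossedElem (coveringPair M θ) π₀ a j) =
          (a : QuantumTorus θ) * (frame M θ j : QuantumTorus θ)) ∧
    ∃ R : reducedCrossedProduct (coveringPair M θ) π₀ →⋆ₐ[ℂ]
        (EquivHilb (DualDeck M) (L2B θ) →L[ℂ] EquivHilb (DualDeck M) (L2B θ)),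
      (∀ (a : fixedAlg M θ) (j : DualDeck M),
        R (crossedElem (coveringPair M θ) π₀ a j) = hatRep M θ a j) ∧
      HasExplicitFormula M θ π₀ R ∧
      (∀ R' : reducedCrossedProduct (coveringPair M θ) π₀ →⋆ₐ[ℂ]
          (EquivHilb (DualDeck M) (L2B θ) →L[ℂ] EquivHilb (DualDeck M) (L2B θ)),
        HasExplicitFormula M θ π₀ R' → R' = R) ∧
      (∀ (m n : Z2) (g h : DualDeck M) (v w : EuclideanSpace ℂ (Fin 2)),
        ((WithLp.toLp 2 (tens (iotaB θ (W θ m)) g v, tens (iotaB θ (W θ n)) h w) :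
            EquivHilb (DualDeck M) (L2B θ)),
          (WithLp.toLp 2
            (tens (iotaB θ (W θ m)) g (WithLp.toLp 2 ((lengthFun M g).mulVec v)) +
                (2 * Real.pi * ((n 0 : ℂ) - Complex.I * n 1)) • tens (iotaB θ (W θ n)) h w,
              (2 * Real.pi * ((m 0 : ℂ) + Complex.I * m 1)) • tens (iotaB θ (W θ m)) g v -
                tens (iotaB θ (W θ n)) h (WithLp.toLp 2 ((lengthFun M h).mulVec w))) :
            EquivHilb (DualDeck M) (L2B θ))) ∈ (diracTilde M θ).graph) ∧
      IsOddSpectralTriple (crossedSmooth (coveringPair M θ) π₀ (smoothFixed M θ)) R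
        (diracTilde M θ) ∧
      IsRegularTriple (crossedSmooth (coveringPair M θ) π₀ (smoothFixed M θ)) R
        (diracTilde M θ) :=
  mainTheorem11_general θ M π₀ hπ₀
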